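/- Let $\alpha\in(0,1)\cup(1,\infty)$, $\epsilon,\delta,\Lambda\in(0,1)$, $n\ge 1$, and let $\rho\in\mathbb C^{2^n\times 2^n}$ be a quantum state all of whose non-zero eigenvalues are at least $\Lambda$. Let $R_\alpha(\rho)=\frac1{1-\alpha}\log_2\operatorname{tr}(\rho^\alpha)$, and put $\tau=[\operatorname{tr}(\rho^2)]^{\alpha-1}$ if $\alpha\in(0,1)\cup(2,\infty)$ and $\tau=\operatorname{tr}(\rho^2)$ if $\alpha\in(1,2]$. **The algorithm.** Given $\alpha,\epsilon,\delta,\Lambda$, the value $\operatorname{tr}(\rho^2)$, and copies of $\rho$: 1. Set $\xi=\frac13\cdot\frac{\tau}{2}\min(|1-\alpha|\epsilon,1)$. 2. Set $K=\left\lceil\frac{\ln(\Lambda\xi/4)}{\ln(1-\Lambda)}+\alpha^2\right\rceil$, $w=\sum_{k=1}^K\left|\binom{\alpha-1}{k}\right|$, $L=\frac1{\Lambda^2}\ln\frac{4w}{\xi}$, and, for $0\le l\le\lfloor L\rfloor$, $M_l=\left\lceil\sqrt{\tfrac l2\ln\tfrac{4w}{\xi}}\right\rceil$, $D_l=\max\{0,\lfloor\frac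 l2\rfloor-M_l\}$, $U_l=\min\{l,\lceil\frac l2\rceil+M_l\}$. Let $b^{(k)}_l$ be the coefficients of $\left(\frac{\arcsin y}{\pi/2}\right)^k=\sum_l b_l^{(k)}y^l$. 3. For $0\le l\le\lfloor L\rfloor$ and $D_l\le s\le U_l$ set $f(s,l)=2^{-l}\binom ls\sum_{k=1}^K(-1)^k b_l^{(k)}\binom{\alpha-1}{k}$ and $t(s,l)=\frac{(2s-l)\pi}2$. Set $\|\mathbf f\|_1=\sum_{l,s}|f(s,l)|$, $\varepsilon=\xi/\|\mathbf f\|_1$ and $N=\sum_{l=0}^{\lfloor L\rfloor}(2M_l+1)$. 4. Draw $B=\left\lceil 2\varepsilon^{-2}\ln(2/\delta)\right\rceil$ independent pairs $(s_j,l_j)$, each pair $(s,l)$ having probability $|f(s,l)|/\|\mathbf f\|_1$. 5. For each $j$, let $t=t(s_j,l_j)$ and $Q=\lceil t^2/\varepsilon\rceil$. Take the following circuit on one measured qubit, a few ancilla qubits and $Q+1$ registers, each prepared in state $\rho$: a Hadamard gate on the measured qubit; the operators $e^{-i\mathcal S_{1,r}t/Q}$, $r=2,\dots,Q+1$, controlled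 on the measured qubit, where $\mathcal S_{1,r}$ swaps registers $1$ and $r$, and where $e^{-i\mathcal S\Delta}=\cos(\Delta)I-i\sin(\Delta)\mathcal S$ is implemented as a linear combination of unitaries followed by one round of oblivious amplitude amplification, all decomposed into single/two-qubit gates; a Hadamard gate on the measured qubit. Execute this circuit $\left\lceil16\,\varepsilon^{-2}\ln(4N/\delta)\right\rceil$ times, measuring the measured qubit in the computational basis, and let $\mathrm{est}_j$ be the fraction of outcomes $0$ minus the fraction of outcomes $1$. 6. Output $\frac1{1-\alpha}\log_2\left(1+\frac{\|\mathbf f\|_1}{B}\sum_{j=1}^B\operatorname{sgn}(f(s_j,l_j))\,\mathrm{est}_j\right)$. **Claim.** With probability at least $1-\delta$ the output differs from $R_\alpha(\rho)$ by at most $\epsilon$. Moreover, on every run, the number of copies of $\rho$ used is $$\widetilde O\left(\frac{w^5}{|1-\alpha|^5[\operatorname{tr}(\rho^2)]^{5(\alpha-1)}\epsilon^5\Lambda^2}\right)\ \text{ if }\alpha\in(0,1)\cup(2,\infty),\qquad \widetilde O\left(\frac{w^5}{|1-\alpha|^5[\operatorname{tr}(\rho^2)]^{5}\epsilon^5\Lambda^2}\right)\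 \text{ if }\alpha\in(1,2],$$ and the total number of single/two-qubit gates in the circuits of the $B$ sampled terms (each circuit counted once for its repeated executions) is $$\widetilde O\left(\frac{n\,w^3}{|1-\alpha|^3[\operatorname{tr}(\rho^2)]^{3(\alpha-1)}\epsilon^3\Lambda^2}\right)\ \text{ if }\alpha\in(0,1)\cup(2,\infty),\qquad \widetilde O\left(\frac{n\,w^3}{|1-\alpha|^3[\operatorname{tr}(\rho^2)]^{3}\epsilon^3\Lambda^2}\right)\ \text{ if }\alpha\in(1,2].$$ Here $\widetilde O(X)$ means at most $C\,X\left(\ln\left(2+\frac{w}{|1-\alpha|\,\tau\,\epsilon\,\Lambda\,\delta}\right)\right)^{c}$ with absolute constants $C>0$ and $c\in\mathbb N$. -/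

import Mathlib

noncomputable section

namespace RenyiEst

open scoped ComplexOrder

/-! ### Quantum states and entropies -/

/-- Computational basis labels of an `n`-qubit register. -/
abbrev Bits (n : ℕ) : Type := Fin n → Bool

/-- `ρ` is a density matrix: positive semidefinite with unit trace. -/
def IsState {n : ℕ} (ρ : Matrix (Bits n) (Bits n) ℂ) : Prop :=
  ρ.PosSemidef ∧ ρ.trace = 1

/-- The eigenvalues of a state, with multiplicity. -/
def eig {n : ℕ} {ρ : Matrix (Bits n) (Bits n) ℂ} (hρ : IsState ρ) : Bits n → ℝ :=
  hρ.1.isHermitian.eigenvalues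

/-- `tr (ρ ^ α)`, for `α > 0`. -/
def tracePow {n : ℕ} {ρ : Matrix (Bits n) (Bits n) ℂ} (hρ : IsState ρ) (α : ℝ) : ℝ :=
  ∑ i, eig hρ i ^ α

/-- The quantum Rényi entropy of order `α`, in bits. -/
def renyiEntropy {n : ℕ} {ρ : Matrix (Bits n) (Bits n) ℂ} (hρ : IsState ρ) (α : ℝ) : ℝ :=
  1 / (1 - α) * Real.logb 2 (tracePow hρ α)

/-- The purity `tr (ρ ^ 2)`. -/
def purity {n : ℕ} (ρ : Matrix (Bits n) (Bits n) ℂ) : ℝ := ((ρ * ρ).trace).re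

/-! ### Circuits of single- and two-qubit gates -/

/-- A gate on qubits labelled by `W`: an arbitrary unitary on one qubit or on two
distinct qubits. -/
inductive Gate (W : Type) : Type
  | one (w : W) (u : Matrix.unitaryGroup Bool ℂ) : Gate W
  | two (v w : W) (h : v ≠ w) (u : Matrix.unitaryGroup (Bool × Bool) ℂ) : Gate W

/-- The inverse gate. -/
def Gate.inv {W : Type} : Gate W → Gate W
  | .one w u => .one w u⁻¹
  | .two v w h u => .two v w h u⁻¹

open scoped Classical in
/-- The action of a gate on all the qubits (identity on the qubits it does not touch). -/
def Gate.mat {W : Type} : Gate W → Matrix (W → Bool) (W → Bool) ℂ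
  | .one w u => fun x y =>
      if ∀ z, z ≠ w → x z = y z then u.1 (x w) (y w) else 0
  | .two v w _ u => fun x y =>
      if ∀ z, z ≠ v → z ≠ w → x z = y z then u.1 (x v, x w) (y v, y w) else 0

/-- A circuit: the list of its gates, the first one being applied first. -/
abbrev Circuit (W : Type) : Type := List (Gate W)

/-- The number of single/two-qubit gates of a circuit. -/
def Circuit.size {W : Type} (c : Circuit W) : ℕ := List.length c

/-- The inverse circuit. -/
def Circuit.inv {W : Type} (c : Circuit W) : Circuit W := (List.map Gate.inv c).reverse

/-- The unitary implemented by a circuit. -/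
def Circuit.mat {W : Type} [Fintype W] [DecidableEq W] :
    Circuit W → Matrix (W → Bool) (W → Bool) ℂ
  | [] => 1
  | g :: c => Circuit.mat c * g.mat

/-! ### Elementary gates -/

/-- The Pauli `X` gate. -/
def gX : Matrix.unitaryGroup Bool ℂ :=
  ⟨Matrix.of fun a b => if a = b then 0 else 1, by
    rw [Matrix.mem_unitaryGroup_iff]
    ext a b
    cases a <;> cases b <;> simp [Matrix.mul_apply, Matrix.star_apply]⟩

/-- The Hadamard gate. -/
def gH : Matrix.unitaryGroup Bool ℂ :=
  ⟨Matrix.of fun a b => if a && b then -((Real.sqrt 2 / 2 : ℝ) : ℂ) else ((Real.sqrt 2 / 2 : ℝ) : ℂ), by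
    have h : ((Real.sqrt 2 / 2 : ℝ) : ℂ) * ((Real.sqrt 2 / 2 : ℝ) : ℂ) = 1 / 2 := by
      rw [← Complex.ofReal_mul]
      have : Real.sqrt 2 / 2 * (Real.sqrt 2 / 2) = 1 / 2 := by
        have := Real.mul_self_sqrt (show (0 : ℝ) ≤ 2 by norm_num)
        nlinarith
      rw [this]; norm_num
    rw [Matrix.mem_unitaryGroup_iff]
    ext a b
    cases a <;> cases b <;>
      simp only [Matrix.mul_apply, Matrix.star_apply, Fintype.sum_bool, Matrix.of_apply,
        Bool.and_true, Bool.and_false, if_true, Bool.false_eq_true, if_false, Complex.star_def,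
        map_neg, Complex.conj_ofReal, neg_mul, mul_neg, neg_neg, h,
        Matrix.one_apply, reduceCtorEq] <;> norm_num⟩

/-- The phase gate `diag (1, exp (i θ))`. -/
def gPhase (θ : ℝ) : Matrix.unitaryGroup Bool ℂ :=
  ⟨Matrix.diagonal fun a => if a then Complex.exp (θ * Complex.I) else 1, by
    rw [Matrix.mem_unitaryGroup_iff, Matrix.star_eq_conjTranspose,
      Matrix.diagonal_conjTranspose, Matrix.diagonal_mul_diagonal, ← Matrix.diagonal_one]
    congr 1
    funext a
    cases a
    · simp
    · simp only [if_true, Pi.star_apply, Complex.star_def, Complex.mul_conj,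
        Complex.normSq_eq_norm_sq, Complex.norm_exp_ofReal_mul_I]
      norm_num⟩

/-- The Pauli `Z` gate. -/
def gZ : Matrix.unitaryGroup Bool ℂ := gPhase Real.pi

/-- The gate `S = diag (1, i)`. -/
def gS : Matrix.unitaryGroup Bool ℂ := gPhase (Real.pi / 2)

/-- The real rotation sending `|0⟩` to `cos φ |0⟩ + sin φ |1⟩` (that is, `R_y (2 φ)`). -/
def gRot (φ : ℝ) : Matrix.unitaryGroup Bool ℂ :=
  ⟨Matrix.of fun a b =>
      if a = b then ((Real.cos φ : ℝ) : ℂ)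
      else if a then ((Real.sin φ : ℝ) : ℂ) else -((Real.sin φ : ℝ) : ℂ), by
    have h : ((Real.cos φ : ℝ) : ℂ) * ((Real.cos φ : ℝ) : ℂ)
        + ((Real.sin φ : ℝ) : ℂ) * ((Real.sin φ : ℝ) : ℂ) = 1 := by
      rw [← Complex.ofReal_mul, ← Complex.ofReal_mul, ← Complex.ofReal_add,
        ← sq, ← sq, Real.cos_sq_add_sin_sq, Complex.ofReal_one]
    rw [Matrix.mem_unitaryGroup_iff]
    ext a b
    cases a <;> cases b <;>
      simp only [Matrix.mul_apply, Matrix.star_apply, Fintype.sum_bool, Matrix.of_apply,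
        if_true, Bool.false_eq_true, if_false, Complex.star_def, map_neg,
        Complex.conj_ofReal, Matrix.one_apply, reduceCtorEq] <;>
      first
        | linear_combination h
        | ring⟩

/-- The two-qubit gate applying `u₀` or `u₁` to the second qubit, according to whether
the first qubit is `0` or `1`. -/
def gCond (u₀ u₁ : Matrix.unitaryGroup Bool ℂ) : Matrix.unitaryGroup (Bool × Bool) ℂ :=
  ⟨Matrix.of fun p q => if p.1 = q.1 then (if p.1 then u₁.1 else u₀.1) p.2 q.2 else 0, by
    have h₀ := Matrix.mem_unitaryGroup_iff.1 u₀.2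
    have h₁ := Matrix.mem_unitaryGroup_iff.1 u₁.2
    rw [Matrix.mem_unitaryGroup_iff]
    ext ⟨a, b⟩ ⟨c, d⟩
    have e₀ := congrFun (congrFun h₀ b) d
    have e₁ := congrFun (congrFun h₁ b) d
    rw [Matrix.mul_apply] at e₀ e₁
    rw [Matrix.mul_apply, Fintype.sum_prod_type]
    cases a <;> cases c <;>
      simp_all [Matrix.star_apply, Matrix.one_apply]⟩

/-- The controlled version of a single-qubit gate (control on `1`). -/
def gCtl (u : Matrix.unitaryGroup Bool ℂ) : Matrix.unitaryGroup (Bool × Bool) ℂ := gCond 1 u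

/-- The version of a single-qubit gate controlled on `0`. -/
def gOctl (u : Matrix.unitaryGroup Bool ℂ) : Matrix.unitaryGroup (Bool × Bool) ℂ := gCond u 1

/-- The doubly controlled `Z` gate, out of two-qubit gates. -/
def ccZ {W : Type} (a b c : W) (hab : a ≠ b) (hac : a ≠ c) (hbc : b ≠ c) : Circuit W :=
  [.two b c hbc (gCtl gS), .two a b hab (gCtl gX), .two b c hbc (gCtl gS⁻¹),
    .two a b hab (gCtl gX), .two a c hac (gCtl gS)]

/-- The Toffoli gate with controls `a`, `b` and target `c`. -/
def toffoli {W : Type} (a b c : W) (hab : a ≠ b) (hac : a ≠ c) (hbc : b ≠ c) : Circuit W :=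
  [.one c gH] ++ ccZ a b c hab hac hbc ++ [.one c gH]

/-! ### The circuit estimating `tr (ρ cos (ρ t))` -/

/-- The qubits: four single qubits (the measured qubit, the two ancillas of the linear
combination of unitaries, one flag for the doubly controlled swaps) and `Q + 1` registers
of `n` qubits. Register `0` is the main register. -/
abbrev Wire (Q n : ℕ) : Type := Fin 4 ⊕ (Fin (Q + 1) × Fin n)

/-- The measured qubit. -/
abbrev wM {Q n : ℕ} : Wire Q n := Sum.inl 0
/-- The first ancilla. -/
abbrev wA {Q n : ℕ} : Wire Q n := Sum.inl 1
/-- The second ancilla. -/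
abbrev wB {Q n : ℕ} : Wire Q n := Sum.inl 2
/-- The flag. -/
abbrev wF {Q n : ℕ} : Wire Q n := Sum.inl 3
/-- The `i`-th qubit of register `r`. -/
abbrev wD {Q n : ℕ} (r : Fin (Q + 1)) (i : Fin n) : Wire Q n := Sum.inr (r, i)

/-- The main register and register `j + 1` are different. -/
theorem wD_ne {Q n : ℕ} (j : Fin Q) (i : Fin n) :
    (wD j.succ i : Wire Q n) ≠ wD 0 i := by
  intro h
  have h' := congrArg Prod.fst (Sum.inr.inj h)
  exact Fin.succ_ne_zero j h'

/-- The swap of qubit `i` of the main register with qubit `i` of register `j + 1`,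
controlled by the flag. -/
def cSwap {Q n : ℕ} (j : Fin Q) (i : Fin n) : Circuit (Wire Q n) :=
  [.two (wD j.succ i) (wD 0 i) (wD_ne j i) (gCtl gX)]
    ++ toffoli wF (wD 0 i) (wD j.succ i) (by simp) (by simp) (wD_ne j i).symm
    ++ [.two (wD j.succ i) (wD 0 i) (wD_ne j i) (gCtl gX)]

/-- If the measured qubit is `1`, apply `|0⟩⟨0| ⊗ I + |1⟩⟨1| ⊗ (- i sgn Δ) Swap`, with the
second ancilla as the selecting qubit, to the main register and register `j + 1`. -/
def cSelect {Q n : ℕ} (Δ : ℝ) (j : Fin Q) : Circuit (Wire Q n) :=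
  toffoli wM wB wF (by simp) (by simp) (by simp)
    ++ (List.finRange n).flatMap (fun i => cSwap j i)
    ++ toffoli wM wB wF (by simp) (by simp) (by simp)
    ++ [.two wM wB (by simp) (gCtl gS)]
    ++ (if 0 < Δ then [.two wM wB (by simp) (gCtl gZ)] else [])

/-- The normalisation of the linear combination `cos Δ I - i sin Δ Swap`. -/
def lcuNorm (Δ : ℝ) : ℝ := Real.cos Δ + |Real.sin Δ|

/-- The rotation sending `|0⟩` to `(a / 2) |0⟩ + √(1 - a² / 4) |1⟩`, `a = lcuNorm Δ`. -/
def gR1 (Δ : ℝ) : Matrix.unitaryGroup Bool ℂ := gRot (Real.arccos (lcuNorm Δ / 2))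

/-- The rotation sending `|0⟩` to `√(cos Δ / a) |0⟩ + √(|sin Δ| / a) |1⟩`, `a = lcuNorm Δ`
(when `cos Δ > 0`). -/
def gR2 (Δ : ℝ) : Matrix.unitaryGroup Bool ℂ :=
  gRot (Real.arccos (Real.sqrt (Real.cos Δ / lcuNorm Δ)))

/-- The controlled module `W`. -/
def cW {Q n : ℕ} (Δ : ℝ) (j : Fin Q) : Circuit (Wire Q n) :=
  [.two wM wA (by simp) (gCtl (gR1 Δ)), .two wA wB (by simp) (gOctl (gR2 Δ))]
    ++ cSelect Δ j ++ [.one wB (gR2 Δ)⁻¹]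

/-- The controlled reflection `I - 2 |00⟩⟨00|` of the ancillas. -/
def cRefl {Q n : ℕ} : Circuit (Wire Q n) :=
  [.one wA gX, .two wM wA (by simp) (gCtl gZ)]
    ++ ccZ wM wA wB (by simp) (by simp) (by simp) ++ [.one wA gX]

/-- The controlled reflection `- (I - 2 |00⟩⟨00|)` of the ancillas. -/
def cReflNeg {Q n : ℕ} : Circuit (Wire Q n) :=
  [.two wM wA (by simp) (gCtl gZ), .one wA gX]
    ++ ccZ wM wA wB (by simp) (by simp) (by simp) ++ [.one wA gX]

/-- The controlled operator `A = - W (I - 2 P) W† (I - 2 P) W`, which simulates the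
controlled `exp (- i Δ Swap)` on the main register and register `j + 1`. -/
def cA {Q n : ℕ} (Δ : ℝ) (j : Fin Q) : Circuit (Wire Q n) :=
  cW Δ j ++ cRefl ++ Circuit.inv (cW Δ j) ++ cReflNeg ++ cW Δ j

/-- The circuit for `tr (ρ cos (ρ t))` with `Q` steps, each of length `t / Q`. -/
def cosCircuit (n Q : ℕ) (t : ℝ) : Circuit (Wire Q n) :=
  [.one wM gH] ++ (List.finRange Q).flatMap (fun j => cA (t / Q) j) ++ [.one wM gH]

/-- The input: `|0⟩` on the four single qubits and a copy of `ρ` on each register. -/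
def initState {n : ℕ} (ρ : Matrix (Bits n) (Bits n) ℂ) (Q : ℕ) :
    Matrix (Wire Q n → Bool) (Wire Q n → Bool) ℂ := fun x y =>
  (if (∀ a : Fin 4, x (.inl a) = false) ∧ (∀ a : Fin 4, y (.inl a) = false) then 1 else 0)
    * ∏ r : Fin (Q + 1), ρ (fun i => x (wD r i)) (fun i => y (wD r i))

/-- The Born probability that measuring the measured qubit at the end gives `b`. -/
def outcomeProb {n : ℕ} (ρ : Matrix (Bits n) (Bits n) ℂ) (Q : ℕ) (t : ℝ) (b : Bool) : ℝ :=
  ∑ x : Wire Q n → Bool, if x wM = b then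
    (((cosCircuit n Q t).mat * initState ρ Q * ((cosCircuit n Q t).mat).conjTranspose) x x).re
    else 0

/-! ### Coefficients of the Fourier series -/

/-- The power series coefficients of `arcsin y / (π / 2)`. -/
def arcsinCoeff (l : ℕ) : ℝ :=
  if Even l then 0
  else 2 * ((l - 1).choose ((l - 1) / 2) : ℝ) / (Real.pi * 2 ^ (l - 1) * l)

/-- The coefficients `b_l^{(k)}` of the powers `(arcsin y / (π / 2)) ^ k`. -/
def bCoeff : ℕ → ℕ → ℝ
  | 0, l => if l = 0 then 1 else 0
  | k + 1, l => ∑ l' ∈ Finset.range (l + 1), bCoeff k l' * arcsinCoeff (l - l')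

/-! ### The algorithm -/

/-- The classical data given to the algorithm: the order, the precision, the failure
probability, the bound on the nonzero eigenvalues and the purity of the state. -/
structure Input where
  /-- order of the entropy -/
  α : ℝ
  /-- precision -/
  ε : ℝ
  /-- failure probability -/
  δ : ℝ
  /-- lower bound on the nonzero eigenvalues -/
  Λ : ℝ
  /-- the purity of the state -/
  P : ℝ

namespace Input

/-- The lower bound on `tr (ρ ^ α)` in terms of the purity. -/
def traceBound (I : Input) : ℝ :=
  if 1 < I.α ∧ I.α ≤ 2 then I.P else I.P ^ (I.α - 1)

/-- The precision to which `tr (ρ ^ α)` has to be known. The minimum with `1` keeps the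
relative error of the estimate of `tr (ρ ^ α)` below one half. -/
def totalPrec (I : Input) : ℝ := min (|1 - I.α| * I.ε) 1 * I.traceBound / 2

/-- The share `ξ` of each of the three sources of error: truncation of the series,
sampling of its terms, estimation of the sampled terms. -/
def xi (I : Input) : ℝ := I.totalPrec / 3

/-- The truncation order `K` of the binomial series. -/
def K (I : Input) : ℕ :=
  ⌈Real.log (I.Λ * I.xi / 4) / Real.log (1 - I.Λ) + I.α ^ 2⌉₊

/-- The weight `∑_{k=1}^K |binom (α - 1) k|`. -/
def weight (I : Input) : ℝ := ∑ k ∈ Finset.Icc 1 I.K, |Ring.choose (I.α - 1) k|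

/-- The truncation parameter `L`. -/
def L (I : Input) : ℝ := Real.log (4 * I.weight / I.xi) * (1 / I.Λ ^ 2)

/-- The half-widths `M_l`. -/
def M (I : Input) (l : ℕ) : ℕ := ⌈Real.sqrt (Real.log (4 * I.weight / I.xi) * (l / 2))⌉₊

/-- The index set of the series: pairs `⟨l, s⟩` with `0 ≤ l ≤ ⌊L⌋` and
`max (0, ⌊l/2⌋ - M_l) ≤ s ≤ min (l, ⌈l/2⌉ + M_l)` (subtraction of naturals truncates). -/
def terms (I : Input) : Finset (Σ _ : ℕ, ℕ) :=
  (Finset.range (⌊I.L⌋₊ + 1)).sigma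
    fun l => Finset.Icc (l / 2 - I.M l) (min l ((l + 1) / 2 + I.M l))

/-- The coefficient `f (s, l)`, at `p = ⟨l, s⟩`. -/
def f (I : Input) (p : Σ _ : ℕ, ℕ) : ℝ :=
  (∑ k ∈ Finset.Icc 1 I.K, bCoeff k p.1 * (-1) ^ k * Ring.choose (I.α - 1) k)
    * ((p.1.choose p.2 : ℝ) / 2 ^ p.1)

/-- The `ℓ₁` norm of the coefficients. -/
def fNorm (I : Input) : ℝ := ∑ p ∈ I.terms, |I.f p|

/-- The precision for the estimation of the mean and of each term. -/
def prec (I : Input) : ℝ := I.xi / I.fNorm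

/-- The (bound on the) number of terms. -/
def N (I : Input) : ℕ := ∑ l ∈ Finset.range (⌊I.L⌋₊ + 1), (2 * I.M l + 1)

/-- The number of sampled terms. -/
def B (I : Input) : ℕ := ⌈2 * (I.fNorm ^ 2 / I.xi ^ 2) * Real.log (2 / I.δ)⌉₊

/-- The number of measurements for each sampled term. -/
def meas (I : Input) : ℕ := ⌈16 * Real.log (4 * I.N / I.δ) / I.prec ^ 2⌉₊

/-- The time `t (s, l) = (2 s - l) π / 2`, at `p = ⟨l, s⟩`. -/
def time (p : Σ _ : ℕ, ℕ) : ℝ := (2 * (p.2 : ℝ) - p.1) * Real.pi / 2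

/-- The number of steps of the circuit for a term. -/
def steps (I : Input) (p : Σ _ : ℕ, ℕ) : ℕ := ⌈time p ^ 2 / I.prec⌉₊

/-- The random choices of a run: `B` sampled terms and, for each of them, the outcomes of
its `meas` measurements (`false` is the outcome `0`, `true` the outcome `1`). -/
abbrev Run (I : Input) : Type := Fin I.B → {p // p ∈ I.terms} × (Fin I.meas → Bool)

/-- The probability of a run on copies of `ρ`: terms are drawn independently, with
probabilities `|f (s, l)| / ‖f‖₁`, and each measurement is made at the end of a fresh
execution of the circuit of the drawn term. -/
def runProb (I : Input) {n : ℕ} (ρ : Matrix (Bits n) (Bits n) ℂ) (ω : I.Run) : ℝ :=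
  ∏ j, (|I.f (ω j).1.1| / I.fNorm *
    ∏ r, outcomeProb ρ (I.steps (ω j).1.1) (time (ω j).1.1) ((ω j).2 r))

/-- The estimate `Pr[0] - Pr[1]` of the `j`-th sampled term. -/
def est (I : Input) (ω : I.Run) (j : Fin I.B) : ℝ :=
  (∑ r, if (ω j).2 r then (-1 : ℝ) else 1) / I.meas

/-- The output of a run. -/
def output (I : Input) (ω : I.Run) : ℝ :=
  Real.logb 2 (1 + I.fNorm * (∑ j, Real.sign (I.f (ω j).1.1) * I.est ω j) / I.B) / (1 - I.α)

/-- The number of copies of `ρ` that a run uses: one for each register in each execution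
of a circuit. -/
def copies (I : Input) (ω : I.Run) : ℕ :=
  ∑ j, I.meas * (I.steps (ω j).1.1 + 1)

/-- The total number of single/two-qubit gates of the circuits of the sampled terms, for
states of `n` qubits (repeated executions of one circuit are not counted anew). -/
def gates (I : Input) (n : ℕ) (ω : I.Run) : ℕ :=
  ∑ j, (cosCircuit n (I.steps (ω j).1.1) (time (ω j).1.1)).size

open scoped Classical in
/-- The probability that a run on copies of `ρ` has the property `E`. -/
def prob (I : Input) {n : ℕ} (ρ : Matrix (Bits n) (Bits n) ℂ) (E : I.Run → Prop) : ℝ :=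
  ∑ ω : I.Run, if E ω then I.runProb ρ ω else 0

/-- The quantity `∑ |binom (α - 1) k| / (|1 - α| τ ε)`, where `τ` is `tr (ρ ^ 2) ^ (α - 1)`
for `α ∈ (0, 1) ∪ (2, ∞)` and `tr (ρ ^ 2)` for `α ∈ (1, 2]`. -/
def ratio (I : Input) : ℝ := I.weight / (|1 - I.α| * I.traceBound * I.ε)

/-- The logarithm whose powers are hidden in the cost bounds. -/
def logFactor (I : Input) : ℝ := Real.log (2 + I.ratio / (I.Λ * I.δ))

end Input

end RenyiEst

end

noncomputable section
namespace RenyiEst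
open Matrix

/-! ### Action of circuits on vectors -/

section Action

variable {W : Type} [Fintype W] [DecidableEq W]

/-! Write `tr (ρ ^ α) = ∑ λ · λ ^ (α - 1)` over the eigenvalues, and approximate `λ ^ (α - 1)` on
`[Λ, 1]` by a finite cosine sum. Expand `(1 - (1 - λ)) ^ (α - 1)` in powers of `1 - λ`. With `y =
cos (λ π / 2)` one has `1 - λ = arcsin y / (π / 2)`, so each power of `1 - λ` is a power series in
`y` with nonnegative coefficients of total at most `1`. Finally `y ^ l` is a binomial average of
`cos ((2 s - l) λ π / 2)`, concentrated near `s = l / 2`. The three truncations together cost at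
most `ξ` (`Input.abs_series_sub_le`), so `1 + ∑ f (s, l) tr (ρ cos (ρ t))` is within `ξ` of `tr (ρ ^
α)`.

The circuit is a Hadamard test. One exact round of amplitude amplification (`amplification`,
`cA_mat_mul_projMAB`) makes every module act as the controlled `cos Δ - i sin Δ Swap`. Tracing out
the fresh copies turns each partial swap into multiplication by `cos Δ - i sin Δ ρ`
(`traceMain_chain_copyState`). Hence the difference of the outcome probabilities is `Re tr ((cos Δ -
i sin Δ ρ) ^ Q ρ)`, which differs from `tr (ρ cos (ρ t))` by at most `t² / Q ≤ prec`. Weighted by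
`f`, this costs `‖f‖₁ · prec = ξ`.

A sampled term and its measurement outcomes are treated as one random variable, bounded by `‖f‖₁`,
whose mean is exactly the sum with the circuit expectations. A single use of Hoeffding's inequality
over the `B` samples (`one_sub_le_prob`) gives the last `ξ` with probability `1 - δ`; the number of
measurements per term only has to be positive. Since `τ ≤ tr (ρ ^ α)` by convexity or monotonicity
of powers, the total error `3 ξ` is a relative error below one half, and the logarithm turns it into
an error `ε` of the entropy.

For the costs put `V = 1 / prec = ‖f‖₁ / ξ ≤ w / ξ`. Up to logarithms `B` and `meas` are `V²` and
the number of steps is `V / Λ²`, whence `V⁵ / Λ²` copies and `n V³ / Λ²` gates. The minimum with `1`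
in the precision is harmless: when `|1 - α|` is large, `w` is exponential in `α`, so `|1 - α|` is
itself at most a logarithmic factor (`abs_le_logFactor`, `weight_div_xi_le`). -/

theorem Circuit.mat_append (c d : Circuit W) :
    Circuit.mat (c ++ d) = Circuit.mat d * Circuit.mat c := by
  induction c with
  | nil => simp [Circuit.mat]
  | cons g c ih => simp [Circuit.mat, ih, Matrix.mul_assoc]

/-- The action of a circuit on a vector of amplitudes. -/
def Circuit.act (c : Circuit W) (ψ : (W → Bool) → ℂ) : (W → Bool) → ℂ :=
  Circuit.mat c *ᵥ ψ

theorem Circuit.act_nil (ψ : (W → Bool) → ℂ) : Circuit.act [] ψ = ψ := by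
  simp [Circuit.act, Circuit.mat]

theorem Circuit.act_append (c d : Circuit W) (ψ : (W → Bool) → ℂ) :
    Circuit.act (c ++ d) ψ = Circuit.act d (Circuit.act c ψ) := by
  simp [Circuit.act, Circuit.mat_append, Matrix.mulVec_mulVec]

theorem Circuit.act_cons (g : Gate W) (c : Circuit W) (ψ : (W → Bool) → ℂ) :
    Circuit.act (g :: c) ψ = Circuit.act c (g.mat *ᵥ ψ) := by
  simp [Circuit.act, Circuit.mat, Matrix.mulVec_mulVec]

theorem Gate.one_mulVec (w : W) (u : Matrix.unitaryGroup Bool ℂ) (ψ : (W → Bool) → ℂ)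
    (x : W → Bool) :
    ((Gate.one w u).mat *ᵥ ψ) x = ∑ b, u.1 (x w) b * ψ (Function.update x w b) := by
  symm
  refine Fintype.sum_of_injective (fun b => Function.update x w b)
    (fun b c h => by simpa using congrFun h w) _ _ ?_ ?_
  · intro y hy
    simp only [Gate.mat]
    rw [if_neg, zero_mul]
    intro h
    refine hy ⟨y w, ?_⟩
    ext z
    by_cases hz : z = w
    · subst hz; simp
    · simp [hz, h z hz]
  · intro b
    simp only [Gate.mat]
    rw [if_pos]
    · simp
    · intro z hz; simp [hz]

theorem Gate.cond_mulVec (v w : W) (h : v ≠ w) (u₀ u₁ : Matrix.unitaryGroup Bool ℂ)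
    (ψ : (W → Bool) → ℂ) (x : W → Bool) :
    ((Gate.two v w h (gCond u₀ u₁)).mat *ᵥ ψ) x =
      ∑ b, (if x v then u₁ else u₀).1 (x w) b * ψ (Function.update x w b) := by
  symm
  refine Fintype.sum_of_injective (fun b => Function.update x w b)
    (fun b c h => by simpa using congrFun h w) _ _ ?_ ?_
  · intro y hy
    simp only [Gate.mat]
    split_ifs with h'
    · have : x v ≠ y v := by
        intro hv
        refine hy ⟨y w, ?_⟩
        ext z
        by_cases hz : z = w
        · subst hz; simp
        · by_cases hz' : z = v
          · subst hz'; simp [hz, hv]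
          · simp [hz, h' z hz' hz]
      simp [gCond, this]
    · simp
  · intro b
    have hb : ∀ z, z ≠ v → z ≠ w → x z = Function.update x w b z := fun z _ hz => by simp [hz]
    simp only [Gate.mat, if_pos hb, gCond, Matrix.of_apply, Function.update_of_ne h, if_true,
      Function.update_self]
    split_ifs <;> rfl

theorem gX_apply (a b : Bool) : gX.1 a b = if a = b then 0 else 1 := rfl

theorem gPhase_apply (θ : ℝ) (a b : Bool) :
    (gPhase θ).1 a b = if a = b then (if a then Complex.exp (θ * Complex.I) else 1) else 0 := by
  simp [gPhase, Matrix.diagonal_apply]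

theorem gH_apply (a b : Bool) :
    gH.1 a b = (if a && b then -1 else 1) * ((Real.sqrt 2 / 2 : ℝ) : ℂ) := by
  cases a <;> cases b <;> simp [gH]

theorem one_apply' (a b : Bool) : (1 : Matrix.unitaryGroup Bool ℂ).1 a b = if a = b then 1 else 0 := by
  simp [Matrix.one_apply]

theorem gZ_apply (a b : Bool) : gZ.1 a b = if a = b then (if a then -1 else 1) else 0 := by
  rw [gZ, gPhase_apply]; simp

theorem gS_apply (a b : Bool) : gS.1 a b = if a = b then (if a then Complex.I else 1) else 0 := by
  rw [gS, gPhase_apply]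
  simp only [Complex.ofReal_div, Complex.ofReal_ofNat, Complex.exp_pi_div_two_mul_I]

theorem unitary_inv_apply (u : Matrix.unitaryGroup Bool ℂ) (a b : Bool) :
    (u⁻¹).1 a b = star (u.1 b a) := rfl

theorem gX_mulVec (w : W) (ψ : (W → Bool) → ℂ) (x : W → Bool) :
    ((Gate.one w gX).mat *ᵥ ψ) x = ψ (Function.update x w (!x w)) := by
  rw [Gate.one_mulVec]
  cases h : x w <;> simp [gX_apply]

theorem cnot_mulVec (v w : W) (h : v ≠ w) (ψ : (W → Bool) → ℂ) (x : W → Bool) :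
    ((Gate.two v w h (gCtl gX)).mat *ᵥ ψ) x = ψ (Function.update x w (x v ^^ x w)) := by
  rw [gCtl, Gate.cond_mulVec]
  cases hv : x v <;> cases h : x w <;> simp [gX_apply, Matrix.one_apply]

theorem cZ_mulVec (v w : W) (h : v ≠ w) (ψ : (W → Bool) → ℂ) (x : W → Bool) :
    ((Gate.two v w h (gCtl gZ)).mat *ᵥ ψ) x = (if x v && x w then -1 else 1) * ψ x := by
  rw [gCtl, Gate.cond_mulVec]
  have hx : ∀ b, x w = b → Function.update x w b = x := fun b hb => by simp [← hb]
  cases hv : x v <;> cases h : x w <;> simp [gZ_apply, Matrix.one_apply, hx _ h]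

theorem cS_mulVec (v w : W) (h : v ≠ w) (ψ : (W → Bool) → ℂ) (x : W → Bool) :
    ((Gate.two v w h (gCtl gS)).mat *ᵥ ψ) x = (if x v && x w then Complex.I else 1) * ψ x := by
  rw [gCtl, Gate.cond_mulVec]
  have hx : ∀ b, x w = b → Function.update x w b = x := fun b hb => by simp [← hb]
  cases hv : x v <;> cases h : x w <;> simp [gS_apply, Matrix.one_apply, hx _ h]

theorem cSinv_mulVec (v w : W) (h : v ≠ w) (ψ : (W → Bool) → ℂ) (x : W → Bool) :
    ((Gate.two v w h (gCtl gS⁻¹)).mat *ᵥ ψ) x = (if x v && x w then -Complex.I else 1) * ψ x := by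
  rw [gCtl, Gate.cond_mulVec]
  have hx : ∀ b, x w = b → Function.update x w b = x := fun b hb => by simp [← hb]
  cases hv : x v <;> cases h : x w <;>
    simp [-UnitaryGroup.inv_val, unitary_inv_apply, gS_apply, Matrix.one_apply, hx _ h]

/-- The three phase gates contribute `i` to the power `c (b - (a ⊕ b) + a)`, and `a + b - (a ⊕ b) =
2 a b`. -/
theorem ccZ_act (a b c : W) (hab : a ≠ b) (hac : a ≠ c) (hbc : b ≠ c) (ψ : (W → Bool) → ℂ)
    (x : W → Bool) :
    Circuit.act (ccZ a b c hab hac hbc) ψ x = (if x a && x b && x c then -1 else 1) * ψ x := by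
  rw [ccZ]
  simp only [Circuit.act_cons, Circuit.act_nil]
  simp only [cS_mulVec, cnot_mulVec, cSinv_mulVec]
  have hx : ∀ v, x b = v → Function.update x b v = x := fun v hb => by simp [← hb]
  cases h1 : x a <;> cases h2 : x b <;> cases h3 : x c <;>
    simp [hab, hbc.symm, h1, h3, hx _ h2, ← mul_assoc]

/-- Conjugating by the Hadamard gate on the target turns a controlled `Z` into a controlled `X`. -/
theorem toffoli_act (a b c : W) (hab : a ≠ b) (hac : a ≠ c) (hbc : b ≠ c) (ψ : (W → Bool) → ℂ)
    (x : W → Bool) :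
    Circuit.act (toffoli a b c hab hac hbc) ψ x =
      ψ (Function.update x c ((x a && x b) ^^ x c)) := by
  rw [toffoli]
  simp only [Circuit.act_append, Circuit.act_cons, Circuit.act_nil]
  rw [Gate.one_mulVec]
  simp only [ccZ_act, Gate.one_mulVec]
  have h2 : ((Real.sqrt 2 / 2 : ℝ) : ℂ) * ((Real.sqrt 2 / 2 : ℝ) : ℂ) = 1 / 2 := by
    rw [← Complex.ofReal_mul]
    have : Real.sqrt 2 / 2 * (Real.sqrt 2 / 2) = 1 / 2 := by
      have := Real.mul_self_sqrt (show (0 : ℝ) ≤ 2 by norm_num)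
      nlinarith
    rw [this]; norm_num
  cases h1 : x a <;> cases h4 : x b <;> cases h3 : x c <;>
    simp only [gH_apply, Fintype.sum_bool, Function.update_self, Function.update_of_ne hac,
      Function.update_of_ne hbc, h1, h4, Function.update_idem, Bool.and_true, Bool.and_false,
      Bool.false_and, Bool.true_and, if_true, if_false, Bool.false_eq_true, Bool.xor_false,
      Bool.xor_true, Bool.not_true, Bool.not_false] <;>
    generalize ψ (Function.update x c true) = p <;>
    generalize ψ (Function.update x c false) = q <;>
    first
      | linear_combination (2 * p) * h2
      | linear_combination (2 * q) * h2

end Action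

end RenyiEst
end

noncomputable section
namespace RenyiEst
open Matrix

/-! ### The controlled swaps and the controlled selection -/

section Select

variable {Q n : ℕ}

/-- Exchange the qubits in `l` of the main register with those of register `j + 1`. -/
def swapOn (j : Fin Q) (l : List (Fin n)) (x : Wire Q n → Bool) : Wire Q n → Bool
  | .inl a => x (.inl a)
  | .inr (r, i) => if i ∈ l then x (.inr (Equiv.swap 0 j.succ r, i)) else x (.inr (r, i))

/-- A swap is three CNOTs, and only the middle one needs the control: the outer two cancel when the
flag is `0`. -/
theorem cSwap_act (j : Fin Q) (i : Fin n) (ψ : (Wire Q n → Bool) → ℂ) (x : Wire Q n → Bool) :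
    Circuit.act (cSwap j i) ψ x = ψ (if x wF then swapOn j [i] x else x) := by
  rw [cSwap]
  simp only [Circuit.act_append, Circuit.act_cons, Circuit.act_nil, cnot_mulVec, toffoli_act]
  congr 1
  have hj : j.succ ≠ 0 := Fin.succ_ne_zero j
  funext z
  rcases z with a | ⟨r, i'⟩
  · cases h : x wF <;> simp [swapOn, Function.update_apply]
  · by_cases hi : i' = i
    · subst hi
      by_cases h0 : r = 0
      · subst h0
        cases h : x wF <;> cases h1 : x (.inr (0, i')) <;> cases h2 : x (.inr (j.succ, i')) <;>
          simp [swapOn, hj, hj.symm, h, h1, h2]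
      · by_cases h0' : r = j.succ
        · subst h0'
          cases h : x wF <;> cases h1 : x (.inr (0, i')) <;> cases h2 : x (.inr (j.succ, i')) <;>
            simp [swapOn, hj, hj.symm, h, h1, h2]
        · cases h : x wF <;>
            simp [swapOn, Function.update_apply, h0, h0', Equiv.swap_apply_of_ne_of_ne]
    · cases h : x wF <;> simp [swapOn, Function.update_apply, hi]

/-- A repeated index would swap twice and cancel, hence `Nodup`. The flag is never touched, so one
case distinction on it serves all factors. -/
theorem cSwaps_act (j : Fin Q) (l : List (Fin n)) (hl : l.Nodup) (ψ : (Wire Q n → Bool) → ℂ)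
    (x : Wire Q n → Bool) :
    Circuit.act (l.flatMap fun i => cSwap j i) ψ x = ψ (if x wF then swapOn j l x else x) := by
  induction l generalizing ψ with
  | nil =>
    have : swapOn j [] x = x := by
      funext z; rcases z with a | ⟨r, i⟩ <;> simp [swapOn]
    simp [Circuit.act_nil, this]
  | cons i l ih =>
    rw [List.flatMap_cons, Circuit.act_append, ih (List.nodup_cons.1 hl).2, cSwap_act]
    congr 1
    cases h : x wF
    · simp [h]
    · simp only [if_true]
      rw [show swapOn j l x wF = true from h]
      simp only [if_true]
      funext z
      rcases z with a | ⟨r, i'⟩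
      · simp [swapOn]
      · by_cases hi : i' = i
        · subst hi
          simp [swapOn, (List.nodup_cons.1 hl).1]
        · simp [swapOn, hi]

/-- Exchange the main register with register `j + 1`. -/
def swapReg (j : Fin Q) (x : Wire Q n → Bool) : Wire Q n → Bool := swapOn j (List.finRange n) x

@[simp] theorem swapReg_inl (j : Fin Q) (x : Wire Q n → Bool) (a : Fin 4) :
    swapReg j x (.inl a) = x (.inl a) := rfl

theorem swapReg_inr (j : Fin Q) (x : Wire Q n → Bool) (r : Fin (Q + 1)) (i : Fin n) :
    swapReg j x (.inr (r, i)) = x (.inr (Equiv.swap 0 j.succ r, i)) := by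
  simp [swapReg, swapOn]

@[simp] theorem swapReg_swapReg (j : Fin Q) (x : Wire Q n → Bool) :
    swapReg j (swapReg j x) = x := by
  funext z
  rcases z with a | ⟨r, i⟩ <;> simp [swapReg_inr]

theorem swapReg_update (j : Fin Q) (x : Wire Q n → Bool) (a : Fin 4) (b : Bool) :
    swapReg j (Function.update x (.inl a) b) = Function.update (swapReg j x) (.inl a) b := by
  funext z
  rcases z with a' | ⟨r, i⟩
  · simp [Function.update_apply]
  · simp [swapReg_inr]

/-- Exchange the main register with register `j + 1` if `b` is true. -/
def swapIf (b : Bool) (j : Fin Q) (x : Wire Q n → Bool) : Wire Q n → Bool :=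
  if b then swapReg j x else x

@[simp] theorem swapIf_inl (b : Bool) (j : Fin Q) (x : Wire Q n → Bool) (a : Fin 4) :
    swapIf b j x (.inl a) = x (.inl a) := by
  cases b <;> rfl

@[simp] theorem swapIf_swapIf (b c : Bool) (j : Fin Q) (x : Wire Q n → Bool) :
    swapIf b j (swapIf c j x) = swapIf (b ^^ c) j x := by
  cases b <;> cases c <;> simp [swapIf]

theorem swapIf_update (c : Bool) (j : Fin Q) (x : Wire Q n → Bool) (a : Fin 4) (b : Bool) :
    swapIf c j (Function.update x (.inl a) b) = Function.update (swapIf c j x) (.inl a) b := by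
  cases c <;> simp [swapIf, swapReg_update]

/-- The phase `- i sgn Δ` of the selected swap. -/
def selPhase (Δ : ℝ) : ℂ := if 0 < Δ then -Complex.I else Complex.I

/-- The first Toffoli adds `M ∧ B` to the flag and the second removes it. The flag is left arbitrary
because the operator identities needed for the amplification are on the whole space; this is why it
enters through an exclusive or. -/
theorem cSelect_act (Δ : ℝ) (j : Fin Q) (ψ : (Wire Q n → Bool) → ℂ) (x : Wire Q n → Bool) :
    Circuit.act (cSelect Δ j) ψ x = (if x wM && x wB then selPhase Δ else 1) *
      ψ (swapIf (x wF ^^ (x wM && x wB)) j x) := by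
  have key : ∀ φ : (Wire Q n → Bool) → ℂ,
      Circuit.act (toffoli wM wB wF (by simp) (by simp) (by simp) : Circuit (Wire Q n))
        (Circuit.act ((List.finRange n).flatMap (fun i => cSwap j i))
        (Circuit.act (toffoli wM wB wF (by simp) (by simp) (by simp)) φ)) x =
      φ (swapIf (x wF ^^ (x wM && x wB)) j x) := by
    intro φ
    rw [toffoli_act, cSwaps_act _ _ (List.nodup_finRange n), toffoli_act]
    congr 1
    rw [Function.update_self, ← swapReg]
    have hx : ∀ v, x wF = v → Function.update x wF v = x := fun v hb => by simp [← hb]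
    cases h : x wF <;> cases h1 : x wM <;> cases h2 : x wB <;>
      simp [swapIf, swapReg_update, h, h1, h2, hx _ h]
  rw [cSelect]
  simp only [Circuit.act_append, Circuit.act_cons, Circuit.act_nil]
  split_ifs with hΔ h h <;>
  simp only [Circuit.act_cons, Circuit.act_nil, cS_mulVec, cZ_mulVec, key] <;>
  simp [h, selPhase, hΔ]

end Select

end RenyiEst
end

noncomputable section
namespace RenyiEst
open Matrix

/-! ### Unitarity of circuits -/

section Unitarity

variable {W : Type} [Fintype W] [DecidableEq W]

theorem eq_of_mulVec_eq {X : Type*} [Fintype X] [DecidableEq X] {A B : Matrix X X ℂ}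
    (h : ∀ ψ, A *ᵥ ψ = B *ᵥ ψ) : A = B :=
  Matrix.mulVec_injective (funext h)

theorem Gate.two_mulVec (v w : W) (h : v ≠ w) (u : Matrix.unitaryGroup (Bool × Bool) ℂ)
    (ψ : (W → Bool) → ℂ) (x : W → Bool) :
    ((Gate.two v w h u).mat *ᵥ ψ) x =
      ∑ p, u.1 (x v, x w) p * ψ (Function.update (Function.update x v p.1) w p.2) := by
  symm
  refine Fintype.sum_of_injective
    (fun p : Bool × Bool => Function.update (Function.update x v p.1) w p.2) ?_ _ _ ?_ ?_
  · rintro ⟨b, c⟩ ⟨b', c'⟩ he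
    have h1 := congrFun he w
    have h2 := congrFun he v
    simp only [Function.update_self, Function.update_of_ne h] at h1 h2
    rw [h1, h2]
  · intro y hy
    simp only [Gate.mat]
    rw [if_neg, zero_mul]
    intro h'
    refine hy ⟨(y v, y w), ?_⟩
    ext z
    by_cases hz : z = w
    · subst hz; simp
    · by_cases hz' : z = v
      · subst hz'; simp [hz]
      · simp [hz, hz', h' z hz' hz]
  · intro p
    simp only [Gate.mat]
    rw [if_pos]
    · simp [h]
    · intro z hz hz'; simp [hz, hz']

theorem Gate.inv_mat (g : Gate W) : g.inv.mat = g.matᴴ := by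
  ext x y
  rw [Matrix.conjTranspose_apply]
  cases g with
  | one w u =>
    simp only [Gate.inv, Gate.mat, apply_ite star, star_zero]
    congr 1
    simp only [eq_comm]
  | two v w h u =>
    simp only [Gate.inv, Gate.mat, apply_ite star, star_zero]
    congr 1
    simp only [eq_comm]

theorem Gate.inv_mat_mul (g : Gate W) : g.inv.mat * g.mat = 1 := by
  refine eq_of_mulVec_eq fun ψ => ?_
  rw [← Matrix.mulVec_mulVec, Matrix.one_mulVec]
  funext x
  cases g with
  | one w u =>
    rw [Gate.inv, Gate.one_mulVec]
    simp only [Gate.one_mulVec, Function.update_self, Function.update_idem, Finset.mul_sum]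
    rw [Finset.sum_comm]
    have key : ∀ c, ∑ b, (u⁻¹).1 (x w) b * u.1 b c = if x w = c then 1 else 0 := by
      intro c
      have := congrFun (congrFun (congrArg Subtype.val (inv_mul_cancel u)) (x w)) c
      rwa [Matrix.UnitaryGroup.mul_val, Matrix.mul_apply, Matrix.UnitaryGroup.one_val,
        Matrix.one_apply] at this
    simp only [← mul_assoc, ← Finset.sum_mul, key]
    simp
  | two v w h u =>
    rw [Gate.inv, Gate.two_mulVec]
    simp only [Gate.two_mulVec, Finset.mul_sum]
    rw [Finset.sum_comm]
    have key : ∀ c, ∑ b, (u⁻¹).1 (x v, x w) b * u.1 b c = if (x v, x w) = c then 1 else 0 := by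
      intro c
      have := congrFun (congrFun (congrArg Subtype.val (inv_mul_cancel u)) (x v, x w)) c
      rwa [Matrix.UnitaryGroup.mul_val, Matrix.mul_apply, Matrix.UnitaryGroup.one_val,
        Matrix.one_apply] at this
    have e : ∀ p q : Bool × Bool,
        Function.update (Function.update (Function.update (Function.update x v p.1) w p.2) v q.1)
          w q.2 = Function.update (Function.update x v q.1) w q.2 := by
      intro p q
      funext z
      simp only [Function.update_apply]
      split_ifs <;> rfl
    simp only [Function.update_self, Function.update_of_ne h, e, ← mul_assoc, ← Finset.sum_mul]
    simp only [key]
    simp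

theorem Circuit.inv_mat (c : Circuit W) : Circuit.mat (Circuit.inv c) = (Circuit.mat c)ᴴ := by
  induction c with
  | nil => simp [Circuit.inv, Circuit.mat]
  | cons g c ih =>
    rw [Circuit.inv] at ih ⊢
    rw [List.map_cons, List.reverse_cons, Circuit.mat_append, ih]
    simp [Circuit.mat, Gate.inv_mat, Matrix.conjTranspose_mul]

theorem Circuit.conjTranspose_mat_mul (c : Circuit W) : (Circuit.mat c)ᴴ * Circuit.mat c = 1 := by
  induction c with
  | nil => simp [Circuit.mat]
  | cons g c ih =>
    rw [Circuit.mat, Matrix.conjTranspose_mul, Matrix.mul_assoc, ← Matrix.mul_assoc _ _ g.mat, ih,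
      Matrix.one_mul, ← Gate.inv_mat, Gate.inv_mat_mul]

theorem Circuit.mat_mul_conjTranspose (c : Circuit W) : Circuit.mat c * (Circuit.mat c)ᴴ = 1 :=
  mul_eq_one_comm.1 c.conjTranspose_mat_mul

end Unitarity

/-! ### Oblivious amplitude amplification -/

/-- One exact round of oblivious amplitude amplification, controlled by the projection `E`. -/
theorem amplification {X : Type*} [Fintype X] [DecidableEq X] {W U P E : Matrix X X ℂ}
    (hW : W * Wᴴ = 1) (hW' : Wᴴ * W = 1) (hU : Uᴴ * U = 1) (hPH : Pᴴ = P) (hPP : P * P = P)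
    (hEP : E * P = P) (hUP : U * P = P * U) (hEH : Eᴴ = E) (hEW : E * W = W * E)
    (hEU : E * U = U * E) (hPWP : (2 : ℂ) • (P * W * P) = U * P) :
    W * (1 - (2 : ℂ) • E + (2 : ℂ) • P) * Wᴴ * (1 - (2 : ℂ) • P) * W * P = U * P := by
  have hUP' : P * Uᴴ = Uᴴ * P := by
    have := congrArg Matrix.conjTranspose hUP
    simpa [Matrix.conjTranspose_mul, hPH] using this
  have hEW' : Wᴴ * E = E * Wᴴ := by
    have := congrArg Matrix.conjTranspose hEW
    simpa [Matrix.conjTranspose_mul, hEH] using this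
  have hPWP' : (2 : ℂ) • (P * Wᴴ * P) = P * Uᴴ := by
    have := congrArg Matrix.conjTranspose hPWP
    simpa [Matrix.conjTranspose_mul, Matrix.conjTranspose_smul, hPH, Matrix.mul_assoc] using this
  -- The amplitude of the wanted block is exactly one half, so `2 P W P` may be replaced by `U P`.
  have h1 : Wᴴ * (1 - (2 : ℂ) • P) * W * P = P - Wᴴ * U * P := by
    calc _ = Wᴴ * W * P - Wᴴ * ((2 : ℂ) • (P * W * P)) := by
          simp only [Matrix.mul_sub, Matrix.sub_mul, Matrix.mul_one, Matrix.mul_smul,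
            Matrix.smul_mul, Matrix.mul_assoc]
      _ = _ := by rw [hPWP, hW', Matrix.one_mul, Matrix.mul_assoc]
  have h2 : (1 - (2 : ℂ) • E + (2 : ℂ) • P) * P = P := by
    rw [Matrix.add_mul, Matrix.sub_mul, Matrix.one_mul, Matrix.smul_mul, Matrix.smul_mul, hEP, hPP,
      sub_add_cancel]
  have hEWU : E * (Wᴴ * U * P) = Wᴴ * U * P := by
    rw [← Matrix.mul_assoc, ← Matrix.mul_assoc, ← hEW', Matrix.mul_assoc Wᴴ E, hEU,
      Matrix.mul_assoc, Matrix.mul_assoc, hEP, ← Matrix.mul_assoc]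
  have hPWU : (2 : ℂ) • (P * (Wᴴ * U * P)) = P := by
    calc _ = ((2 : ℂ) • (P * Wᴴ * P)) * U := by
          rw [Matrix.mul_assoc Wᴴ, hUP, Matrix.smul_mul]; simp only [Matrix.mul_assoc]
      _ = P := by rw [hPWP', Matrix.mul_assoc, hU, Matrix.mul_one]
  -- On the range of `E` this operator is `2 P - 1`, and off it the identity. The vector lies in the
  -- range of `E`, and its `P` component is `P / 2` because `U` is unitary. Subtracting from `h2`
  -- leaves exactly `Wᴴ U P`.
  have h3 : (1 - (2 : ℂ) • E + (2 : ℂ) • P) * (Wᴴ * U * P) = - (Wᴴ * U * P) + P := by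
    rw [Matrix.add_mul, Matrix.sub_mul, Matrix.one_mul, Matrix.smul_mul, Matrix.smul_mul, hEWU,
      hPWU, two_smul]
    abel
  calc _ = W * ((1 - (2 : ℂ) • E + (2 : ℂ) • P) * (Wᴴ * (1 - (2 : ℂ) • P) * W * P)) := by
        simp only [Matrix.mul_assoc]
    _ = W * (Wᴴ * U * P) := by
        rw [h1, Matrix.mul_sub, h2, h3]; congr 1; abel
    _ = U * P := by
        rw [Matrix.mul_assoc, ← Matrix.mul_assoc, hW, Matrix.one_mul]

end RenyiEst
end

noncomputable section
namespace RenyiEst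
open Matrix

/-! ### The controlled simulation of one step -/

section Step

variable {Q n : ℕ}

/-- The projection on the states whose measured qubit is `1`. -/
def projM : Matrix (Wire Q n → Bool) (Wire Q n → Bool) ℂ :=
  Matrix.diagonal fun x => if x wM then 1 else 0

/-- The projection on the states whose measured qubit is `1` and whose ancillas are `0`. -/
def projMAB : Matrix (Wire Q n → Bool) (Wire Q n → Bool) ℂ :=
  Matrix.diagonal fun x => if x wM && !x wA && !x wB then 1 else 0

/-- The operator `cos Δ I - i sin Δ Swap`, up to a swap if the flag is set. -/
def stepU (Δ : ℝ) (j : Fin Q) : Matrix (Wire Q n → Bool) (Wire Q n → Bool) ℂ :=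
  Matrix.of fun x y => (Real.cos Δ : ℂ) * (if y = swapIf (x wF) j x then 1 else 0)
    + (-Complex.I * Real.sin Δ) * (if y = swapIf (!x wF) j x then 1 else 0)

theorem projM_mulVec (ψ : (Wire Q n → Bool) → ℂ) (x : Wire Q n → Bool) :
    (projM *ᵥ ψ) x = if x wM then ψ x else 0 := by
  simp [projM, Matrix.mulVec_diagonal]

theorem projMAB_mulVec (ψ : (Wire Q n → Bool) → ℂ) (x : Wire Q n → Bool) :
    (projMAB *ᵥ ψ) x = if x wM && !x wA && !x wB then ψ x else 0 := by
  simp only [projMAB, Matrix.mulVec_diagonal]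
  split_ifs <;> simp

theorem stepU_mulVec (Δ : ℝ) (j : Fin Q) (ψ : (Wire Q n → Bool) → ℂ) (x : Wire Q n → Bool) :
    (stepU Δ j *ᵥ ψ) x = Real.cos Δ * ψ (swapIf (x wF) j x)
      - Complex.I * Real.sin Δ * ψ (swapIf (!x wF) j x) := by
  simp only [stepU, Matrix.mulVec, dotProduct, Matrix.of_apply, add_mul, Finset.sum_add_distrib,
    mul_assoc, ← Finset.mul_sum, ite_mul, one_mul, zero_mul, Finset.sum_ite_eq', Finset.mem_univ,
    if_true]
  ring

/-- The conditional swap is an involution fixing the flag; this yields the adjoint of `stepU`. -/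
theorem eq_swapIf_iff (b : Bool) (j : Fin Q) (x y : Wire Q n → Bool) :
    y = swapIf (x wF ^^ b) j x ↔ x = swapIf (y wF ^^ b) j y := by
  constructor <;> (intro h; rw [h]; simp; simp [swapIf])

theorem stepU_conjTranspose (Δ : ℝ) (j : Fin Q) :
    (stepU Δ j : Matrix (Wire Q n → Bool) (Wire Q n → Bool) ℂ)ᴴ = stepU (-Δ) j := by
  ext x y
  rw [Matrix.conjTranspose_apply]
  have h0 := eq_swapIf_iff false j x y
  have h1 := eq_swapIf_iff true j x y
  simp only [Bool.xor_false, Bool.xor_true] at h0 h1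
  simp only [stepU, Matrix.of_apply, h0, h1, star_add, star_mul', apply_ite star, star_zero,
    star_one, star_neg, Complex.star_def, Complex.conj_I, Complex.conj_ofReal, Real.cos_neg,
    Real.sin_neg, Complex.ofReal_neg]
  ring

theorem stepU_unitary (Δ : ℝ) (j : Fin Q) :
    (stepU Δ j : Matrix (Wire Q n → Bool) (Wire Q n → Bool) ℂ)ᴴ * stepU Δ j = 1 := by
  refine eq_of_mulVec_eq fun ψ => ?_
  rw [stepU_conjTranspose, ← Matrix.mulVec_mulVec, Matrix.one_mulVec]
  funext x
  have h : (Real.cos Δ : ℂ) * Real.cos Δ + Real.sin Δ * Real.sin Δ = 1 := by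
    rw [← Complex.ofReal_mul, ← Complex.ofReal_mul, ← Complex.ofReal_add, ← sq, ← sq,
      Real.cos_sq_add_sin_sq, Complex.ofReal_one]
  simp only [stepU_mulVec, swapIf_inl, swapIf_swapIf, Real.cos_neg, Real.sin_neg,
    Complex.ofReal_neg]
  cases x wF <;> simp only [Bool.xor_self, Bool.not_false, Bool.not_true, Bool.xor_false,
      Bool.xor_true, swapIf, if_true, if_false, Bool.false_eq_true]
  all_goals linear_combination ψ x * h - (ψ x * Real.sin Δ * Real.sin Δ) * Complex.I_mul_I

/-- Between the two `X` gates the controlled `Z` flips the sign for `A = 0`, and the doubly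
controlled one restores it for `B = 1`. -/
theorem cRefl_mat : Circuit.mat (cRefl : Circuit (Wire Q n)) = 1 - (2 : ℂ) • projMAB := by
  refine eq_of_mulVec_eq fun ψ => ?_
  funext x
  rw [Matrix.sub_mulVec, Matrix.one_mulVec, Matrix.smul_mulVec, Pi.sub_apply, Pi.smul_apply,
    projMAB_mulVec, ← Circuit.act, cRefl]
  simp only [Circuit.act_append, Circuit.act_cons, Circuit.act_nil, gX_mulVec, ccZ_act,
    cZ_mulVec]
  have hx : ∀ v, x wA = v → Function.update x wA v = x := fun v hb => by simp [← hb]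
  cases h : x wM <;> cases h1 : x wA <;> cases h2 : x wB <;> simp [h, h2, hx _ h1]
  ring

/-- Here the controlled `Z` precedes the `X`, so the sign flips for `A = 1` and for `A = 0, B = 1`:
everything but `00`. -/
theorem cReflNeg_mat : Circuit.mat (cReflNeg : Circuit (Wire Q n)) =
    1 - (2 : ℂ) • projM + (2 : ℂ) • projMAB := by
  refine eq_of_mulVec_eq fun ψ => ?_
  funext x
  rw [Matrix.add_mulVec, Matrix.sub_mulVec, Matrix.one_mulVec, Matrix.smul_mulVec,
    Matrix.smul_mulVec, Pi.add_apply, Pi.sub_apply, Pi.smul_apply, Pi.smul_apply,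
    projMAB_mulVec, projM_mulVec, ← Circuit.act, cReflNeg]
  simp only [Circuit.act_append, Circuit.act_cons, Circuit.act_nil, gX_mulVec, ccZ_act,
    cZ_mulVec]
  have hx : ∀ v, x wA = v → Function.update x wA v = x := fun v hb => by simp [← hb]
  cases h : x wM <;> cases h1 : x wA <;> cases h2 : x wB <;> simp [h, h2, hx _ h1]
  all_goals ring

theorem cW_act (Δ : ℝ) (j : Fin Q) (ψ : (Wire Q n → Bool) → ℂ) (x : Wire Q n → Bool) :
    Circuit.act (cW Δ j) ψ x = ∑ b, star ((gR2 Δ).1 b (x wB)) *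
      ((if x wM && b then selPhase Δ else 1) *
        ∑ c, (if x wA then (1 : Matrix.unitaryGroup Bool ℂ) else gR2 Δ).1 b c *
          ∑ a, (if x wM then gR1 Δ else 1).1 (x wA) a *
            ψ (Function.update (Function.update (swapIf (x wF ^^ (x wM && b)) j x) wB c) wA a)) := by
  rw [cW]
  simp only [Circuit.act_append, Circuit.act_cons, Circuit.act_nil, Gate.one_mulVec,
    unitary_inv_apply, cSelect_act, gCtl, gOctl, Gate.cond_mulVec, swapIf_update,
    Function.update_self, Function.update_idem]
  simp

theorem gR1_apply_false (Δ : ℝ) (h0 : 0 ≤ lcuNorm Δ) (h2 : lcuNorm Δ ≤ 2) :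
    (gR1 Δ).1 false false = ((lcuNorm Δ / 2 : ℝ) : ℂ) := by
  simp only [gR1, gRot, Matrix.of_apply, if_true]
  rw [Real.cos_arccos] <;> linarith

theorem gR2_apply_false (Δ : ℝ) (hc : 0 < Real.cos Δ) :
    (gR2 Δ).1 false false = ((Real.sqrt (Real.cos Δ / lcuNorm Δ) : ℝ) : ℂ) ∧
    (gR2 Δ).1 true false = ((Real.sqrt (|Real.sin Δ| / lcuNorm Δ) : ℝ) : ℂ) := by
  have hn : 0 < lcuNorm Δ := by unfold lcuNorm; positivity
  have hle : Real.cos Δ / lcuNorm Δ ≤ 1 := by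
    rw [div_le_one hn]; unfold lcuNorm; linarith [abs_nonneg (Real.sin Δ)]
  constructor
  · simp only [gR2, gRot, Matrix.of_apply, if_true]
    rw [Real.cos_arccos]
    · linarith [Real.sqrt_nonneg (Real.cos Δ / lcuNorm Δ)]
    · exact Real.sqrt_le_one.2 hle
  · simp only [gR2, gRot, Matrix.of_apply, if_true, Bool.true_eq_false, if_false]
    rw [Real.sin_arccos, Real.sq_sqrt (by positivity)]
    congr 3
    rw [eq_div_iff hn.ne', sub_mul, div_mul_cancel₀ _ hn.ne']
    unfold lcuNorm; ring

theorem selPhase_mul_abs_sin (Δ : ℝ) (h : |Δ| < Real.pi) :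
    selPhase Δ * ((|Real.sin Δ| : ℝ) : ℂ) = -Complex.I * Real.sin Δ := by
  unfold selPhase
  split_ifs with hΔ
  · rw [abs_of_nonneg (Real.sin_nonneg_of_nonneg_of_le_pi hΔ.le (abs_lt.1 h).2.le)]
  · rw [abs_of_nonpos (Real.sin_nonpos_of_nonpos_of_neg_pi_le (not_lt.1 hΔ) (abs_lt.1 h).1.le)]
    push_cast; ring

theorem lcuNorm_le_two (Δ : ℝ) : lcuNorm Δ ≤ 2 := by
  unfold lcuNorm
  linarith [Real.cos_le_one Δ, Real.abs_sin_le_one Δ]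

/-- The second ancilla yields `(cos Δ I - i sin Δ Swap) / a` with `a = lcuNorm Δ`. The first ancilla
multiplies this by `a / 2`, so the block is exactly half of the step, the amplitude for which a
single round of amplification is exact. The bound on `Δ` makes `cos Δ` positive, so its square root
is available. -/
theorem two_smul_projMAB_cW (Δ : ℝ) (h : |Δ| < Real.pi / 2) (j : Fin Q) :
    (2 : ℂ) • (projMAB * Circuit.mat (cW Δ j : Circuit (Wire Q n)) * projMAB) =
      stepU Δ j * projMAB := by
  have hc : 0 < Real.cos Δ := Real.cos_pos_of_mem_Ioo ⟨(abs_lt.1 h).1, (abs_lt.1 h).2⟩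
  have hn : 0 < lcuNorm Δ := by unfold lcuNorm; positivity
  obtain ⟨r0, r1⟩ := gR2_apply_false Δ hc
  have q0 : ((Real.sqrt (Real.cos Δ / lcuNorm Δ) : ℝ) : ℂ) *
      ((Real.sqrt (Real.cos Δ / lcuNorm Δ) : ℝ) : ℂ) * (lcuNorm Δ : ℂ) = Real.cos Δ := by
    rw [← Complex.ofReal_mul, Real.mul_self_sqrt (by positivity), ← Complex.ofReal_mul,
      div_mul_cancel₀ _ hn.ne']
  have q1 : ((Real.sqrt (|Real.sin Δ| / lcuNorm Δ) : ℝ) : ℂ) *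
      ((Real.sqrt (|Real.sin Δ| / lcuNorm Δ) : ℝ) : ℂ) * (lcuNorm Δ : ℂ) = |Real.sin Δ| := by
    rw [← Complex.ofReal_mul, Real.mul_self_sqrt (by positivity), ← Complex.ofReal_mul,
      div_mul_cancel₀ _ hn.ne']
  have q2 := selPhase_mul_abs_sin Δ (by linarith [Real.pi_pos])
  refine eq_of_mulVec_eq fun ψ => ?_
  funext x
  rw [Matrix.smul_mulVec, Pi.smul_apply, ← Matrix.mulVec_mulVec, ← Matrix.mulVec_mulVec,
    ← Matrix.mulVec_mulVec, projMAB_mulVec, stepU_mulVec, ← Circuit.act, cW_act]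
  simp only [projMAB_mulVec, swapIf_inl]
  cases hM : x wM
  · simp
  cases hA : x wA
  · cases hB : x wB
    · have r := gR1_apply_false Δ hn.le (lcuNorm_le_two Δ)
      rw [Complex.ofReal_div] at r
      have c0 := Complex.conj_ofReal (Real.sqrt (Real.cos Δ / lcuNorm Δ))
      have c1 := Complex.conj_ofReal (Real.sqrt (|Real.sin Δ| / lcuNorm Δ))
      generalize ((Real.sqrt (Real.cos Δ / lcuNorm Δ) : ℝ) : ℂ) = s0 at *
      generalize ((Real.sqrt (|Real.sin Δ| / lcuNorm Δ) : ℝ) : ℂ) = s1 at *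
      generalize ((|Real.sin Δ| : ℝ) : ℂ) = t1 at *
      generalize ((Real.sin Δ : ℝ) : ℂ) = t2 at *
      generalize ((Real.cos Δ : ℝ) : ℂ) = t3 at *
      have e : ∀ c, Function.update (Function.update (swapIf c j x) wB false) wA false
          = swapIf c j x := by
        intro c
        rw [Function.update_eq_self_iff.2, Function.update_eq_self_iff.2] <;> simp [hA, hB]
      simp only [Fintype.sum_bool]
      simp [hM, e, r, r0, r1, c0, c1]
      cases x wF <;> simp only [Bool.not_true, Bool.not_false]
      · linear_combination ψ (swapIf false j x) * q0 + ψ (swapIf true j x) * q2 +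
          ψ (swapIf true j x) * selPhase Δ * q1
      · linear_combination ψ (swapIf true j x) * q0 + ψ (swapIf false j x) * q2 +
          ψ (swapIf false j x) * selPhase Δ * q1
    · simp
  · simp

theorem projM_mul_cW (Δ : ℝ) (j : Fin Q) :
    projM * Circuit.mat (cW Δ j : Circuit (Wire Q n)) =
      Circuit.mat (cW Δ j : Circuit (Wire Q n)) * projM := by
  refine eq_of_mulVec_eq fun ψ => ?_
  funext x
  rw [← Matrix.mulVec_mulVec, ← Matrix.mulVec_mulVec, projM_mulVec, ← Circuit.act, cW_act,
    ← Circuit.act, cW_act]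
  simp only [projM_mulVec]
  cases hM : x wM <;> simp [hM]

theorem projM_mul_stepU (Δ : ℝ) (j : Fin Q) :
    projM * stepU Δ j = (stepU Δ j * projM : Matrix (Wire Q n → Bool) (Wire Q n → Bool) ℂ) := by
  refine eq_of_mulVec_eq fun ψ => ?_
  funext x
  rw [← Matrix.mulVec_mulVec, ← Matrix.mulVec_mulVec, projM_mulVec, stepU_mulVec, stepU_mulVec]
  simp only [projM_mulVec]
  cases hM : x wM <;> simp [hM]

theorem stepU_mul_projMAB (Δ : ℝ) (j : Fin Q) :
    stepU Δ j * projMAB = (projMAB * stepU Δ j : Matrix (Wire Q n → Bool) (Wire Q n → Bool) ℂ) := by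
  refine eq_of_mulVec_eq fun ψ => ?_
  funext x
  rw [← Matrix.mulVec_mulVec, ← Matrix.mulVec_mulVec, projMAB_mulVec, stepU_mulVec, stepU_mulVec]
  simp only [projMAB_mulVec, swapIf_inl]
  split_ifs <;> simp

theorem cA_mat (Δ : ℝ) (j : Fin Q) : Circuit.mat (cA Δ j : Circuit (Wire Q n)) =
    Circuit.mat (cW Δ j) * (1 - (2 : ℂ) • projM + (2 : ℂ) • projMAB) * (Circuit.mat (cW Δ j))ᴴ *
      (1 - (2 : ℂ) • projMAB) * Circuit.mat (cW Δ j) := by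
  rw [cA, Circuit.mat_append, Circuit.mat_append, Circuit.mat_append, Circuit.mat_append,
    Circuit.inv_mat, cRefl_mat, cReflNeg_mat]
  simp only [Matrix.mul_assoc]

theorem cA_mat_mul_projMAB (Δ : ℝ) (h : |Δ| < Real.pi / 2) (j : Fin Q) :
    Circuit.mat (cA Δ j : Circuit (Wire Q n)) * projMAB = stepU Δ j * projMAB := by
  rw [cA_mat]
  refine amplification (Circuit.mat_mul_conjTranspose _) (Circuit.conjTranspose_mat_mul _)
    (stepU_unitary Δ j) ?_ ?_ ?_ (stepU_mul_projMAB Δ j) ?_ (projM_mul_cW Δ j)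
    (projM_mul_stepU Δ j) (two_smul_projMAB_cW Δ h j)
  · rw [projMAB, Matrix.diagonal_conjTranspose]; congr 1; funext x
    simp only [Pi.star_apply, apply_ite star, star_one, star_zero]
  · rw [projMAB, Matrix.diagonal_mul_diagonal]; congr 1; funext x; split_ifs <;> simp
  · rw [projM, projMAB, Matrix.diagonal_mul_diagonal]; congr 1; funext x
    cases x wM <;> simp
  · rw [projM, Matrix.diagonal_conjTranspose]; congr 1; funext x
    simp only [Pi.star_apply, apply_ite star, star_one, star_zero]

/-- The step does nothing if the measured qubit is `0`. -/
theorem cA_mulVec_of_measured_false (Δ : ℝ) (j : Fin Q) (ψ : (Wire Q n → Bool) → ℂ)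
    (hψ : ∀ x, ψ x ≠ 0 → ∀ a : Fin 4, x (.inl a) = false) :
    Circuit.mat (cA Δ j : Circuit (Wire Q n)) *ᵥ ψ = ψ := by
  have hψ' : ∀ x (a : Fin 4), x (.inl a) = true → ψ x = 0 := by
    intro x a hx
    by_contra h
    simpa [hx] using hψ x h a
  -- With the measured qubit at `0` only the rotation of the second ancilla and its inverse act, and
  -- they cancel. The reflections are trivial because both projections annihilate `ψ`.
  have hW : Circuit.mat (cW Δ j : Circuit (Wire Q n)) *ᵥ ψ = ψ := by
    funext x
    rw [← Circuit.act, cW_act]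
    have key : ∀ b c, ∑ d, star ((gR2 Δ).1 d b) * (gR2 Δ).1 d c = if b = c then 1 else 0 := by
      intro b c
      have := congrFun (congrFun (congrArg Subtype.val (inv_mul_cancel (gR2 Δ))) b) c
      rwa [Matrix.UnitaryGroup.mul_val, Matrix.mul_apply, Matrix.UnitaryGroup.one_val,
        Matrix.one_apply] at this
    cases hM : x wM
    · cases hA : x wA
      · cases hF : x wF
        · have e1 : ∀ c, Function.update (Function.update x wB c) wA false
              = Function.update x wB c := by
            intro c
            rw [Function.update_eq_self_iff.2]; simp [hA]
          simp only [Bool.false_and, Bool.xor_false, Bool.false_eq_true, if_false, swapIf, one_mul,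
            one_apply', Finset.mul_sum, ← mul_assoc]
          rw [Finset.sum_comm]
          simp only [ite_mul, zero_mul, Finset.sum_ite_eq, Finset.mem_univ, if_true,
            e1, mul_ite, mul_one, mul_zero]
          simp only [← Finset.sum_mul, key]
          simp
        · rw [hψ' x 3 hF]
          simp [hψ' _ 3, hF]
      · rw [hψ' x 1 hA]
        simp only [Bool.false_and, Bool.xor_false, Bool.false_eq_true, if_false, one_apply',
          ite_mul, one_mul, zero_mul, Finset.sum_ite_eq, Finset.mem_univ, if_true]
        simp [hψ' _ 1]
    · rw [hψ' x 0 hM]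
      simp [hψ' _ 0, hM]
  have hW' : (Circuit.mat (cW Δ j : Circuit (Wire Q n)))ᴴ *ᵥ ψ = ψ := by
    conv_lhs => rw [← hW]
    rw [Matrix.mulVec_mulVec, Circuit.conjTranspose_mat_mul, Matrix.one_mulVec]
  have hM : projM *ᵥ ψ = 0 := by
    funext x; rw [projM_mulVec]; split_ifs with h
    · exact hψ' x 0 h
    · rfl
  have hMAB : projMAB *ᵥ ψ = 0 := by
    funext x; rw [projMAB_mulVec]; split_ifs with h
    · exact hψ' x 0 (by simp only [Bool.and_eq_true] at h; exact h.1.1)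
    · rfl
  rw [cA_mat]
  simp only [← Matrix.mulVec_mulVec, hW, hW', Matrix.sub_mulVec, Matrix.add_mulVec,
    Matrix.one_mulVec, Matrix.smul_mulVec, hM, hMAB, smul_zero, sub_zero, add_zero]

end Step

end RenyiEst
end

noncomputable section
set_option linter.unusedSectionVars false

namespace RenyiEst
open Matrix

/-! ### Swaps of identical copies -/

section Copies

variable {X : Type} [Fintype X] [DecidableEq X] {Q : ℕ}

/-- Exchange the entries `0` and `j + 1`. -/
def swapCoord (j : Fin Q) (d : Fin (Q + 1) → X) : Fin (Q + 1) → X :=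
  fun r => d (Equiv.swap 0 j.succ r)

@[simp] theorem swapCoord_swapCoord (j : Fin Q) (d : Fin (Q + 1) → X) :
    swapCoord j (swapCoord j d) = d := by
  funext r; simp [swapCoord]

/-- The operator `cos Δ I - i sin Δ Swap` on the main register and register `j + 1`. -/
def copyU (Δ : ℝ) (j : Fin Q) : Matrix (Fin (Q + 1) → X) (Fin (Q + 1) → X) ℂ :=
  Matrix.of fun d d' => (Real.cos Δ : ℂ) * (if d' = d then 1 else 0)
    + (-Complex.I * Real.sin Δ) * (if d' = swapCoord j d then 1 else 0)

theorem copyU_mul_apply {Y : Type*} (Δ : ℝ) (j : Fin Q)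
    (M : Matrix (Fin (Q + 1) → X) Y ℂ) (d : Fin (Q + 1) → X) (y : Y) :
    ((copyU Δ j : Matrix (Fin (Q + 1) → X) (Fin (Q + 1) → X) ℂ) * M) d y = Real.cos Δ * M d y - Complex.I * Real.sin Δ * M (swapCoord j d) y := by
  simp only [copyU, Matrix.mul_apply, Matrix.of_apply, add_mul, Finset.sum_add_distrib,
    mul_assoc, ← Finset.mul_sum, ite_mul, one_mul, zero_mul, Finset.sum_ite_eq', Finset.mem_univ,
    if_true]
  ring

theorem copyU_mulVec (Δ : ℝ) (j : Fin Q) (φ : (Fin (Q + 1) → X) → ℂ) (d : Fin (Q + 1) → X) :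
    (copyU Δ j *ᵥ φ) d = Real.cos Δ * φ d - Complex.I * Real.sin Δ * φ (swapCoord j d) := by
  simp only [copyU, Matrix.mulVec, dotProduct, Matrix.of_apply, add_mul, Finset.sum_add_distrib,
    mul_assoc, ← Finset.mul_sum, ite_mul, one_mul, zero_mul, Finset.sum_ite_eq', Finset.mem_univ,
    if_true]
  ring

theorem copyU_unitary (Δ : ℝ) (j : Fin Q) :
    (copyU Δ j : Matrix (Fin (Q + 1) → X) (Fin (Q + 1) → X) ℂ)ᴴ * copyU Δ j = 1 := by
  have hH : (copyU Δ j : Matrix (Fin (Q + 1) → X) (Fin (Q + 1) → X) ℂ)ᴴ = copyU (-Δ) j := by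
    ext d d'
    have h0 : d = d' ↔ d' = d := eq_comm
    have h1 : d = swapCoord j d' ↔ d' = swapCoord j d := by
      constructor <;> (intro h; rw [h]; simp)
    rw [Matrix.conjTranspose_apply]
    simp only [copyU, Matrix.of_apply, h0, h1, star_add, star_mul', apply_ite star, star_zero,
      star_one, star_neg, Complex.star_def, Complex.conj_I, Complex.conj_ofReal, Real.cos_neg,
      Real.sin_neg, Complex.ofReal_neg]
    ring
  rw [hH]
  refine eq_of_mulVec_eq fun φ => ?_
  rw [← Matrix.mulVec_mulVec, Matrix.one_mulVec]
  funext d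
  have h : (Real.cos Δ : ℂ) * Real.cos Δ + Real.sin Δ * Real.sin Δ = 1 := by
    rw [← Complex.ofReal_mul, ← Complex.ofReal_mul, ← Complex.ofReal_add, ← sq, ← sq,
      Real.cos_sq_add_sin_sq, Complex.ofReal_one]
  simp only [copyU_mulVec, swapCoord_swapCoord, Real.cos_neg, Real.sin_neg, Complex.ofReal_neg]
  linear_combination φ d * h - (φ d * Real.sin Δ * Real.sin Δ) * Complex.I_mul_I

/-- The successive application of the operators `copyU Δ j`, for `j` in the list. -/
def chain (Δ : ℝ) : List (Fin Q) → Matrix (Fin (Q + 1) → X) (Fin (Q + 1) → X) ℂ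
  | [] => 1
  | j :: l => chain Δ l * copyU Δ j

theorem chain_append_singleton (Δ : ℝ) (l : List (Fin Q)) (j : Fin Q) :
    (chain Δ (l ++ [j]) : Matrix (Fin (Q + 1) → X) (Fin (Q + 1) → X) ℂ) =
      copyU Δ j * chain Δ l := by
  induction l with
  | nil => simp [chain]
  | cons i l ih => simp [chain, ih, Matrix.mul_assoc]

theorem chain_unitary (Δ : ℝ) (l : List (Fin Q)) :
    (chain Δ l : Matrix (Fin (Q + 1) → X) (Fin (Q + 1) → X) ℂ)ᴴ * chain Δ l = 1 := by
  induction l with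
  | nil => simp [chain]
  | cons j l ih =>
    rw [chain, Matrix.conjTranspose_mul, Matrix.mul_assoc, ← Matrix.mul_assoc _ (chain Δ l), ih,
      Matrix.one_mul, copyU_unitary]

/-- The state consisting of `Q + 1` copies of `ρ`. -/
def copyState (ρ : Matrix X X ℂ) (Q : ℕ) : Matrix (Fin (Q + 1) → X) (Fin (Q + 1) → X) ℂ :=
  Matrix.of fun d d' => ∏ r, ρ (d r) (d' r)

theorem trace_copyState (ρ : Matrix X X ℂ) (Q : ℕ) : (copyState ρ Q).trace = ρ.trace ^ (Q + 1) := by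
  simp only [Matrix.trace, Matrix.diag_apply, copyState, Matrix.of_apply]
  rw [Fintype.sum_pow]

theorem conjTranspose_copyState {ρ : Matrix X X ℂ} (h : ρᴴ = ρ) (Q : ℕ) :
    (copyState ρ Q)ᴴ = copyState ρ Q := by
  ext d d'
  rw [Matrix.conjTranspose_apply]
  simp only [copyState, Matrix.of_apply, star_prod]
  refine Finset.prod_congr rfl fun r _ => ?_
  rw [← Matrix.conjTranspose_apply, h]

/-- The tensor product of `M` with a state of the last register. -/
def tensLast (M : Matrix (Fin (Q + 1) → X) (Fin (Q + 1) → X) ℂ) (ρ : Matrix X X ℂ) :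
    Matrix (Fin (Q + 2) → X) (Fin (Q + 2) → X) ℂ :=
  Matrix.of fun d d' => M (Fin.init d) (Fin.init d') * ρ (d (Fin.last _)) (d' (Fin.last _))

theorem copyState_succ (ρ : Matrix X X ℂ) (Q : ℕ) :
    copyState ρ (Q + 1) = tensLast (copyState ρ Q) ρ := by
  ext d d'
  simp only [copyState, tensLast, Matrix.of_apply]
  rw [Fin.prod_univ_castSucc]
  rfl

theorem init_swapCoord (j : Fin Q) (d : Fin (Q + 2) → X) :
    Fin.init (swapCoord j.castSucc d) = swapCoord j (Fin.init d) := by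
  funext r
  simp only [Fin.init, swapCoord]
  congr 1
  by_cases h0 : r = 0
  · subst h0; simp
  · by_cases h1 : r = j.succ
    · subst h1
      rw [← Fin.succ_castSucc, Equiv.swap_apply_right, Equiv.swap_apply_right]; rfl
    · rw [Equiv.swap_apply_of_ne_of_ne h0 h1, Equiv.swap_apply_of_ne_of_ne]
      · simpa using h0
      · rw [Fin.succ_castSucc]; exact fun h => h1 (Fin.castSucc_injective _ h)

/-- The earlier steps do not touch the last register, so that register can be split off and traced
out first. -/
theorem copyU_mul_tensLast (Δ : ℝ) (j : Fin Q)
    (M : Matrix (Fin (Q + 1) → X) (Fin (Q + 1) → X) ℂ) (ρ : Matrix X X ℂ) :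
    copyU Δ j.castSucc * tensLast M ρ = tensLast (copyU Δ j * M) ρ := by
  ext d d'
  have h : swapCoord j.castSucc d (Fin.last (Q + 1)) = d (Fin.last (Q + 1)) := by
    rw [swapCoord, Equiv.swap_apply_of_ne_of_ne]
    · exact Fin.last_pos.ne'
    · rw [Fin.succ_castSucc]; exact (Fin.castSucc_lt_last _).ne'
  rw [copyU_mul_apply]
  simp only [tensLast, Matrix.of_apply, copyU_mul_apply, init_swapCoord, h]
  ring

theorem chain_mul_tensLast (Δ : ℝ) (l : List (Fin Q))
    (M : Matrix (Fin (Q + 1) → X) (Fin (Q + 1) → X) ℂ) (ρ : Matrix X X ℂ) :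
    chain Δ (l.map Fin.castSucc) * tensLast M ρ = tensLast (chain Δ l * M) ρ := by
  induction l generalizing M with
  | nil => simp [chain]
  | cons j l ih =>
    rw [List.map_cons, chain, chain, Matrix.mul_assoc, copyU_mul_tensLast, ih, Matrix.mul_assoc]

/-- The trace of the product of `M` with the operator `G` on the main register. -/
def traceMain (G : Matrix X X ℂ) (M : Matrix (Fin (Q + 1) → X) (Fin (Q + 1) → X) ℂ) : ℂ :=
  ∑ d, ∑ e, G (d 0) e * M (Function.update d 0 e) d

theorem traceMain_one (M : Matrix (Fin (Q + 1) → X) (Fin (Q + 1) → X) ℂ) :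
    traceMain 1 M = M.trace := by
  simp [traceMain, Matrix.trace, Matrix.one_apply]

/-- Partial trace over the fresh copy: the identity part gives the factor `tr ρ = 1`, while `tr ((G
⊗ 1) Swap (M ⊗ ρ)) = tr (G ρ M)` moves `ρ` to the main register. -/
theorem traceMain_copyU_last (Δ : ℝ) (G ρ : Matrix X X ℂ) (hρ : ρ.trace = 1)
    (M : Matrix (Fin (Q + 1) → X) (Fin (Q + 1) → X) ℂ) :
    traceMain G (copyU Δ (Fin.last Q) * tensLast M ρ) =
      Real.cos Δ * traceMain G M - Complex.I * Real.sin Δ * traceMain (G * ρ) M := by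
  have hup : ∀ (d : Fin (Q + 1) → X) (f e : X),
      Function.update (Fin.snoc d f : Fin (Q + 2) → X) 0 e = Fin.snoc (Function.update d 0 e) f := by
    intro d f e
    rw [Fin.snoc_update]; rfl
  have hsw : ∀ (d : Fin (Q + 1) → X) (f : X), swapCoord (Fin.last Q) (Fin.snoc d f : Fin (Q + 2) → X)
      = Fin.snoc (Function.update d 0 f) (d 0) := by
    intro d f
    funext r
    simp only [swapCoord]
    refine Fin.lastCases ?_ (fun r => ?_) r
    · rw [← Fin.succ_last, Equiv.swap_apply_right, Fin.succ_last, Fin.snoc_last]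
      exact Fin.snoc_castSucc (α := fun _ => X) f d 0
    · rw [Fin.snoc_castSucc]
      by_cases h : r = 0
      · subst h
        rw [Fin.castSucc_zero, Equiv.swap_apply_left, Fin.succ_last, Fin.snoc_last,
          Function.update_self]
      · rw [Equiv.swap_apply_of_ne_of_ne, Fin.snoc_castSucc, Function.update_of_ne h]
        · simpa using h
        · rw [Fin.succ_last]; exact (Fin.castSucc_lt_last _).ne
  rw [traceMain, ← (Fin.snocEquiv (fun _ : Fin (Q + 2) => X)).sum_comp, Fintype.sum_prod_type]
  have h0 : ∀ (f : X) (d : Fin (Q + 1) → X), (Fin.snocEquiv (fun _ : Fin (Q + 2) => X)) (f, d) =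
      (Fin.snoc d f : Fin (Q + 2) → X) := fun _ _ => rfl
  have h1 : ∀ (f : X) (d : Fin (Q + 1) → X), (Fin.snoc d f : Fin (Q + 2) → X) 0 = d 0 :=
    fun f d => Fin.snoc_castSucc (α := fun _ => X) f d 0
  simp only [h0, h1, hup, copyU_mul_apply, hsw, tensLast, Matrix.of_apply, Fin.init_snoc,
    Fin.snoc_last, Function.update_self, Function.update_idem]
  rw [Finset.sum_comm]
  simp only [traceMain, Finset.mul_sum, ← Finset.sum_sub_distrib]
  refine Finset.sum_congr rfl fun d _ => ?_
  simp only [mul_sub, Finset.sum_sub_distrib]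
  congr 1
  · rw [Finset.sum_comm]
    refine Finset.sum_congr rfl fun e _ => ?_
    calc _ = Real.cos Δ * (G (d 0) e * M (Function.update d 0 e) d) * ∑ f, ρ f f := by
          rw [Finset.mul_sum]; exact Finset.sum_congr rfl fun f _ => by ring
      _ = _ := by
          have : ∑ f, ρ f f = 1 := hρ
          rw [this, mul_one]
  · refine Finset.sum_congr rfl fun f _ => ?_
    rw [Matrix.mul_apply, Finset.sum_mul, Finset.mul_sum]
    exact Finset.sum_congr rfl fun e _ => by ring

/-- Peeling off the last step multiplies `G` on the right by `cos Δ - i sin Δ ρ`, so the induction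
has to run over all `G`. -/
theorem traceMain_chain_copyState (Δ : ℝ) (ρ : Matrix X X ℂ) (hρ : ρ.trace = 1) (Q : ℕ)
    (G : Matrix X X ℂ) :
    traceMain G (chain Δ (List.finRange Q) * copyState ρ Q) =
      (G * ((Real.cos Δ : ℂ) • 1 - (Complex.I * Real.sin Δ) • ρ) ^ Q * ρ).trace := by
  induction Q generalizing G with
  | zero =>
    simp only [List.finRange_zero, chain, Matrix.one_mul, pow_zero, Matrix.mul_one]
    rw [traceMain, ← (Equiv.funUnique (Fin 1) X).symm.sum_comp]
    simp [copyState, Matrix.trace, Matrix.mul_apply, Equiv.funUnique]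
  | succ Q ih =>
    rw [List.finRange_succ_last, chain_append_singleton, copyState_succ, Matrix.mul_assoc,
      chain_mul_tensLast, traceMain_copyU_last Δ G ρ hρ, ih, ih, pow_succ']
    simp only [Matrix.mul_sub, Matrix.sub_mul, Matrix.trace_sub, Matrix.mul_smul, Matrix.smul_mul,
      Matrix.trace_smul, smul_eq_mul, Matrix.mul_assoc, Matrix.one_mul]

theorem trace_chain_copyState (Δ : ℝ) (ρ : Matrix X X ℂ) (hρ : ρ.trace = 1) (Q : ℕ) :
    (chain Δ (List.finRange Q) * copyState ρ Q).trace =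
      (((Real.cos Δ : ℂ) • 1 - (Complex.I * Real.sin Δ) • ρ) ^ Q * ρ).trace := by
  rw [← traceMain_one, traceMain_chain_copyState Δ ρ hρ, Matrix.one_mul]

end Copies

end RenyiEst
end

noncomputable section
namespace RenyiEst
open Matrix
open scoped ComplexOrder

/-! ### The measurement statistics of the circuit -/

section Outcome

variable {Q n : ℕ}

/-- Operators on all the qubits. -/
abbrev WireMat (Q n : ℕ) : Type := Matrix (Wire Q n → Bool) (Wire Q n → Bool) ℂ

/-- Operators on the registers. -/
abbrev RegMat (Q n : ℕ) : Type := Matrix (Fin (Q + 1) → Bits n) (Fin (Q + 1) → Bits n) ℂ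

/-- Operators from the registers to all the qubits. -/
abbrev EmbMat (Q n : ℕ) : Type := Matrix (Wire Q n → Bool) (Fin (Q + 1) → Bits n) ℂ

/-- The labels with measured qubit `m`, ancillas and flag `0`, and registers `d`. -/
def embedBits (m : Bool) (d : Fin (Q + 1) → Bits n) : Wire Q n → Bool
  | .inl a => if a = 0 then m else false
  | .inr (r, i) => d r i

/-- The isometry setting the measured qubit to `m`, the ancillas and the flag to `0`. -/
def embed (m : Bool) : EmbMat Q n :=
  Matrix.of fun x d => if x = embedBits m d then 1 else 0

theorem embed_mulVec (m : Bool) (φ : (Fin (Q + 1) → Bits n) → ℂ) (x : Wire Q n → Bool) :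
    (embed m *ᵥ φ) x = if x wM = m ∧ x wA = false ∧ x wB = false ∧ x wF = false then
      φ (fun r i => x (wD r i)) else 0 := by
  have key : ∀ d : Fin (Q + 1) → Bits n, x = embedBits m d ↔
      (x wM = m ∧ x wA = false ∧ x wB = false ∧ x wF = false) ∧ d = fun r i => x (wD r i) := by
    intro d
    constructor
    · intro h; rw [h]; simp [embedBits]
    · rintro ⟨⟨h0, h1, h2, h3⟩, rfl⟩
      funext z
      rcases z with a | ⟨r, i⟩
      · fin_cases a <;> simp [embedBits, h0, h1, h2, h3]
      · rfl
  simp only [embed, Matrix.mulVec, dotProduct, Matrix.of_apply, key]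
  split_ifs with h
  · simp [h]
  · simp [h]

theorem rect_eq_of_mulVec_eq {X Y : Type*} [Fintype Y] [DecidableEq Y] {A B : Matrix X Y ℂ}
    (h : ∀ ψ, A *ᵥ ψ = B *ᵥ ψ) : A = B :=
  Matrix.mulVec_injective (funext h)

theorem embed_conjTranspose_mul (m : Bool) :
    (embed m : EmbMat Q n)ᴴ *
      (embed m : EmbMat Q n) = 1 := by
  have hinj : Function.Injective (embedBits m : (Fin (Q + 1) → Bits n) → Wire Q n → Bool) := by
    intro d d' h
    funext r i
    exact congrFun h (.inr (r, i))
  ext d d'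
  simp only [Matrix.mul_apply, Matrix.conjTranspose_apply, embed, Matrix.of_apply, mul_ite, mul_one,
    mul_zero, Finset.sum_ite_eq', Finset.mem_univ, if_true, hinj.eq_iff, Matrix.one_apply,
    apply_ite star, star_one, star_zero, eq_comm]

theorem hadamard_mul_embed (m : Bool) :
    (Circuit.mat [Gate.one wM gH] : WireMat Q n) * (embed m : EmbMat Q n) =
      ((Real.sqrt 2 / 2 : ℝ) : ℂ) •
        (embed false + (if m then (-1 : ℂ) else 1) • embed true) := by
  refine rect_eq_of_mulVec_eq fun φ => ?_
  rw [← Matrix.mulVec_mulVec, Matrix.smul_mulVec, Matrix.add_mulVec, Matrix.smul_mulVec,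
    ← Circuit.act]
  funext x
  rw [Circuit.act_cons, Circuit.act_nil, Gate.one_mulVec]
  simp only [Pi.smul_apply, Pi.add_apply, smul_eq_mul, embed_mulVec, gH_apply, Fintype.sum_bool]
  cases hM : x wM <;> cases m <;> simp

theorem cA_mul_embed_false (Δ : ℝ) (j : Fin Q) :
    (Circuit.mat (cA Δ j) : WireMat Q n) * (embed false : EmbMat Q n) =
      embed false := by
  refine rect_eq_of_mulVec_eq fun φ => ?_
  rw [← Matrix.mulVec_mulVec]
  refine cA_mulVec_of_measured_false Δ j _ fun x hx a => ?_
  rw [embed_mulVec] at hx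
  have h := (ite_ne_right_iff.1 hx).1
  fin_cases a
  · exact h.1
  · exact h.2.1
  · exact h.2.2.1
  · exact h.2.2.2

/-- The embedded states are fixed by `projMAB`, so the amplified module is `stepU` on them; the flag
being `0`, this is the partial swap of the registers. The ancillas return to `0`, so the next module
starts clean. -/
theorem cA_mul_embed_true (Δ : ℝ) (h : |Δ| < Real.pi / 2) (j : Fin Q) :
    (Circuit.mat (cA Δ j) : WireMat Q n) * (embed true : EmbMat Q n) =
      (embed true : EmbMat Q n) * (copyU Δ j : RegMat Q n) := by
  have hP : (projMAB : WireMat Q n) * (embed true : EmbMat Q n) =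
      embed true := by
    refine rect_eq_of_mulVec_eq fun φ => ?_
    rw [← Matrix.mulVec_mulVec]
    funext x
    rw [projMAB_mulVec, embed_mulVec]
    split_ifs with h1 h2 h2
    · rfl
    · rfl
    · simp [h2.1, h2.2.1, h2.2.2.1] at h1
    · rfl
  rw [← hP, ← Matrix.mul_assoc, cA_mat_mul_projMAB Δ h, Matrix.mul_assoc, hP]
  refine rect_eq_of_mulVec_eq fun φ => ?_
  rw [← Matrix.mulVec_mulVec, ← Matrix.mulVec_mulVec]
  funext x
  rw [stepU_mulVec]
  simp only [embed_mulVec, swapIf_inl]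
  cases hF : x wF
  · have e : (fun r i => swapIf true j x (wD r i)) = swapCoord j fun r i => x (wD r i) := by
      funext r i
      exact swapReg_inr j x r i
    split_ifs with h1
    · rw [copyU_mulVec, Bool.not_false, e]
      rfl
    · simp
  · simp

theorem cAs_mul_embed_false (Δ : ℝ) (l : List (Fin Q)) :
    (Circuit.mat (l.flatMap fun j => cA Δ j) : WireMat Q n) *
      (embed false : EmbMat Q n) = embed false := by
  induction l with
  | nil => simp [Circuit.mat]
  | cons j l ih =>
    rw [List.flatMap_cons, Circuit.mat_append, Matrix.mul_assoc, cA_mul_embed_false, ih]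

theorem cAs_mul_embed_true (Δ : ℝ) (h : |Δ| < Real.pi / 2) (l : List (Fin Q)) :
    (Circuit.mat (l.flatMap fun j => cA Δ j) : WireMat Q n) *
      (embed true : EmbMat Q n) =
        (embed true : EmbMat Q n) * (chain Δ l : RegMat Q n) := by
  induction l with
  | nil => simp [Circuit.mat, chain]
  | cons j l ih =>
    rw [List.flatMap_cons, Circuit.mat_append, Matrix.mul_assoc, cA_mul_embed_true Δ h,
      ← Matrix.mul_assoc, ih, chain, Matrix.mul_assoc]

theorem cosCircuit_mul_embed (t : ℝ) (h : Q ≠ 0 → |t / Q| < Real.pi / 2) :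
    Circuit.mat (cosCircuit n Q t) *
      (embed false : EmbMat Q n) =
      (1 / 2 : ℂ) •
        ((embed false : EmbMat Q n) * (1 + chain (t / Q) (List.finRange Q) : RegMat Q n) +
          (embed true : EmbMat Q n) * (1 - chain (t / Q) (List.finRange Q) : RegMat Q n)) := by
  -- For `Q = 0` the quotient is `0` by convention, so the bound is only required of a circuit that
  -- has steps.
  have h' : |t / Q| < Real.pi / 2 := by
    rcases eq_or_ne Q 0 with rfl | hQ
    · simp [Real.pi_pos]
    · exact h hQ
  have h2 : ((Real.sqrt 2 / 2 : ℝ) : ℂ) * ((Real.sqrt 2 / 2 : ℝ) : ℂ) = 1 / 2 := by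
    rw [← Complex.ofReal_mul]
    have : Real.sqrt 2 / 2 * (Real.sqrt 2 / 2) = 1 / 2 := by
      have := Real.mul_self_sqrt (show (0 : ℝ) ≤ 2 by norm_num)
      nlinarith
    rw [this]; norm_num
  rw [cosCircuit, Circuit.mat_append, Circuit.mat_append, Matrix.mul_assoc, Matrix.mul_assoc,
    hadamard_mul_embed, Matrix.mul_smul, Matrix.mul_add, Matrix.mul_smul, Matrix.mul_smul,
    cAs_mul_embed_false,
    cAs_mul_embed_true _ h', Matrix.mul_add, Matrix.mul_smul, ← Matrix.mul_assoc,
    hadamard_mul_embed, hadamard_mul_embed, ← h2]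
  simp only [Bool.false_eq_true, if_false, if_true, one_smul, neg_smul, Matrix.smul_mul,
    Matrix.mul_add, Matrix.mul_sub, Matrix.add_mul, Matrix.mul_one, Matrix.neg_mul]
  module

theorem initState_eq (ρ : Matrix (Bits n) (Bits n) ℂ) (Q : ℕ) :
    initState ρ Q = (embed false : EmbMat Q n) * copyState ρ Q * (embed false : EmbMat Q n)ᴴ := by
  refine eq_of_mulVec_eq fun ψ => ?_
  rw [← Matrix.mulVec_mulVec, ← Matrix.mulVec_mulVec]
  have hE : (embed false : EmbMat Q n)ᴴ *ᵥ ψ =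
      fun d => ψ (embedBits false d) := by
    funext d
    simp only [Matrix.mulVec, dotProduct, Matrix.conjTranspose_apply, embed, Matrix.of_apply,
      apply_ite star, star_one, star_zero, ite_mul, one_mul, zero_mul, Finset.sum_ite_eq',
      Finset.mem_univ, if_true]
  funext x
  rw [hE, embed_mulVec]
  have hinj : Function.Injective (embedBits false : (Fin (Q + 1) → Bits n) → Wire Q n → Bool) := by
    intro d d' h
    funext r i
    exact congrFun h (.inr (r, i))
  have hcond : (∀ a : Fin 4, x (.inl a) = false) ↔
      (x wM = false ∧ x wA = false ∧ x wB = false ∧ x wF = false) := by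
    constructor
    · intro h; exact ⟨h 0, h 1, h 2, h 3⟩
    · rintro ⟨h0, h1, h2, h3⟩ a
      fin_cases a <;> assumption
  symm
  by_cases hx : ∀ a : Fin 4, x (.inl a) = false
  · rw [if_pos (hcond.1 hx)]
    refine Fintype.sum_of_injective _ hinj _ _ ?_ ?_
    · intro y hy
      simp only [initState]
      rw [if_neg, zero_mul, zero_mul]
      rintro ⟨-, hy'⟩
      refine hy ⟨fun r i => y (wD r i), ?_⟩
      funext z
      rcases z with a | ⟨r, i⟩
      · rw [hy' a]; simp [embedBits]
      · rfl
    · intro d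
      simp only [initState]
      rw [if_pos, one_mul]
      · rfl
      · exact ⟨hx, fun a => by simp [embedBits]⟩
  · rw [if_neg (fun h => hx (hcond.2 h))]
    refine (Finset.sum_eq_zero fun y _ => ?_).symm
    simp [initState, hx]

/-- The expectation of the measurement: the difference of the two outcome probabilities. -/
def meanOutcome (ρ : Matrix (Bits n) (Bits n) ℂ) (Q : ℕ) (t : ℝ) : ℝ :=
  ((((Real.cos (t / Q) : ℂ) • 1 - (Complex.I * Real.sin (t / Q)) • ρ) ^ Q * ρ).trace).re

/-- The Hadamard test: outcome `b` leaves the unnormalised operator `(1 ± V) / 2` on the copies `D`,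
and unitarity of `V` gives the trace `(2 ± 2 Re tr (V D)) / 4`. That `D` is Hermitian makes `tr (Vᴴ
D)` the conjugate of `tr (V D)`. -/
theorem outcomeProb_eq {ρ : Matrix (Bits n) (Bits n) ℂ} (hρ : IsState ρ) (Q : ℕ) (t : ℝ)
    (h : Q ≠ 0 → |t / Q| < Real.pi / 2) (b : Bool) :
    outcomeProb ρ Q t b = (1 + (if b then -1 else 1) * meanOutcome ρ Q t) / 2 := by
  set V : RegMat Q n :=
    chain (t / Q) (List.finRange Q) with hV
  set s : ℂ := if b then -1 else 1 with hs
  set D : RegMat Q n := copyState ρ Q with hD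
  set C : WireMat Q n := Circuit.mat (cosCircuit n Q t) with hC
  set F : WireMat Q n :=
    Matrix.diagonal fun x => if x wM = b then 1 else 0 with hF
  have hFm : ∀ m, F * (embed m : EmbMat Q n) =
      if m = b then embed m else 0 := by
    intro m
    refine rect_eq_of_mulVec_eq fun φ => ?_
    rw [← Matrix.mulVec_mulVec]
    funext x
    rw [hF, Matrix.mulVec_diagonal, embed_mulVec]
    by_cases hm : m = b
    · simp only [hm, if_true, embed_mulVec]
      split_ifs with h1 h2 h2
      · simp
      · simp
      · exact absurd h2.1 h1
      · simp
    · simp only [hm, if_false, Matrix.zero_mulVec, Pi.zero_apply]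
      split_ifs with h1 h2 h2
      · exact absurd (h2.1.symm.trans h1) hm
      · simp
      · simp
      · simp
  have hFC : F * (C * (embed false : EmbMat Q n)) = (1 / 2 : ℂ) • ((embed b : EmbMat Q n) * (1 + s • V)) := by
    rw [hC, cosCircuit_mul_embed t h, Matrix.mul_smul, Matrix.mul_add, ← Matrix.mul_assoc,
      ← Matrix.mul_assoc, hFm, hFm]
    cases b
    · simp [hs, hV]
    · simp [hs, hV, sub_eq_add_neg]
  have h1 : (outcomeProb ρ Q t b : ℂ) =
      (F * (C * (embed false : EmbMat Q n)) * D * (F * (C * (embed false : EmbMat Q n)))ᴴ).trace.re := by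
    have e : F * (C * (embed false : EmbMat Q n)) * D * (F * (C * (embed false : EmbMat Q n)))ᴴ =
        F * (C * initState ρ Q * Cᴴ) * Fᴴ := by
      rw [initState_eq]
      simp only [Matrix.conjTranspose_mul, Matrix.mul_assoc]
      rfl
    have hFH : Fᴴ = F := by
      rw [hF, Matrix.diagonal_conjTranspose]; congr 1; funext x
      simp only [Pi.star_apply, apply_ite star, star_one, star_zero]
    rw [e, hFH, outcomeProb, Matrix.trace, Complex.re_sum]
    congr 1
    refine Finset.sum_congr rfl fun x _ => ?_
    rw [Matrix.diag_apply, hF, Matrix.mul_diagonal, Matrix.diagonal_mul]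
    split_ifs <;> simp [hC]
  have hss : star s = s := by
    rw [hs]; split_ifs <;> simp
  have hs2 : s * s = 1 := by
    rw [hs]; split_ifs <;> simp
  have hVV : Vᴴ * V = 1 := chain_unitary _ _
  have hDH : Dᴴ = D := conjTranspose_copyState hρ.1.isHermitian Q
  have hDt : D.trace = 1 := by rw [hD, trace_copyState, hρ.2, one_pow]
  have hVD : (V * D).trace.re = meanOutcome ρ Q t := by
    rw [hV, hD, trace_chain_copyState _ _ hρ.2]; rfl
  have hVD' : (Vᴴ * D).trace = star (V * D).trace := by
    rw [← Matrix.trace_conjTranspose, Matrix.conjTranspose_mul, hDH, Matrix.trace_mul_comm]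
  have h2 : (F * (C * (embed false : EmbMat Q n)) * D * (F * (C * (embed false : EmbMat Q n)))ᴴ).trace =
      (1 / 4 : ℂ) * (2 + s * ((V * D).trace + star (V * D).trace)) := by
    rw [hFC, Matrix.trace_mul_comm, ← Matrix.mul_assoc]
    have : ((1 / 2 : ℂ) • ((embed b : EmbMat Q n) * (1 + s • V)))ᴴ * ((1 / 2 : ℂ) • ((embed b : EmbMat Q n) * (1 + s • V))) =
        (1 / 4 : ℂ) • ((2 : ℂ) • 1 + s • (V + Vᴴ)) := by
      rw [Matrix.conjTranspose_smul, Matrix.smul_mul, Matrix.mul_smul, smul_smul,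
        Matrix.conjTranspose_mul, Matrix.mul_assoc, ← Matrix.mul_assoc _ (embed b),
        embed_conjTranspose_mul, Matrix.one_mul]
      congr 1
      · simp; norm_num
      · rw [Matrix.conjTranspose_add, Matrix.conjTranspose_smul, hss, Matrix.conjTranspose_one,
          Matrix.add_mul, Matrix.mul_add, Matrix.one_mul, Matrix.one_mul, Matrix.mul_add,
          Matrix.mul_one, Matrix.smul_mul, Matrix.mul_smul, hVV, smul_smul, hs2, one_smul,
          smul_add, two_smul]
        abel
    rw [this]
    simp only [Matrix.smul_mul, Matrix.add_mul, Matrix.trace_smul, Matrix.trace_add,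
      Matrix.one_mul, hDt, hVD', smul_eq_mul]
    ring
  have h3 : outcomeProb ρ Q t b =
      (F * (C * (embed false : EmbMat Q n)) * D * (F * (C * (embed false : EmbMat Q n)))ᴴ).trace.re := by exact_mod_cast h1
  rw [h3, h2, ← hVD]
  have h4 : (V * D).trace + star (V * D).trace = ((2 * (V * D).trace.re : ℝ) : ℂ) :=
    Complex.add_conj _
  have h5 : s = ((if b then -1 else 1 : ℝ) : ℂ) := by rw [hs]; split_ifs <;> simp
  rw [h4, h5]
  have h6 : ∀ a c : ℝ, (1 / 4 : ℂ) * (2 + (a : ℂ) * ((2 * c : ℝ) : ℂ)) =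
      (((1 + a * c) / 2 : ℝ) : ℂ) := by
    intro a c; push_cast; ring
  rw [h6, Complex.ofReal_re]

end Outcome

end RenyiEst
end

noncomputable section
namespace RenyiEst
open Matrix
open scoped ComplexOrder

/-! ### Spectral expressions -/

section Spectral

variable {n : ℕ} {ρ : Matrix (Bits n) (Bits n) ℂ}

theorem eig_nonneg (hρ : IsState ρ) (i : Bits n) : 0 ≤ eig hρ i :=
  hρ.1.eigenvalues_nonneg i

/-- There is a trace preserving algebra automorphism that diagonalizes `ρ`. -/
theorem exists_diagonalization (hρ : IsState ρ) :
    ∃ σ : Matrix (Bits n) (Bits n) ℂ ≃ₐ[ℂ] Matrix (Bits n) (Bits n) ℂ,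
      (∀ M, (σ M).trace = M.trace) ∧ σ (Matrix.diagonal fun i => (eig hρ i : ℂ)) = ρ := by
  refine ⟨(Unitary.conjStarAlgAut ℂ _ hρ.1.isHermitian.eigenvectorUnitary).toAlgEquiv,
    fun M => ?_, ?_⟩
  · change (Unitary.conjStarAlgAut ℂ _ hρ.1.isHermitian.eigenvectorUnitary M).trace = _
    rw [Unitary.conjStarAlgAut_apply, Matrix.trace_mul_cycle, Unitary.coe_star_mul_self,
      Matrix.one_mul]
  · exact hρ.1.isHermitian.spectral_theorem.symm

theorem sum_eig (hρ : IsState ρ) : ∑ i, eig hρ i = 1 := by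
  obtain ⟨σ, hσ, h⟩ := exists_diagonalization hρ
  have h1 := hρ.2
  rw [← h, hσ, Matrix.trace_diagonal] at h1
  exact_mod_cast h1

theorem eig_le_one (hρ : IsState ρ) (i : Bits n) : eig hρ i ≤ 1 := by
  rw [← sum_eig hρ]
  exact Finset.single_le_sum (fun j _ => eig_nonneg hρ j) (Finset.mem_univ i)

theorem purity_eq (hρ : IsState ρ) : purity ρ = ∑ i, eig hρ i ^ 2 := by
  obtain ⟨σ, hσ, h⟩ := exists_diagonalization hρ
  have h1 : (ρ * ρ).trace = ((∑ i, eig hρ i ^ 2 : ℝ) : ℂ) := by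
    conv_lhs => rw [← h]
    rw [← map_mul, hσ, Matrix.diagonal_mul_diagonal, Matrix.trace_diagonal]
    push_cast
    exact Finset.sum_congr rfl fun i _ => by ring
  rw [purity, h1, Complex.ofReal_re]

theorem meanOutcome_eq (hρ : IsState ρ) (Q : ℕ) (t : ℝ) :
    meanOutcome ρ Q t = ∑ i, eig hρ i *
      (((Real.cos (t / Q) : ℂ) - Complex.I * Real.sin (t / Q) * eig hρ i) ^ Q).re := by
  obtain ⟨σ, hσ, h⟩ := exists_diagonalization hρ
  have h1 : (((Real.cos (t / Q) : ℂ) • 1 - (Complex.I * Real.sin (t / Q)) • ρ) ^ Q * ρ) =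
      σ (Matrix.diagonal fun i =>
        ((Real.cos (t / Q) : ℂ) - Complex.I * Real.sin (t / Q) * eig hρ i) ^ Q * eig hρ i) := by
    conv_lhs => rw [← h]
    rw [← map_one σ, ← map_smul, ← map_smul, ← map_sub, ← map_pow, ← map_mul]
    congr 1
    rw [← Matrix.diagonal_one, ← Matrix.diagonal_smul, ← Matrix.diagonal_smul,
      Matrix.diagonal_sub, Matrix.diagonal_pow, Matrix.diagonal_mul_diagonal]
    congr 1
    funext i
    simp
  rw [meanOutcome, h1, hσ, Matrix.trace_diagonal, Complex.re_sum]
  refine Finset.sum_congr rfl fun i _ => ?_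
  rw [mul_comm, Complex.re_ofReal_mul]

/-- The squared modulus is `cos² x + l² sin² x`. Being contractions, the steps let their errors add
up at most linearly. -/
theorem norm_step_le_one {l x : ℝ} (h0 : 0 ≤ l) (h1 : l ≤ 1) :
    ‖(Real.cos x : ℂ) - Complex.I * Real.sin x * l‖ ≤ 1 := by
  have h : ‖(Real.cos x : ℂ) - Complex.I * Real.sin x * l‖ ^ 2 =
      Real.cos x ^ 2 + (Real.sin x * l) ^ 2 := by
    rw [Complex.sq_norm, Complex.normSq_apply]
    simp only [Complex.sub_re, Complex.sub_im, Complex.mul_re, Complex.mul_im, Complex.ofReal_re,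
      Complex.ofReal_im, Complex.I_re, Complex.I_im]
    ring
  have h2 : (Real.sin x * l) ^ 2 ≤ Real.sin x ^ 2 := by
    rw [mul_pow]
    exact mul_le_of_le_one_right (sq_nonneg _) (pow_le_one₀ h0 h1)
  refine (sq_le_one_iff₀ (norm_nonneg _)).1 ?_
  rw [h]
  linarith [Real.cos_sq_add_sin_sq x]

theorem abs_meanOutcome_le_one (hρ : IsState ρ) (Q : ℕ) (t : ℝ) : |meanOutcome ρ Q t| ≤ 1 := by
  rw [meanOutcome_eq hρ, ← sum_eig hρ]
  refine (Finset.abs_sum_le_sum_abs _ _).trans (Finset.sum_le_sum fun i _ => ?_)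
  rw [abs_mul, abs_of_nonneg (eig_nonneg hρ i)]
  refine mul_le_of_le_one_right (eig_nonneg hρ i) ((Complex.abs_re_le_norm _).trans ?_)
  rw [norm_pow]
  exact pow_le_one₀ (norm_nonneg _) (norm_step_le_one (eig_nonneg hρ i) (eig_le_one hρ i))

theorem norm_pow_sub_pow_le {z v : ℂ} (hz : ‖z‖ ≤ 1) (hv : ‖v‖ ≤ 1) (Q : ℕ) :
    ‖z ^ Q - v ^ Q‖ ≤ Q * ‖z - v‖ := by
  induction Q with
  | zero => simp
  | succ Q ih =>
    have e : z ^ (Q + 1) - v ^ (Q + 1) = z ^ Q * (z - v) + (z ^ Q - v ^ Q) * v := by ring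
    rw [e]
    refine (norm_add_le _ _).trans ?_
    rw [norm_mul, norm_mul, norm_pow]
    have h1 : ‖z‖ ^ Q * ‖z - v‖ ≤ ‖z - v‖ :=
      mul_le_of_le_one_left (norm_nonneg _) (pow_le_one₀ (norm_nonneg _) hz)
    have h2 : ‖z ^ Q - v ^ Q‖ * ‖v‖ ≤ ‖z ^ Q - v ^ Q‖ := mul_le_of_le_one_right (norm_nonneg _) hv
    push_cast
    linarith

theorem abs_sin_sub_le (x : ℝ) : |Real.sin x - x| ≤ |x| ^ 3 / 4 := by
  rcases lt_trichotomy x 0 with hx | rfl | hx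
  · rw [abs_of_neg hx]
    have h1 := Real.sin_gt_sub_cube (x := -x) (by linarith)
    have h2 := Real.sin_lt (x := -x) (by linarith)
    rw [Real.sin_neg] at h1 h2
    rw [abs_le]; constructor <;> nlinarith [pow_pos (neg_pos.2 hx) 3]
  · simp
  · rw [abs_of_pos hx]
    have h1 := Real.sin_gt_sub_cube (x := x) hx
    have h2 := Real.sin_lt (x := x) hx
    rw [abs_le]; constructor <;> nlinarith [pow_pos hx 3]

/-- Both numbers are `1 - i l x` to first order. The real parts differ by at most `x² / 2`, and the
imaginary parts only at third order, which `|x| ≤ 1` absorbs into another `x² / 2`. -/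
theorem norm_step_sub_le {l x : ℝ} (h0 : 0 ≤ l) (h1 : l ≤ 1) (hx : |x| ≤ 1) :
    ‖((Real.cos x : ℂ) - Complex.I * Real.sin x * l) - Complex.exp (-(l * x : ℝ) * Complex.I)‖ ≤
      x ^ 2 := by
  have hlx : |l * x| ≤ |x| := by
    rw [abs_mul, abs_of_nonneg h0]; exact mul_le_of_le_one_left (abs_nonneg _) h1
  have hlx2 : (l * x) ^ 2 ≤ x ^ 2 := sq_le_sq.2 hlx
  have e : ((Real.cos x : ℂ) - Complex.I * Real.sin x * l) -
      Complex.exp (-(l * x : ℝ) * Complex.I) =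
      ((Real.cos x - Real.cos (l * x) : ℝ) : ℂ) +
        ((Real.sin (l * x) - l * Real.sin x : ℝ) : ℂ) * Complex.I := by
    rw [← Complex.ofReal_neg, Complex.exp_mul_I, ← Complex.ofReal_cos, ← Complex.ofReal_sin,
      Real.cos_neg, Real.sin_neg]
    push_cast
    ring
  rw [e]
  refine (norm_add_le _ _).trans ?_
  rw [norm_mul, Complex.norm_I, mul_one, Complex.norm_real, Complex.norm_real, Real.norm_eq_abs,
    Real.norm_eq_abs]
  have hc : |Real.cos x - Real.cos (l * x)| ≤ x ^ 2 / 2 := by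
    have a1 := Real.one_sub_sq_div_two_le_cos (x := x)
    have a2 := Real.one_sub_sq_div_two_le_cos (x := l * x)
    have a3 := Real.cos_le_one x
    have a4 := Real.cos_le_one (l * x)
    rw [abs_le]; constructor <;> linarith
  have hs : |Real.sin (l * x) - l * Real.sin x| ≤ x ^ 2 / 2 := by
    have b1 := abs_sin_sub_le x
    have b2 := abs_sin_sub_le (l * x)
    have b3 : |x| ^ 3 ≤ x ^ 2 := by
      rw [← sq_abs x]; exact pow_le_pow_of_le_one (abs_nonneg _) hx (by norm_num)
    have b4 : |l * x| ^ 3 ≤ |x| ^ 3 := pow_le_pow_left₀ (abs_nonneg _) hlx 3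
    have b5 : |l * (Real.sin x - x)| ≤ |Real.sin x - x| := by
      rw [abs_mul, abs_of_nonneg h0]; exact mul_le_of_le_one_left (abs_nonneg _) h1
    calc _ = |(Real.sin (l * x) - l * x) - l * (Real.sin x - x)| := by congr 1; ring
      _ ≤ |Real.sin (l * x) - l * x| + |l * (Real.sin x - x)| := abs_sub _ _
      _ ≤ _ := by linarith
  linarith

/-- The simulation error of the circuit with `Q` steps. -/
theorem abs_meanOutcome_sub_le (hρ : IsState ρ) {Q : ℕ} (hQ : Q ≠ 0) {t : ℝ}
    (ht : |t / Q| ≤ 1) :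
    |meanOutcome ρ Q t - ∑ i, eig hρ i * Real.cos (eig hρ i * t)| ≤ t ^ 2 / Q := by
  have hQ' : (Q : ℝ) ≠ 0 := Nat.cast_ne_zero.2 hQ
  rw [meanOutcome_eq hρ, ← Finset.sum_sub_distrib]
  calc _ ≤ ∑ i, eig hρ i * (t ^ 2 / Q) := by
        refine (Finset.abs_sum_le_sum_abs _ _).trans (Finset.sum_le_sum fun i _ => ?_)
        have h0 := eig_nonneg hρ i
        have h1 := eig_le_one hρ i
        rw [← mul_sub, abs_mul, abs_of_nonneg h0]
        refine mul_le_mul_of_nonneg_left ?_ h0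
        -- The target is the real part of a `Q`-th power of a unit complex number, so the two powers
        -- can be compared factor by factor.
        have e : Real.cos (eig hρ i * t) =
            (Complex.exp (-(eig hρ i * (t / Q) : ℝ) * Complex.I) ^ Q).re := by
          rw [← Complex.exp_nat_mul, show (Q : ℂ) * (-(eig hρ i * (t / Q) : ℝ) * Complex.I) =
            ((-(eig hρ i * t) : ℝ) : ℂ) * Complex.I by
              push_cast; field_simp, Complex.exp_ofReal_mul_I_re, Real.cos_neg]
        rw [e, ← Complex.sub_re]
        refine (Complex.abs_re_le_norm _).trans ((norm_pow_sub_pow_le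
          (norm_step_le_one h0 h1) ?_ Q).trans ?_)
        · rw [← Complex.ofReal_neg, Complex.norm_exp_ofReal_mul_I]
        · refine (mul_le_mul_of_nonneg_left (norm_step_sub_le h0 h1 ht) Q.cast_nonneg).trans_eq ?_
          field_simp
    _ = t ^ 2 / Q := by rw [← Finset.sum_mul, sum_eig, one_mul]

end Spectral

end RenyiEst
end

noncomputable section
namespace RenyiEst
open scoped Topology
open Filter

/-! ### The binomial series -/

section Binomial

theorem succ_mul_ringChoose_succ (x : ℝ) (k : ℕ) :
    ((k : ℝ) + 1) * Ring.choose x (k + 1) = (x - k) * Ring.choose x k := by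
  -- The library identity evaluates an integer polynomial by `smeval`; its coefficients are
  -- transported to `ℝ` to reach the product formula.
  have h : ∀ m : ℕ, (m.factorial : ℝ) * Ring.choose x m = ∏ j ∈ Finset.range m, (x - j) := by
    intro m
    have h1 := Ring.descPochhammer_eq_factorial_smul_choose x m
    rw [nsmul_eq_mul] at h1
    rw [← h1, ← descPochhammer_eval_eq_prod_range, Polynomial.smeval_def, Polynomial.eval,
      Polynomial.eval₂_eq_sum, Polynomial.sum_def, Polynomial.sum_def]
    have hd : descPochhammer ℝ m = (descPochhammer ℤ m).map (Int.castRingHom ℝ) :=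
      (descPochhammer_map (Int.castRingHom ℝ) m).symm
    rw [hd, Polynomial.support_map_of_injective _ (RingHom.injective_int _)]
    refine Finset.sum_congr rfl fun i _ => ?_
    have hc : (descPochhammer ℝ m).coeff i = ((descPochhammer ℤ m).coeff i : ℝ) := by
      rw [hd, Polynomial.coeff_map]; rfl
    simp [Polynomial.smul_pow, hc]
  have h1 := h (k + 1)
  rw [Finset.prod_range_succ, ← h k, Nat.factorial_succ] at h1
  have h2 : (k.factorial : ℝ) ≠ 0 := by positivity
  push_cast at h1
  apply mul_left_cancel₀ h2
  linear_combination h1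

/-- Up to index `⌈x⌉₊` the coefficients are dominated by those of the integer `⌈x⌉₊`, the last of
which is `1`. Beyond it the ratio `|x - j| / (j + 1)` is at most `1` because `x > -1`. -/
theorem abs_ringChoose_le_one {x : ℝ} (hx : -1 < x) {k : ℕ} (hk : x ≤ k) :
    |Ring.choose x k| ≤ 1 := by
  have step : ∀ j : ℕ, |Ring.choose x (j + 1)| = |x - j| * |Ring.choose x j| / (j + 1) := by
    intro j
    have h := succ_mul_ringChoose_succ x j
    rw [eq_div_iff (by positivity), ← abs_mul, ← h, abs_mul,
      abs_of_pos (show (0 : ℝ) < j + 1 by positivity), mul_comm]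
  have h1 : ∀ j : ℕ, j ≤ ⌈x⌉₊ → |Ring.choose x j| ≤ (⌈x⌉₊.choose j : ℝ) := by
    intro j
    induction j with
    | zero => simp
    | succ j ih =>
      intro hj
      have hjx : (j : ℝ) < x := Nat.lt_ceil.1 hj
      have hc : ((⌈x⌉₊.choose (j + 1) : ℕ) : ℝ) = (⌈x⌉₊ - j) * ⌈x⌉₊.choose j / (j + 1) := by
        rw [eq_div_iff (by positivity)]
        have := Nat.choose_succ_right_eq ⌈x⌉₊ j
        have h2 : ((⌈x⌉₊ - j : ℕ) : ℝ) = ⌈x⌉₊ - j := Nat.cast_sub (by omega)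
        rw [← h2]
        exact_mod_cast this.trans (mul_comm _ _)
      rw [step, hc, abs_of_pos (by linarith)]
      have := Nat.le_ceil x
      exact div_le_div_of_nonneg_right (mul_le_mul (by linarith) (ih (by omega)) (abs_nonneg _)
        (by linarith)) (by positivity)
  have hm : ⌈x⌉₊ ≤ k := Nat.ceil_le.2 hk
  clear hk
  induction k, hm using Nat.le_induction with
  | base => simpa using h1 _ le_rfl
  | succ j hj ih =>
    have hjx : x ≤ j := Nat.ceil_le.1 hj
    rw [step, div_le_one (by positivity), abs_of_nonpos (by linarith)]
    nlinarith [abs_nonneg (Ring.choose x j)]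

theorem hasSum_ringChoose (x : ℝ) {u : ℝ} (h0 : 0 ≤ u) (h1 : u < 1) :
    HasSum (fun k : ℕ => (-1) ^ k * Ring.choose x k * u ^ k) ((1 - u) ^ x) := by
  have hu : |u| < 1 := by rwa [abs_of_nonneg h0]
  have h := (Real.one_add_rpow_hasFPowerSeriesOnBall_zero (a := x)).hasSum (y := -u)
    (by simpa [enorm_eq_nnnorm] using! hu)
  simp only [binomialSeries_apply, List.ofFn_const, List.prod_replicate, smul_eq_mul,
    zero_add] at h
  rw [← sub_eq_add_neg] at h
  refine h.congr_fun fun k => ?_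
  rw [neg_pow u]; ring

theorem abs_rpow_sub_sum_le {x : ℝ} (hx : -1 < x) {K : ℕ} (hK : x ≤ K) {u : ℝ} (h0 : 0 ≤ u)
    (h1 : u < 1) :
    |(1 - u) ^ x - ∑ k ∈ Finset.range (K + 1), (-1) ^ k * Ring.choose x k * u ^ k| ≤
      u ^ (K + 1) / (1 - u) := by
  have h := (hasSum_nat_add_iff' (K + 1)).2 (hasSum_ringChoose x h0 h1)
  have hg : HasSum (fun k : ℕ => u ^ (K + 1) * u ^ k) (u ^ (K + 1) * (1 - u)⁻¹) :=
    (hasSum_geometric_of_lt_one h0 h1).mul_left _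
  rw [← h.tsum_eq, div_eq_mul_inv, ← Real.norm_eq_abs]
  refine tsum_of_norm_bounded hg fun k => ?_
  rw [norm_mul, norm_mul, norm_pow, norm_neg, norm_one, one_pow, one_mul, norm_pow,
    Real.norm_of_nonneg h0, ← pow_add, add_comm (K + 1) k]
  refine mul_le_of_le_one_left (by positivity) ?_
  rw [Real.norm_eq_abs]
  refine abs_ringChoose_le_one hx (hK.trans ?_)
  push_cast
  linarith [(k.cast_nonneg : (0 : ℝ) ≤ k)]

end Binomial

/-! ### The powers of the arcsine series -/

section Arcsin

theorem ringChoose_neg_half (m : ℕ) :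
    (-1) ^ m * Ring.choose (-1 / 2 : ℝ) m = (m.centralBinom : ℝ) / 4 ^ m := by
  induction m with
  | zero => simp
  | succ m ih =>
    have h1 := succ_mul_ringChoose_succ (-1 / 2) m
    have h2 : ((m : ℝ) + 1) * ((m + 1).centralBinom : ℝ) = 2 * (2 * m + 1) * m.centralBinom := by
      exact_mod_cast Nat.succ_mul_centralBinom_succ m
    have h3 : ((m : ℝ) + 1) ≠ 0 := by positivity
    apply mul_left_cancel₀ h3
    rw [pow_succ, pow_succ, mul_div_assoc', h2]
    rw [eq_div_iff (by positivity)] at ih ⊢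
    linear_combination (-4 * (-1) ^ m * 4 ^ m) * h1 + (4 * m + 2) * ih

theorem hasSum_inv_sqrt {y : ℝ} (h : |y| < 1) :
    HasSum (fun m : ℕ => (m.centralBinom : ℝ) / 4 ^ m * y ^ (2 * m)) (1 / √(1 - y ^ 2)) := by
  have hy : y ^ 2 < 1 := (sq_lt_one_iff_abs_lt_one y).2 h
  have h1 := hasSum_ringChoose (-1 / 2) (sq_nonneg y) hy
  have h2 : (1 - y ^ 2) ^ (-1 / 2 : ℝ) = 1 / √(1 - y ^ 2) := by
    rw [show (-1 / 2 : ℝ) = -(1 / 2) by norm_num, Real.rpow_neg (by linarith),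
      ← Real.sqrt_eq_rpow, one_div]
  rw [← h2]
  refine h1.congr_fun fun m => ?_
  rw [ringChoose_neg_half, pow_mul]

/-- Both sides vanish at `0` and have derivative `1 / √(1 - z²)`. Termwise differentiation is
justified on `(-r, r)` with `|y| < r < 1`, where the derivatives are dominated by the geometric
series of `r²`. -/
theorem hasSum_arcsin {y : ℝ} (h : |y| < 1) :
    HasSum (fun m : ℕ => (m.centralBinom : ℝ) / (4 ^ m * (2 * m + 1)) * y ^ (2 * m + 1))
      (Real.arcsin y) := by
  obtain ⟨r, hr, hr1⟩ := exists_between h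
  have hr0 : 0 ≤ r := (abs_nonneg y).trans hr.le
  set g : ℕ → ℝ → ℝ := fun m z => (m.centralBinom : ℝ) / (4 ^ m * (2 * m + 1)) * z ^ (2 * m + 1)
    with hg
  set g' : ℕ → ℝ → ℝ := fun m z => (m.centralBinom : ℝ) / 4 ^ m * z ^ (2 * m) with hg'
  have hder : ∀ m, ∀ z ∈ Set.Ioo (-r) r, HasDerivAt (g m) (g' m z) z := by
    intro m z _
    have := ((hasDerivAt_id z).pow (2 * m + 1)).const_mul
      ((m.centralBinom : ℝ) / (4 ^ m * (2 * m + 1)))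
    refine this.congr_deriv ?_
    simp only [hg', id, Nat.add_sub_cancel, mul_one]
    push_cast
    have : (2 * (m : ℝ) + 1) ≠ 0 := by positivity
    field_simp
  have hc1 : ∀ m : ℕ, (m.centralBinom : ℝ) / 4 ^ m ≤ 1 := by
    intro m
    rw [div_le_one (by positivity)]
    exact_mod_cast Nat.centralBinom_le_four_pow m
  have hbd : ∀ m, ∀ z ∈ Set.Ioo (-r) r, ‖g' m z‖ ≤ (r ^ 2) ^ m := by
    intro m z hz
    have hz' : |z| ≤ r := (abs_lt.2 hz).le
    rw [hg', norm_mul, norm_pow, Real.norm_eq_abs, Real.norm_eq_abs,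
      abs_of_nonneg (by positivity), ← pow_mul]
    calc _ ≤ 1 * r ^ (2 * m) := by gcongr; exact hc1 m
      _ = _ := one_mul _
  have hsum : Summable fun m : ℕ => (r ^ 2) ^ m :=
    summable_geometric_of_lt_one (by positivity) (by nlinarith)
  have hyr : y ∈ Set.Ioo (-r) r := abs_lt.1 hr
  have h0r : (0 : ℝ) ∈ Set.Ioo (-r) r := by
    have : 0 < r := (abs_nonneg y).trans_lt hr
    exact ⟨by linarith, this⟩
  have hg0 : ∀ m, g m 0 = 0 := by intro m; simp [hg]
  have hs0 : Summable fun m => g m 0 := by simp only [hg0]; exact summable_zero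
  have hF : ∀ z ∈ Set.Ioo (-r) r, HasDerivAt (fun z => ∑' m, g m z) (1 / √(1 - z ^ 2)) z := by
    intro z hz
    have := hasDerivAt_tsum_of_isPreconnected hsum isOpen_Ioo isPreconnected_Ioo hder hbd h0r hs0 hz
    rwa [(hasSum_inv_sqrt ((abs_lt.2 hz).trans hr1)).tsum_eq] at this
  have hA : ∀ z ∈ Set.Ioo (-r) r, HasDerivAt Real.arcsin (1 / √(1 - z ^ 2)) z := by
    intro z hz
    exact Real.hasDerivAt_arcsin (by linarith [hz.1]) (by linarith [hz.2])
  have heq := isOpen_Ioo.eqOn_of_deriv_eq isPreconnected_Ioo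
    (fun z hz => (hF z hz).differentiableAt.differentiableWithinAt)
    (fun z hz => (hA z hz).differentiableAt.differentiableWithinAt)
    (fun z hz => by rw [(hF z hz).deriv, (hA z hz).deriv]) h0r
    (by simp only [hg0, tsum_zero, Real.arcsin_zero]) hyr
  have hsy : Summable fun m => g m y :=
    summable_of_summable_hasDerivAt_of_isPreconnected hsum isOpen_Ioo isPreconnected_Ioo hder hbd
      h0r hs0 hyr
  rw [← heq]
  exact hsy.hasSum

theorem arcsinCoeff_nonneg (l : ℕ) : 0 ≤ arcsinCoeff l := by
  unfold arcsinCoeff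
  split_ifs <;> positivity

theorem hasSum_arcsinCoeff {y : ℝ} (h : |y| < 1) :
    HasSum (fun l : ℕ => arcsinCoeff l * y ^ l) (Real.arcsin y / (Real.pi / 2)) := by
  have hinj : Function.Injective fun m : ℕ => 2 * m + 1 := by
    intro a b hab; simpa using hab
  rw [← hinj.hasSum_iff]
  · refine ((hasSum_arcsin h).div_const (Real.pi / 2)).congr_fun fun m => ?_
    have h1 : ¬ Even (2 * m + 1) := by simp
    simp only [Function.comp, arcsinCoeff, h1, if_false, Nat.add_sub_cancel]
    rw [Nat.mul_div_cancel_left _ (by norm_num : 0 < 2), ← Nat.centralBinom_eq_two_mul_choose,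
      pow_mul]
    push_cast
    have := Real.pi_pos
    field_simp
    ring
  · intro l hl
    rcases Nat.even_or_odd' l with ⟨m, rfl | rfl⟩
    · simp [arcsinCoeff]
    · exact absurd ⟨m, rfl⟩ hl

theorem bCoeff_nonneg (k l : ℕ) : 0 ≤ bCoeff k l := by
  induction k generalizing l with
  | zero => unfold bCoeff; split_ifs <;> norm_num
  | succ k ih =>
    unfold bCoeff
    exact Finset.sum_nonneg fun i _ => mul_nonneg (ih i) (arcsinCoeff_nonneg _)

theorem hasSum_bCoeff (k : ℕ) {y : ℝ} (h0 : 0 ≤ y) (h1 : y < 1) :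
    HasSum (fun l : ℕ => bCoeff k l * y ^ l) ((Real.arcsin y / (Real.pi / 2)) ^ k) := by
  induction k with
  | zero =>
    rw [pow_zero]
    have := hasSum_ite_eq (0 : ℕ) (1 : ℝ)
    refine this.congr_fun fun l => ?_
    by_cases hl : l = 0 <;> simp [bCoeff, hl]
  | succ k ih =>
    have ha := hasSum_arcsinCoeff (y := y) (by rwa [abs_of_nonneg h0])
    have n1 : Summable fun l => ‖bCoeff k l * y ^ l‖ := by
      refine ih.summable.congr fun l => ?_
      rw [Real.norm_of_nonneg (mul_nonneg (bCoeff_nonneg k l) (by positivity))]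
    have n2 : Summable fun l => ‖arcsinCoeff l * y ^ l‖ := by
      refine ha.summable.congr fun l => ?_
      rw [Real.norm_of_nonneg (mul_nonneg (arcsinCoeff_nonneg l) (by positivity))]
    have hs := (summable_norm_sum_mul_range_of_summable_norm n1 n2).of_norm.hasSum
    rw [← tsum_mul_tsum_eq_tsum_sum_range_of_summable_norm n1 n2, ih.tsum_eq, ha.tsum_eq,
      ← pow_succ] at hs
    refine hs.congr_fun fun l => ?_
    rw [bCoeff, Finset.sum_mul]
    refine Finset.sum_congr rfl fun i hi => ?_
    have : y ^ l = y ^ i * y ^ (l - i) := by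
      rw [← pow_add]; congr 1; have := Finset.mem_range.1 hi; omega
    rw [this]; ring

/-- By nonnegativity a partial sum at `y < 1` is at most the value of the function, which is at most
`1`; then `y → 1`. No convergence at the endpoint is needed. -/
theorem sum_range_bCoeff_le_one (k N : ℕ) : ∑ l ∈ Finset.range N, bCoeff k l ≤ 1 := by
  have hcont : Tendsto (fun y : ℝ => ∑ l ∈ Finset.range N, bCoeff k l * y ^ l) (𝓝[<] 1)
      (𝓝 (∑ l ∈ Finset.range N, bCoeff k l * 1 ^ l)) := by
    refine (Continuous.tendsto ?_ 1).mono_left nhdsWithin_le_nhds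
    fun_prop
  simp only [one_pow, mul_one] at hcont
  refine le_of_tendsto hcont ?_
  filter_upwards [Ioo_mem_nhdsLT (show (0 : ℝ) < 1 by norm_num)] with y hy
  have h := hasSum_bCoeff k hy.1.le hy.2
  refine (sum_le_hasSum _ (fun l _ => mul_nonneg (bCoeff_nonneg k l)
    (pow_nonneg hy.1.le _)) h).trans ?_
  refine pow_le_one₀ (div_nonneg (Real.arcsin_nonneg.2 hy.1.le) (by positivity)) ?_
  rw [div_le_one (by positivity)]
  exact Real.arcsin_le_pi_div_two y

/-- The tail has a factor `y ^ N`, and its coefficients are nonnegative with total at most `1`,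
uniformly in `k`. -/
theorem abs_arcsin_pow_sub_sum_le (k N : ℕ) {y : ℝ} (h0 : 0 ≤ y) (h1 : y < 1) :
    |(Real.arcsin y / (Real.pi / 2)) ^ k - ∑ l ∈ Finset.range N, bCoeff k l * y ^ l| ≤ y ^ N := by
  have h := (hasSum_nat_add_iff' N).2 (hasSum_bCoeff k h0 h1)
  have hb : Summable (bCoeff k) :=
    summable_of_sum_range_le (bCoeff_nonneg k) (sum_range_bCoeff_le_one k)
  have hb1 : ∑' l, bCoeff k (l + N) ≤ 1 := by
    have e := hb.sum_add_tsum_nat_add N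
    have e1 := Real.tsum_le_of_sum_range_le (bCoeff_nonneg k) (sum_range_bCoeff_le_one k)
    have e2 := Finset.sum_nonneg fun l (_ : l ∈ Finset.range N) => bCoeff_nonneg k l
    linarith
  have hbN : HasSum (fun l => y ^ N * bCoeff k (l + N)) (y ^ N * ∑' l, bCoeff k (l + N)) :=
    ((summable_nat_add_iff N).2 hb).hasSum.mul_left _
  rw [← h.tsum_eq, ← Real.norm_eq_abs]
  refine (tsum_of_norm_bounded hbN fun l => ?_).trans (mul_le_of_le_one_right (by positivity) hb1)
  rw [Real.norm_of_nonneg (mul_nonneg (bCoeff_nonneg k _) (by positivity)), mul_comm, pow_add,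
    mul_comm (y ^ l)]
  exact mul_le_mul_of_nonneg_right
    (mul_le_of_le_one_right (by positivity) (pow_le_one₀ h0 h1.le)) (bCoeff_nonneg k _)

end Arcsin

end RenyiEst
end

noncomputable section
namespace RenyiEst
open scoped Topology
open Filter

/-! ### Powers of the cosine -/

section Cosine

/-- Concavity of the sine gives `sin (x π / 4) ≥ x / √2`, and the cosine is `1 - 2 sin²`. At
eigenvalues at least `Λ` this keeps `y` below `1 - Λ²`, which is why `L` scales as `1 / Λ²`. -/
theorem cos_pi_half_mul_le {x : ℝ} (h0 : 0 ≤ x) (h1 : x ≤ 1) :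
    Real.cos (x * (Real.pi / 2)) ≤ 1 - x ^ 2 := by
  have hc := strictConcaveOn_sin_Icc.concaveOn.2 (x := Real.pi / 4) (y := 0)
    ⟨by positivity, by linarith [Real.pi_pos]⟩ ⟨le_rfl, Real.pi_pos.le⟩ h0
    (show 0 ≤ 1 - x by linarith) (by ring)
  simp only [smul_eq_mul, Real.sin_zero, mul_zero, add_zero, Real.sin_pi_div_four] at hc
  have h2 : Real.cos (x * (Real.pi / 2)) = 1 - 2 * Real.sin (x * (Real.pi / 4)) ^ 2 := by
    rw [show x * (Real.pi / 2) = 2 * (x * (Real.pi / 4)) by ring, Real.cos_two_mul]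
    linarith [Real.cos_sq_add_sin_sq (x * (Real.pi / 4))]
  have h3 : (x * (√2 / 2)) ^ 2 ≤ Real.sin (x * (Real.pi / 4)) ^ 2 :=
    pow_le_pow_left₀ (by positivity) hc 2
  have h4 : (x * (√2 / 2)) ^ 2 = x ^ 2 / 2 := by
    rw [mul_pow, div_pow, Real.sq_sqrt (by norm_num)]; ring
  rw [h2]
  linarith

theorem cos_pow_eq_sum (l : ℕ) (θ : ℝ) :
    Real.cos θ ^ l = ∑ s ∈ Finset.range (l + 1),
      (l.choose s : ℝ) / 2 ^ l * Real.cos ((2 * s - l) * θ) := by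
  have h : ((Real.cos θ ^ l : ℝ) : ℂ) = ∑ s ∈ Finset.range (l + 1),
      (((l.choose s : ℝ) / 2 ^ l : ℝ) : ℂ) * Complex.exp (((2 * s - l) * θ : ℝ) * Complex.I) := by
    rw [Complex.ofReal_pow, Complex.ofReal_cos, Complex.cos, div_pow, add_pow, Finset.sum_div]
    refine Finset.sum_congr rfl fun s hs => ?_
    have hs' : s ≤ l := Nat.lt_succ_iff.1 (Finset.mem_range.1 hs)
    rw [← Complex.exp_nat_mul, ← Complex.exp_nat_mul, ← Complex.exp_add, Nat.cast_sub hs']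
    push_cast
    rw [show (s : ℂ) * (θ * Complex.I) + ((l : ℂ) - s) * (-θ * Complex.I) =
      (2 * s - l) * θ * Complex.I by ring]
    ring
  have h2 := congrArg Complex.re h
  rw [Complex.ofReal_re, Complex.re_sum] at h2
  rw [h2]
  refine Finset.sum_congr rfl fun s _ => ?_
  rw [Complex.re_ofReal_mul, Complex.exp_ofReal_mul_I_re]

theorem cosh_pow_eq_sum (l : ℕ) (x : ℝ) :
    Real.cosh x ^ l = ∑ s ∈ Finset.range (l + 1),
      (l.choose s : ℝ) / 2 ^ l * Real.exp ((2 * s - l) * x) := by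
  rw [Real.cosh_eq, div_pow, add_pow, Finset.sum_div]
  refine Finset.sum_congr rfl fun s hs => ?_
  have hs' : s ≤ l := Nat.lt_succ_iff.1 (Finset.mem_range.1 hs)
  rw [← Real.exp_nat_mul, ← Real.exp_nat_mul, ← Real.exp_add, Nat.cast_sub hs',
    show (s : ℝ) * x + ((l : ℝ) - s) * (-x) = (2 * s - l) * x by ring]
  ring

/-- A Chernoff bound for the binomial distribution. -/
theorem sum_choose_tail_le {l M : ℕ} {G : ℝ} (hl : 0 < l) (hM : G * (l / 2) ≤ (M : ℝ) ^ 2)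
    (S : Finset ℕ) (hS : S ⊆ Finset.range (l + 1))
    (hfar : ∀ s ∈ S, 2 * (M : ℝ) ≤ |2 * (s : ℝ) - l|) :
    ∑ s ∈ S, (l.choose s : ℝ) / 2 ^ l ≤ 2 * Real.exp (-G) := by
  have hl' : (0 : ℝ) < l := Nat.cast_pos.2 hl
  -- The minimiser of `-2 M x + l x² / 2`, the exponent left after `cosh x ≤ exp (x² / 2)`.
  set x : ℝ := 2 * M / l with hx
  have hx0 : 0 ≤ x := by positivity
  have h1 : ∀ s ∈ S, (l.choose s : ℝ) / 2 ^ l ≤ Real.exp (-(2 * M * x)) *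
      ((l.choose s : ℝ) / 2 ^ l * Real.exp ((2 * s - l) * x) +
        (l.choose s : ℝ) / 2 ^ l * Real.exp ((2 * s - l) * (-x))) := by
    intro s hs
    have h2 : Real.exp (2 * M * x) ≤
        Real.exp ((2 * s - l) * x) + Real.exp ((2 * s - l) * (-x)) := by
      have h3 := hfar s hs
      rcases le_total 0 (2 * (s : ℝ) - l) with h | h
      · rw [abs_of_nonneg h] at h3
        have := Real.exp_le_exp.2 (mul_le_mul_of_nonneg_right h3 hx0)
        linarith [Real.exp_pos ((2 * s - l) * (-x))]
      · rw [abs_of_nonpos h] at h3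
        have := Real.exp_le_exp.2 (mul_le_mul_of_nonneg_right h3 hx0)
        rw [neg_mul, ← mul_neg] at this
        linarith [Real.exp_pos ((2 * s - l) * x)]
    rw [← mul_add, mul_left_comm]
    refine le_mul_of_one_le_right (by positivity) ?_
    calc (1 : ℝ) = Real.exp (-(2 * M * x)) * Real.exp (2 * M * x) := by
          rw [← Real.exp_add, neg_add_cancel, Real.exp_zero]
      _ ≤ _ := mul_le_mul_of_nonneg_left h2 (Real.exp_pos _).le
  calc ∑ s ∈ S, (l.choose s : ℝ) / 2 ^ l
      ≤ ∑ s ∈ Finset.range (l + 1), Real.exp (-(2 * M * x)) *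
        ((l.choose s : ℝ) / 2 ^ l * Real.exp ((2 * s - l) * x) +
          (l.choose s : ℝ) / 2 ^ l * Real.exp ((2 * s - l) * (-x))) :=
        (Finset.sum_le_sum h1).trans (Finset.sum_le_sum_of_subset_of_nonneg hS
          fun s _ _ => by positivity)
    _ = Real.exp (-(2 * M * x)) * (2 * Real.cosh x ^ l) := by
        rw [← Finset.mul_sum, Finset.sum_add_distrib, ← cosh_pow_eq_sum, ← cosh_pow_eq_sum,
          Real.cosh_neg, ← two_mul (Real.cosh x ^ l)]
    _ ≤ Real.exp (-(2 * M * x)) * (2 * Real.exp (x ^ 2 / 2) ^ l) := by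
        gcongr
        exact Real.cosh_le_exp_half_sq x
    _ = 2 * Real.exp (-(2 * (M : ℝ) ^ 2 / l)) := by
        rw [← Real.exp_nat_mul, mul_left_comm, ← Real.exp_add]
        congr 2
        rw [hx]; field_simp; ring
    _ ≤ 2 * Real.exp (-G) := by
        gcongr
        rw [le_div_iff₀ hl']
        linarith

theorem sum_choose_div (l : ℕ) : ∑ s ∈ Finset.range (l + 1), (l.choose s : ℝ) / 2 ^ l = 1 := by
  rw [← Finset.sum_div, div_eq_one_iff_eq (by positivity)]
  exact_mod_cast Nat.sum_range_choose l

theorem abs_cos_pow_sub_sum_le {l M : ℕ} {G : ℝ} (hM : G * (l / 2) ≤ (M : ℝ) ^ 2) (θ : ℝ) :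
    |Real.cos θ ^ l - ∑ s ∈ Finset.Icc (l / 2 - M) (min l ((l + 1) / 2 + M)),
      (l.choose s : ℝ) / 2 ^ l * Real.cos ((2 * s - l) * θ)| ≤ 2 * Real.exp (-G) := by
  set J := Finset.Icc (l / 2 - M) (min l ((l + 1) / 2 + M)) with hJ
  have hsub : J ⊆ Finset.range (l + 1) := by
    intro s hs
    rw [hJ, Finset.mem_Icc] at hs
    rw [Finset.mem_range]; omega
  rw [cos_pow_eq_sum, ← Finset.sum_sdiff hsub, add_sub_cancel_right]
  rcases Nat.eq_zero_or_pos l with rfl | hl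
  · have : Finset.range (0 + 1) \ J = ∅ := by
      rw [Finset.sdiff_eq_empty_iff_subset]
      intro s hs
      rw [hJ, Finset.mem_Icc]
      rw [Finset.mem_range] at hs
      omega
    rw [this, Finset.sum_empty, abs_zero]
    positivity
  · refine (Finset.abs_sum_le_sum_abs _ _).trans ((Finset.sum_le_sum fun s _ => ?_).trans
      (sum_choose_tail_le hl hM (Finset.range (l + 1) \ J) Finset.sdiff_subset ?_))
    · rw [abs_mul, abs_of_nonneg (by positivity)]
      exact mul_le_of_le_one_right (by positivity) (Real.abs_cos_le_one _)
    · intro s hs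
      rw [Finset.mem_sdiff, hJ, Finset.mem_Icc, Finset.mem_range] at hs
      -- The rounding in `⌊l/2⌋` and `⌈l/2⌉` is harmless: an index outside the window misses an
      -- integer bound by at least one.
      have h : 2 * M + 2 * s ≤ l ∨ 2 * M + l ≤ 2 * s := by omega
      rcases h with h | h
      · have h' : (2 * M + 2 * s : ℝ) ≤ l := by exact_mod_cast h
        rw [abs_of_nonpos (by linarith [(M.cast_nonneg : (0 : ℝ) ≤ M)])]
        linarith
      · have h' : (2 * M + l : ℝ) ≤ 2 * s := by exact_mod_cast h
        rw [abs_of_nonneg (by linarith [(M.cast_nonneg : (0 : ℝ) ≤ M)])]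
        linarith

end Cosine

/-! ### Truncation of the series -/

section Truncation

theorem Input.sum_terms_eq (I : Input) (x : ℝ) :
    ∑ p ∈ I.terms, I.f p * Real.cos (x * Input.time p) =
      ∑ k ∈ Finset.Icc 1 I.K, (-1) ^ k * Ring.choose (I.α - 1) k *
        ∑ l ∈ Finset.range (⌊I.L⌋₊ + 1), bCoeff k l *
          ∑ s ∈ Finset.Icc (l / 2 - I.M l) (min l ((l + 1) / 2 + I.M l)),
            (l.choose s : ℝ) / 2 ^ l * Real.cos ((2 * s - l) * (x * (Real.pi / 2))) := by
  rw [Input.terms, Finset.sum_sigma]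
  simp only [Input.f, Input.time, Finset.mul_sum, Finset.sum_mul]
  have e : ∀ (g : ℕ → ℕ → ℕ → ℝ), ∑ l ∈ Finset.range (⌊I.L⌋₊ + 1),
      ∑ s ∈ Finset.Icc (l / 2 - I.M l) (min l ((l + 1) / 2 + I.M l)),
        ∑ k ∈ Finset.Icc 1 I.K, g k l s = ∑ k ∈ Finset.Icc 1 I.K,
      ∑ l ∈ Finset.range (⌊I.L⌋₊ + 1),
        ∑ s ∈ Finset.Icc (l / 2 - I.M l) (min l ((l + 1) / 2 + I.M l)), g k l s := by
    intro g
    rw [Finset.sum_comm (s := Finset.Icc 1 I.K)]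
    exact Finset.sum_congr rfl fun l _ => Finset.sum_comm
  rw [e]
  refine Finset.sum_congr rfl fun k _ => Finset.sum_congr rfl fun l _ =>
    Finset.sum_congr rfl fun s _ => ?_
  rw [show (2 * (s : ℝ) - l) * (x * (Real.pi / 2)) = x * ((2 * s - l) * Real.pi / 2) by ring]
  ring

/-- The truncation error of the series at one eigenvalue. -/
theorem Input.abs_series_sub_le (I : Input) (hα : 0 < I.α) (hΛ : 0 < I.Λ) (hΛ1 : I.Λ < 1)
    (hw : 0 < I.weight) (hξ : 0 < I.xi) (hG : 0 ≤ Real.log (4 * I.weight / I.xi))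
    (hK : I.α - 1 ≤ I.K) (hKt : (1 - I.Λ) ^ I.K ≤ I.Λ * I.xi / 4) {x : ℝ} (hx : I.Λ ≤ x)
    (hx1 : x ≤ 1) :
    |1 + ∑ p ∈ I.terms, I.f p * Real.cos (x * Input.time p) - x ^ (I.α - 1)| ≤ I.xi := by
  set w := I.weight with hwdef
  set ξ := I.xi with hξdef
  set G := Real.log (4 * w / ξ) with hGdef
  have hx0 : 0 < x := hΛ.trans_le hx
  have hexpG : Real.exp (-G) = ξ / (4 * w) := by
    rw [hGdef, Real.exp_neg, Real.exp_log (by positivity), inv_div]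
  set y := Real.cos (x * (Real.pi / 2)) with hy
  have hy0 : 0 ≤ y := Real.cos_nonneg_of_neg_pi_div_two_le_of_le (by nlinarith [Real.pi_pos])
    (by nlinarith [Real.pi_pos])
  have hyΛ : y ≤ 1 - I.Λ ^ 2 := (cos_pi_half_mul_le hx0.le hx1).trans (by nlinarith)
  have hy1 : y < 1 := by nlinarith [sq_pos_of_pos hΛ]
  -- The key substitution: `cos` of an angle is `sin` of its complement, so the arcsine recovers `1
  -- - x` from `y`.
  have harc : Real.arcsin y / (Real.pi / 2) = 1 - x := by
    rw [hy, ← Real.sin_pi_div_two_sub, Real.arcsin_sin (by nlinarith [Real.pi_pos])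
      (by nlinarith [Real.pi_pos])]
    have := Real.pi_pos
    field_simp
  have hyN : y ^ (⌊I.L⌋₊ + 1) ≤ ξ / (4 * w) := by
    rw [← hexpG]
    calc y ^ (⌊I.L⌋₊ + 1) ≤ Real.exp (-I.Λ ^ 2) ^ (⌊I.L⌋₊ + 1) := by
          refine pow_le_pow_left₀ hy0 (hyΛ.trans ?_) _
          have := Real.add_one_le_exp (-I.Λ ^ 2)
          linarith
      _ = Real.exp (((⌊I.L⌋₊ + 1 : ℕ) : ℝ) * -I.Λ ^ 2) := (Real.exp_nat_mul _ _).symm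
      _ ≤ Real.exp (-G) := by
          refine Real.exp_le_exp.2 ?_
          have h1 : I.L ≤ ((⌊I.L⌋₊ + 1 : ℕ) : ℝ) := by
            push_cast; exact (Nat.lt_floor_add_one I.L).le
          have h2 : I.L * I.Λ ^ 2 = G := by
            rw [Input.L, mul_assoc, one_div, inv_mul_cancel₀ (by positivity), mul_one]
          have h3 := mul_le_mul_of_nonneg_right h1 (sq_nonneg I.Λ)
          linarith
  set T : ℕ → ℝ := fun l => ∑ s ∈ Finset.Icc (l / 2 - I.M l) (min l ((l + 1) / 2 + I.M l)),
    (l.choose s : ℝ) / 2 ^ l * Real.cos ((2 * s - l) * (x * (Real.pi / 2))) with hT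
  have hTl : ∀ l, |y ^ l - T l| ≤ ξ / (2 * w) := by
    intro l
    have hM : G * (l / 2) ≤ (I.M l : ℝ) ^ 2 := by
      have h1 : √(G * (l / 2)) ≤ I.M l := Nat.le_ceil _
      calc G * (l / 2) = √(G * (l / 2)) ^ 2 := (Real.sq_sqrt (by positivity)).symm
        _ ≤ _ := pow_le_pow_left₀ (Real.sqrt_nonneg _) h1 2
    refine (abs_cos_pow_sub_sum_le hM _).trans_eq ?_
    rw [hexpG]; field_simp; norm_num
  -- The error budget for each power is `ξ / (4 w)` for cutting the arcsine series and `ξ / (2 w)`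
  -- for the window in `s`. Summed against the binomial weights, of total `w`, it becomes `3 ξ / 4`;
  -- the binomial tail takes the remaining `ξ / 4`.
  have hk : ∀ k, |∑ l ∈ Finset.range (⌊I.L⌋₊ + 1), bCoeff k l * T l - (1 - x) ^ k| ≤
      3 * ξ / (4 * w) := by
    intro k
    have h1 := abs_arcsin_pow_sub_sum_le k (⌊I.L⌋₊ + 1) hy0 hy1
    rw [harc, abs_sub_comm] at h1
    have h2 : |∑ l ∈ Finset.range (⌊I.L⌋₊ + 1), bCoeff k l * T l -
        ∑ l ∈ Finset.range (⌊I.L⌋₊ + 1), bCoeff k l * y ^ l| ≤ ξ / (2 * w) := by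
      rw [← Finset.sum_sub_distrib]
      calc _ ≤ ∑ l ∈ Finset.range (⌊I.L⌋₊ + 1), bCoeff k l * (ξ / (2 * w)) := by
            refine (Finset.abs_sum_le_sum_abs _ _).trans (Finset.sum_le_sum fun l _ => ?_)
            rw [← mul_sub, abs_mul, abs_of_nonneg (bCoeff_nonneg k l), abs_sub_comm]
            exact mul_le_mul_of_nonneg_left (hTl l) (bCoeff_nonneg k l)
        _ ≤ 1 * (ξ / (2 * w)) := by
            rw [← Finset.sum_mul]
            exact mul_le_mul_of_nonneg_right (sum_range_bCoeff_le_one _ _) (by positivity)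
        _ = _ := one_mul _
    have h3 := abs_sub_le (∑ l ∈ Finset.range (⌊I.L⌋₊ + 1), bCoeff k l * T l)
      (∑ l ∈ Finset.range (⌊I.L⌋₊ + 1), bCoeff k l * y ^ l) ((1 - x) ^ k)
    have h4 : ξ / (2 * w) + ξ / (4 * w) = 3 * ξ / (4 * w) := by field_simp; norm_num
    linarith
  have hsplit : ∑ k ∈ Finset.range (I.K + 1), (-1) ^ k * Ring.choose (I.α - 1) k * (1 - x) ^ k =
      1 + ∑ k ∈ Finset.Icc 1 I.K, (-1) ^ k * Ring.choose (I.α - 1) k * (1 - x) ^ k := by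
    rw [Finset.range_eq_Ico, Finset.sum_eq_sum_Ico_succ_bot (by omega)]
    congr 1
    simp
  have htr := abs_rpow_sub_sum_le (x := I.α - 1) (by linarith) hK
    (show 0 ≤ 1 - x by linarith) (show 1 - x < 1 by linarith)
  rw [hsplit, sub_sub_cancel] at htr
  -- The factor `Λ` in the choice of `K` compensates the division by `x ≥ Λ` from the geometric
  -- tail.
  have htail : (1 - x) ^ (I.K + 1) / x ≤ ξ / 4 := by
    rw [div_le_iff₀ hx0]
    calc (1 - x) ^ (I.K + 1) ≤ (1 - x) ^ I.K * 1 := by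
          rw [pow_succ]
          exact mul_le_mul_of_nonneg_left (by linarith) (pow_nonneg (by linarith) _)
      _ ≤ (1 - I.Λ) ^ I.K := by
          rw [mul_one]; exact pow_le_pow_left₀ (by linarith) (by linarith) _
      _ ≤ _ := by nlinarith
  have hmain : |∑ k ∈ Finset.Icc 1 I.K, (-1) ^ k * Ring.choose (I.α - 1) k *
        ∑ l ∈ Finset.range (⌊I.L⌋₊ + 1), bCoeff k l * T l -
      ∑ k ∈ Finset.Icc 1 I.K, (-1) ^ k * Ring.choose (I.α - 1) k * (1 - x) ^ k| ≤ 3 * ξ / 4 := by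
    rw [← Finset.sum_sub_distrib]
    calc _ ≤ ∑ k ∈ Finset.Icc 1 I.K, |Ring.choose (I.α - 1) k| * (3 * ξ / (4 * w)) := by
          refine (Finset.abs_sum_le_sum_abs _ _).trans (Finset.sum_le_sum fun k _ => ?_)
          rw [← mul_sub, abs_mul, abs_mul, abs_pow, abs_neg, abs_one, one_pow, one_mul]
          exact mul_le_mul_of_nonneg_left (hk k) (abs_nonneg _)
      _ = w * (3 * ξ / (4 * w)) := by rw [← Finset.sum_mul]; rfl
      _ = _ := by field_simp
  rw [I.sum_terms_eq]
  have h5 : ∀ a b c : ℝ, |a - b| ≤ 3 * ξ / 4 → |c - (1 + b)| ≤ ξ / 4 → |1 + a - c| ≤ ξ := by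
    intro a b c h1 h2
    rw [abs_le] at h1 h2 ⊢
    constructor <;> linarith [h1.1, h1.2, h2.1, h2.2]
  exact h5 _ _ _ hmain (htr.trans htail)

end Truncation

end RenyiEst
end

noncomputable section
namespace RenyiEst
open MeasureTheory ProbabilityTheory

/-! ### Hoeffding's inequality on finite spaces -/

section Hoeffding

variable {A : Type*} [Fintype A]

/-- Hoeffding's lemma for the measure with point masses `q`: values in `[-F, F]` have variance proxy
`(2 F / 2)² = F²`. -/
theorem sum_exp_le_of_abs_le (q X : A → ℝ) (hq : ∀ a, 0 ≤ q a) (hq1 : ∑ a, q a = 1) {F : ℝ}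
    (hX : ∀ a, |X a| ≤ F) (s : ℝ) :
    ∑ a, q a * Real.exp (s * (X a - ∑ b, q b * X b)) ≤ Real.exp (F ^ 2 * s ^ 2 / 2) := by
  let _ : MeasurableSpace A := ⊤
  have h1 : ∑ a, ENNReal.ofReal (q a) = 1 := by
    rw [← ENNReal.ofReal_sum_of_nonneg fun a _ => hq a, hq1, ENNReal.ofReal_one]
  set p : PMF A := PMF.ofFintype (fun a => ENNReal.ofReal (q a)) h1 with hp
  have hpa : ∀ a, (p a).toReal = q a := fun a => by
    rw [hp, PMF.ofFintype_apply, ENNReal.toReal_ofReal (hq a)]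
  have hint : ∀ g : A → ℝ, ∫ a, g a ∂p.toMeasure = ∑ a, q a * g a := by
    intro g
    rw [PMF.integral_eq_sum]
    simp only [hpa, smul_eq_mul]
  have h := (hasSubgaussianMGF_of_mem_Icc (μ := p.toMeasure) (X := X) (a := -F) (b := F)
    (measurable_from_top).aemeasurable (Filter.Eventually.of_forall fun a => abs_le.1 (hX a))).mgf_le s
  rw [mgf, hint, hint] at h
  refine h.trans_eq ?_
  congr 1
  have : ((‖F - -F‖₊ / 2 : NNReal) : ℝ) ^ 2 = F ^ 2 := by
    rw [NNReal.coe_div, coe_nnnorm, Real.norm_eq_abs, div_pow, sq_abs]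
    norm_num
    ring
  rw [← this]
  norm_num

open scoped Classical in
theorem hoeffding_finite (q X : A → ℝ) (hq : ∀ a, 0 ≤ q a) (hq1 : ∑ a, q a = 1) {F c : ℝ}
    (hF : 0 < F) (hc : 0 ≤ c) (hX : ∀ a, |X a| ≤ F) {B : ℕ} (hB : 0 < B) :
    1 - 2 * Real.exp (-(B * c ^ 2 / (2 * F ^ 2))) ≤
      ∑ ω : Fin B → A, if |(∑ j, X (ω j)) / B - ∑ a, q a * X a| ≤ c then ∏ j, q (ω j) else 0 := by
  set E := ∑ a, q a * X a with hE
  have hB' : (0 : ℝ) < B := Nat.cast_pos.2 hB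
  -- The minimiser of `-s c + F² s² / 2`. Both tails are then treated by exponential moments at `s`
  -- and `-s`.
  set s : ℝ := c / F ^ 2 with hs
  have hs0 : 0 ≤ s := by positivity
  have htot : ∑ ω : Fin B → A, ∏ j, q (ω j) = 1 := by
    rw [← Fintype.sum_pow, hq1, one_pow]
  have hmgf : ∀ u : ℝ, ∑ ω : Fin B → A, (∏ j, q (ω j)) * Real.exp (u * ∑ j, (X (ω j) - E)) ≤
      Real.exp (B * (F ^ 2 * u ^ 2 / 2)) := by
    intro u
    have e : ∀ ω : Fin B → A, (∏ j, q (ω j)) * Real.exp (u * ∑ j, (X (ω j) - E)) =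
        ∏ j, (q (ω j) * Real.exp (u * (X (ω j) - E))) := by
      intro ω
      rw [Finset.prod_mul_distrib, ← Real.exp_sum, Finset.mul_sum]
    simp only [e]
    rw [← Fintype.sum_pow (fun a => q a * Real.exp (u * (X a - E))), Real.exp_nat_mul]
    exact pow_le_pow_left₀ (Finset.sum_nonneg fun a _ => mul_nonneg (hq a) (Real.exp_pos _).le)
      (sum_exp_le_of_abs_le q X hq hq1 hX u) B
  have hbad : ∀ ω : Fin B → A, (∏ j, q (ω j)) -
      (if |(∑ j, X (ω j)) / B - E| ≤ c then ∏ j, q (ω j) else 0) ≤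
      Real.exp (-(s * (B * c))) * ((∏ j, q (ω j)) * Real.exp (s * ∑ j, (X (ω j) - E)) +
        (∏ j, q (ω j)) * Real.exp (-s * ∑ j, (X (ω j) - E))) := by
    intro ω
    have hp : 0 ≤ ∏ j, q (ω j) := Finset.prod_nonneg fun j _ => hq _
    split_ifs with h
    · rw [sub_self]; positivity
    · rw [sub_zero, ← mul_add, mul_left_comm]
      refine le_mul_of_one_le_right hp ?_
      have hS : ∑ j, (X (ω j) - E) = B * ((∑ j, X (ω j)) / B - E) := by
        rw [Finset.sum_sub_distrib, Finset.sum_const, Finset.card_univ, Fintype.card_fin,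
          nsmul_eq_mul]
        field_simp
      set D := (∑ j, X (ω j)) / B - E with hD
      have h' : c ≤ |D| := (not_le.1 h).le
      have h2 : Real.exp (s * (B * c)) ≤ Real.exp (s * (B * D)) + Real.exp (-s * (B * D)) := by
        rcases le_total 0 D with h0 | h0
        · rw [abs_of_nonneg h0] at h'
          have : Real.exp (s * (B * c)) ≤ Real.exp (s * (B * D)) := by gcongr
          linarith [Real.exp_pos (-s * (B * D))]
        · rw [abs_of_nonpos h0] at h'
          have : Real.exp (s * (B * c)) ≤ Real.exp (s * (B * (-D))) := by gcongr
          rw [show s * (B * (-D)) = -s * (B * D) by ring] at this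
          linarith [Real.exp_pos (s * (B * D))]
      rw [hS]
      calc (1 : ℝ) = Real.exp (-(s * (B * c))) * Real.exp (s * (B * c)) := by
            rw [← Real.exp_add, neg_add_cancel, Real.exp_zero]
        _ ≤ _ := mul_le_mul_of_nonneg_left h2 (Real.exp_pos _).le
  have hsum := Finset.sum_le_sum fun (ω : Fin B → A) (_ : ω ∈ Finset.univ) => hbad ω
  rw [Finset.sum_sub_distrib, htot, ← Finset.mul_sum, Finset.sum_add_distrib] at hsum
  have h1 := hmgf s
  have h2 := hmgf (-s)
  rw [neg_sq] at h2
  have h3 : Real.exp (-(s * (B * c))) * (Real.exp (B * (F ^ 2 * s ^ 2 / 2)) +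
      Real.exp (B * (F ^ 2 * s ^ 2 / 2))) = 2 * Real.exp (-(B * c ^ 2 / (2 * F ^ 2))) := by
    rw [← two_mul, mul_left_comm, ← Real.exp_add]
    congr 2
    rw [hs]; field_simp; ring
  have h4 := mul_le_mul_of_nonneg_left (add_le_add h1 h2) (Real.exp_pos (-(s * (B * c)))).le
  linarith

end Hoeffding

/-! ### The distribution of the runs -/

section Runs

theorem sum_prod_bool {m : ℕ} (o : Bool → ℝ) (ho : ∑ b, o b = 1) :
    ∑ v : Fin m → Bool, ∏ r, o (v r) = 1 := by
  rw [← Fintype.sum_pow, ho, one_pow]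

theorem sum_prod_bool_mul {m : ℕ} (o g : Bool → ℝ) (ho : ∑ b, o b = 1) (r : Fin m) :
    ∑ v : Fin m → Bool, (∏ r', o (v r')) * g (v r) = ∑ b, o b * g b := by
  have h := Finset.prod_univ_sum (fun _ : Fin m => (Finset.univ : Finset Bool))
    (fun r' b => o b * if r' = r then g b else 1)
  rw [Fintype.piFinset_univ] at h
  have e : ∀ v : Fin m → Bool, (∏ r', o (v r')) * g (v r) =
      ∏ r', (o (v r') * if r' = r then g (v r') else 1) := by
    intro v
    rw [Finset.prod_mul_distrib, Finset.prod_ite_eq' Finset.univ r (fun r' => g (v r'))]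
    simp
  simp only [e]
  rw [← h, Finset.prod_eq_single r]
  · simp
  · intro r' _ hr'
    simpa [hr'] using ho
  · simp

/-- The mean of the empirical estimate of the difference of the outcome probabilities. -/
theorem sum_prod_bool_mul_mean {m : ℕ} (hm : 0 < m) (o : Bool → ℝ) (ho : ∑ b, o b = 1) :
    ∑ v : Fin m → Bool, (∏ r, o (v r)) * ((∑ r, if v r then (-1 : ℝ) else 1) / m) =
      o false - o true := by
  have hm' : (m : ℝ) ≠ 0 := by positivity
  have h := sum_prod_bool_mul (m := m) o (fun b => if b then -1 else 1) ho
  simp only [← mul_div_assoc]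
  rw [← Finset.sum_div, div_eq_iff hm']
  simp only [Finset.mul_sum]
  rw [Finset.sum_comm, Finset.sum_congr rfl fun r _ => h r]
  simp
  ring

/-! ### Sampled terms together with their measurement outcomes. -/

namespace Input

variable (I : Input) {n : ℕ} {ρ : Matrix (Bits n) (Bits n) ℂ} {μ : (Σ _ : ℕ, ℕ) → ℝ}

/-- The probability of one sampled term together with its measurement outcomes. -/
def sampleProb (ρ : Matrix (Bits n) (Bits n) ℂ) (a : {p // p ∈ I.terms} × (Fin I.meas → Bool)) : ℝ :=
  |I.f a.1.1| / I.fNorm * ∏ r, outcomeProb ρ (I.steps a.1.1) (time a.1.1) (a.2 r)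

theorem runProb_eq (ω : I.Run) : I.runProb ρ ω = ∏ j, I.sampleProb ρ (ω j) := rfl

theorem sampleProb_nonneg
    (hμ : ∀ p ∈ I.terms, ∀ b, outcomeProb ρ (I.steps p) (time p) b =
      (1 + (if b then -1 else 1) * μ p) / 2) (hμ1 : ∀ p, |μ p| ≤ 1)
    (a : {p // p ∈ I.terms} × (Fin I.meas → Bool)) : 0 ≤ I.sampleProb ρ a := by
  have hF : 0 ≤ I.fNorm := Finset.sum_nonneg fun p _ => abs_nonneg _
  refine mul_nonneg (div_nonneg (abs_nonneg _) hF) (Finset.prod_nonneg fun r _ => ?_)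
  rw [hμ _ a.1.2]
  have := abs_le.1 (hμ1 a.1.1)
  split_ifs <;> linarith

theorem sum_outcomeProb
    (hμ : ∀ p ∈ I.terms, ∀ b, outcomeProb ρ (I.steps p) (time p) b =
      (1 + (if b then -1 else 1) * μ p) / 2) {p : Σ _ : ℕ, ℕ} (hp : p ∈ I.terms) :
    ∑ b, outcomeProb ρ (I.steps p) (time p) b = 1 := by
  rw [Fintype.sum_bool, hμ p hp, hμ p hp]
  simp
  ring

theorem sum_sampleProb (hF : 0 < I.fNorm)
    (hμ : ∀ p ∈ I.terms, ∀ b, outcomeProb ρ (I.steps p) (time p) b =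
      (1 + (if b then -1 else 1) * μ p) / 2) :
    ∑ a, I.sampleProb ρ a = 1 := by
  rw [Fintype.sum_prod_type]
  simp only [sampleProb, ← Finset.mul_sum]
  have h : ∀ p : {p // p ∈ I.terms}, |I.f p.1| / I.fNorm *
      ∑ v : Fin I.meas → Bool, ∏ r, outcomeProb ρ (I.steps p.1) (time p.1) (v r) =
      |I.f p.1| / I.fNorm := by
    intro p
    rw [sum_prod_bool _ (I.sum_outcomeProb hμ p.2), mul_one]
  simp only [h]
  rw [← Finset.sum_div, Finset.sum_coe_sort I.terms fun p => |I.f p|]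
  exact div_self hF.ne'

/-- Importance sampling is unbiased: the weight `‖f‖₁ sgn f` cancels the probability `|f| / ‖f‖₁` to
leave `f`, and an empirical mean over any positive number of measurements has the exact expectation.
-/
theorem sum_sampleProb_mul (hF : 0 < I.fNorm) (hm : 0 < I.meas)
    (hμ : ∀ p ∈ I.terms, ∀ b, outcomeProb ρ (I.steps p) (time p) b =
      (1 + (if b then -1 else 1) * μ p) / 2) :
    ∑ a, I.sampleProb ρ a * (I.fNorm * (Real.sign (I.f a.1.1) *
      ((∑ r, if a.2 r then (-1 : ℝ) else 1) / I.meas))) = ∑ p ∈ I.terms, I.f p * μ p := by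
  rw [Fintype.sum_prod_type, ← Finset.sum_coe_sort I.terms fun p => I.f p * μ p]
  refine Finset.sum_congr rfl fun p _ => ?_
  have h := sum_prod_bool_mul_mean hm _ (I.sum_outcomeProb hμ p.2)
  have h2 : outcomeProb ρ (I.steps p.1) (time p.1) false -
      outcomeProb ρ (I.steps p.1) (time p.1) true = μ p.1 := by
    rw [hμ p.1 p.2, hμ p.1 p.2]; simp; ring
  rw [h2] at h
  have hs : |I.f p.1| * Real.sign (I.f p.1) = I.f p.1 := by
    rcases lt_trichotomy (I.f p.1) 0 with h0 | h0 | h0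
    · rw [Real.sign_of_neg h0, abs_of_neg h0]; ring
    · rw [h0]; simp
    · rw [Real.sign_of_pos h0, abs_of_pos h0, mul_one]
  calc _ = |I.f p.1| * Real.sign (I.f p.1) * ∑ v : Fin I.meas → Bool,
        (∏ r, outcomeProb ρ (I.steps p.1) (time p.1) (v r)) *
          ((∑ r, if v r then (-1 : ℝ) else 1) / I.meas) := by
        rw [Finset.mul_sum]
        refine Finset.sum_congr rfl fun v _ => ?_
        simp only [sampleProb]
        have := hF.ne'
        field_simp
    _ = _ := by rw [h, hs]

theorem runProb_isDistribution (hF : 0 < I.fNorm)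
    (hμ : ∀ p ∈ I.terms, ∀ b, outcomeProb ρ (I.steps p) (time p) b =
      (1 + (if b then -1 else 1) * μ p) / 2) (hμ1 : ∀ p, |μ p| ≤ 1) :
    (∀ ω : I.Run, 0 ≤ I.runProb ρ ω) ∧ ∑ ω : I.Run, I.runProb ρ ω = 1 := by
  refine ⟨fun ω => Finset.prod_nonneg fun j _ => I.sampleProb_nonneg hμ hμ1 (ω j), ?_⟩
  simp only [runProb_eq]
  rw [← Fintype.sum_pow (I.sampleProb ρ), I.sum_sampleProb hF hμ, one_pow]

theorem abs_mean_signs_le (m : ℕ) (v : Fin m → Bool) :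
    |(∑ r, if v r then (-1 : ℝ) else 1) / m| ≤ 1 := by
  rw [abs_div, Nat.abs_cast]
  refine div_le_one_of_le₀ ((Finset.abs_sum_le_sum_abs _ _).trans ?_) m.cast_nonneg
  calc _ ≤ ∑ _r : Fin m, (1 : ℝ) := Finset.sum_le_sum fun r _ => by split_ifs <;> simp
    _ = m := by simp

/-- The choice of the term and the noise of its measurements form one variable bounded by `‖f‖₁`.
Independence over `j` suffices for a deviation `ξ`, without a union bound over the terms. -/
theorem one_sub_le_prob (hF : 0 < I.fNorm) (hξ : 0 < I.xi) (hδ : 0 < I.δ) (hm : 0 < I.meas)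
    (hB : 0 < I.B)
    (hμ : ∀ p ∈ I.terms, ∀ b, outcomeProb ρ (I.steps p) (time p) b =
      (1 + (if b then -1 else 1) * μ p) / 2) (hμ1 : ∀ p, |μ p| ≤ 1) (E : I.Run → Prop)
    (hE : ∀ ω : I.Run, |I.fNorm * (∑ j, Real.sign (I.f (ω j).1.1) * I.est ω j) / I.B -
      ∑ p ∈ I.terms, I.f p * μ p| ≤ I.xi → E ω) :
    1 - I.δ ≤ I.prob ρ E := by
  classical
  have h := hoeffding_finite (I.sampleProb ρ) (fun a => I.fNorm * (Real.sign (I.f a.1.1) *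
      ((∑ r, if a.2 r then (-1 : ℝ) else 1) / I.meas))) (I.sampleProb_nonneg hμ hμ1)
      (I.sum_sampleProb hF hμ) hF hξ.le (fun a => ?_) hB
  · rw [I.sum_sampleProb_mul hF hm hμ] at h
    have hexp : 2 * Real.exp (-(I.B * I.xi ^ 2 / (2 * I.fNorm ^ 2))) ≤ I.δ := by
      have h1 : 2 * (I.fNorm ^ 2 / I.xi ^ 2) * Real.log (2 / I.δ) ≤ I.B := Nat.le_ceil _
      have h2 : Real.log (2 / I.δ) ≤ I.B * I.xi ^ 2 / (2 * I.fNorm ^ 2) := by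
        rw [le_div_iff₀ (by positivity)]
        calc _ = 2 * (I.fNorm ^ 2 / I.xi ^ 2) * Real.log (2 / I.δ) * I.xi ^ 2 := by
              field_simp
          _ ≤ _ := mul_le_mul_of_nonneg_right h1 (sq_nonneg _)
      calc _ ≤ 2 * Real.exp (-Real.log (2 / I.δ)) := by gcongr
        _ = I.δ := by
          rw [Real.exp_neg, Real.exp_log (by positivity)]; field_simp
    refine (sub_le_sub_left hexp 1).trans (h.trans ?_)
    rw [prob]
    refine Finset.sum_le_sum fun ω _ => ?_
    have hω : 0 ≤ I.runProb ρ ω :=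
      Finset.prod_nonneg fun j _ => I.sampleProb_nonneg hμ hμ1 (ω j)
    split_ifs with h1 h2 h2
    · exact le_rfl
    · refine absurd (hE ω ?_) h2
      rw [← Finset.mul_sum] at h1
      exact h1
    · exact hω
    · exact le_rfl
  · rw [abs_mul, abs_of_pos hF]
    refine mul_le_of_le_one_right hF.le ?_
    rw [abs_mul]
    refine mul_le_one₀ ?_ (abs_nonneg _) (abs_mean_signs_le _ _)
    rcases Real.sign_apply_eq (I.f a.1.1) with h | h | h <;> rw [h] <;> simp

end Input

end Runs

end RenyiEst
end

noncomputable section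
namespace RenyiEst

/-! ### The parameters of the algorithm -/

/-- The admissible classical inputs. -/
structure Input.Valid (I : Input) : Prop where
  α_pos : 0 < I.α
  α_ne_one : I.α ≠ 1
  ε_pos : 0 < I.ε
  ε_lt_one : I.ε < 1
  δ_pos : 0 < I.δ
  δ_lt_one : I.δ < 1
  Λ_pos : 0 < I.Λ
  Λ_lt_one : I.Λ < 1
  Λ_le_P : I.Λ ≤ I.P
  P_le_one : I.P ≤ 1

theorem Input.K_lower (I : Input) :
    Real.log (I.Λ * I.xi / 4) / Real.log (1 - I.Λ) + I.α ^ 2 ≤ I.K := Nat.le_ceil _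

namespace Input.Valid

variable {I : Input} (hI : I.Valid)

include hI

theorem P_pos : 0 < I.P := hI.Λ_pos.trans_le hI.Λ_le_P

theorem abs_pos : 0 < |1 - I.α| := by
  rw [_root_.abs_pos]; exact sub_ne_zero.2 hI.α_ne_one.symm

theorem traceBound_pos : 0 < I.traceBound := by
  unfold Input.traceBound
  split_ifs
  · exact hI.P_pos
  · exact Real.rpow_pos_of_pos hI.P_pos _

theorem traceBound_le_one (h : 1 < I.α) : I.traceBound ≤ 1 := by
  unfold Input.traceBound
  split_ifs
  · exact hI.P_le_one
  · exact Real.rpow_le_one hI.P_pos.le hI.P_le_one (by linarith)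

omit hI in
theorem traceBound_eq (h : I.α < 1) : I.traceBound = I.P ^ (I.α - 1) := by
  unfold Input.traceBound
  rw [if_neg (fun h' => by linarith [h'.1])]

theorem traceBound_le_rpow (h : I.α < 1) : I.traceBound ≤ I.Λ ^ (I.α - 1) := by
  rw [traceBound_eq h]
  exact Real.rpow_le_rpow_of_nonpos hI.Λ_pos hI.Λ_le_P (by linarith)

/-- For `α < 1` the bound `τ` may exceed `1`, but never `Λ ^ (α - 1) ≤ 1 / Λ`. -/
theorem Λ_mul_traceBound_le : I.Λ * I.traceBound ≤ 1 := by
  rcases lt_or_gt_of_ne hI.α_ne_one with h | h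
  · have h1 := hI.traceBound_le_rpow h
    have h2 : I.Λ ^ (I.α - 1) ≤ I.Λ ^ (-1 : ℝ) :=
      Real.rpow_le_rpow_of_exponent_ge hI.Λ_pos hI.Λ_lt_one.le (by linarith [hI.α_pos])
    rw [Real.rpow_neg_one] at h2
    calc I.Λ * I.traceBound ≤ I.Λ * I.Λ⁻¹ :=
          mul_le_mul_of_nonneg_left (h1.trans h2) hI.Λ_pos.le
      _ = 1 := mul_inv_cancel₀ hI.Λ_pos.ne'
  · have h1 := hI.traceBound_le_one h
    have := hI.traceBound_pos
    nlinarith [hI.Λ_pos, hI.Λ_lt_one]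

theorem xi_pos : 0 < I.xi := by
  have h1 := hI.traceBound_pos
  have h2 : 0 < min (|1 - I.α| * I.ε) 1 := lt_min (mul_pos hI.abs_pos hI.ε_pos) one_pos
  unfold Input.xi Input.totalPrec
  positivity

theorem xi_le : I.xi ≤ |1 - I.α| * I.traceBound / 6 := by
  have h1 := hI.traceBound_pos
  have h2 : min (|1 - I.α| * I.ε) 1 ≤ |1 - I.α| :=
    (min_le_left _ _).trans (mul_le_of_le_one_right (abs_nonneg _) hI.ε_lt_one.le)
  unfold Input.xi Input.totalPrec
  nlinarith [mul_le_mul_of_nonneg_right h2 h1.le]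

theorem xi_le' : I.xi ≤ I.traceBound / 6 := by
  have h1 := hI.traceBound_pos
  have h2 : min (|1 - I.α| * I.ε) 1 ≤ 1 := min_le_right _ _
  unfold Input.xi Input.totalPrec
  nlinarith [mul_le_mul_of_nonneg_right h2 h1.le]

theorem log_one_sub_neg : Real.log (1 - I.Λ) < 0 :=
  Real.log_neg (by linarith [hI.Λ_lt_one]) (by linarith [hI.Λ_pos])

theorem Λ_mul_xi_lt : I.Λ * I.xi / 4 < 1 := by
  have := mul_le_mul_of_nonneg_left hI.xi_le' hI.Λ_pos.le
  linarith [hI.Λ_mul_traceBound_le]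

/-- The quotient of logarithms in `K` is nonnegative, as both are nonpositive. The summand `α²`
exceeds `α - 1`, so the truncation lies where the binomial coefficients are at most `1`. -/
theorem sq_le_K : I.α ^ 2 ≤ I.K := by
  have h1 : Real.log (I.Λ * I.xi / 4) ≤ 0 :=
    Real.log_nonpos (by have := hI.xi_pos; have := hI.Λ_pos; positivity) hI.Λ_mul_xi_lt.le
  have h2 := div_nonneg_of_nonpos h1 hI.log_one_sub_neg.le
  linarith [I.K_lower]

theorem sub_one_le_K : I.α - 1 ≤ I.K := by
  nlinarith [hI.sq_le_K, sq_nonneg (I.α - 1)]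

theorem K_pos : 0 < I.K := by
  have h : (0 : ℝ) < I.K := (pow_pos hI.α_pos 2).trans_le hI.sq_le_K
  exact_mod_cast h

theorem pow_K_le : (1 - I.Λ) ^ I.K ≤ I.Λ * I.xi / 4 := by
  have h0 : 0 < I.Λ * I.xi / 4 := by have := hI.xi_pos; have := hI.Λ_pos; positivity
  have h1 : (0 : ℝ) < 1 - I.Λ := by linarith [hI.Λ_lt_one]
  rw [← Real.log_le_log_iff (pow_pos h1 _) h0, Real.log_pow]
  have h2 : Real.log (I.Λ * I.xi / 4) / Real.log (1 - I.Λ) ≤ I.K := by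
    linarith [I.K_lower, sq_nonneg I.α]
  rwa [div_le_iff_of_neg hI.log_one_sub_neg] at h2

theorem abs_le_weight : |1 - I.α| ≤ I.weight := by
  have h := Finset.single_le_sum (f := fun k => |Ring.choose (I.α - 1) k|)
    (fun k _ => abs_nonneg _) (Finset.mem_Icc.2 ⟨le_rfl, hI.K_pos⟩ : 1 ∈ Finset.Icc 1 I.K)
  simp only [Ring.choose_one_right] at h
  rw [abs_sub_comm]
  exact h

theorem weight_pos : 0 < I.weight := hI.abs_pos.trans_le hI.abs_le_weight

/-- A large `τ` forces a large weight: `τ ≤ Λ ^ (α - 1)`, and the truncated binomial series at `1 -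
Λ` is at most `1 + w`. -/
theorem traceBound_le_weight (h : I.α < 1) : I.traceBound ≤ 1 + I.weight + I.xi / 4 := by
  have hΛ := hI.Λ_pos
  have hΛ1 := hI.Λ_lt_one
  refine (hI.traceBound_le_rpow h).trans ?_
  have h1 := abs_rpow_sub_sum_le (x := I.α - 1) (by linarith [hI.α_pos]) hI.sub_one_le_K
    (show 0 ≤ 1 - I.Λ by linarith) (show 1 - I.Λ < 1 by linarith)
  rw [sub_sub_cancel] at h1
  have h2 : (1 - I.Λ) ^ (I.K + 1) / I.Λ ≤ I.xi / 4 := by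
    rw [div_le_iff₀ hΛ, pow_succ]
    have := mul_le_of_le_one_right (pow_nonneg (show 0 ≤ 1 - I.Λ by linarith) I.K)
      (show 1 - I.Λ ≤ 1 by linarith)
    linarith [hI.pow_K_le]
  have h3 : ∑ k ∈ Finset.range (I.K + 1), (-1) ^ k * Ring.choose (I.α - 1) k * (1 - I.Λ) ^ k ≤
      1 + I.weight := by
    rw [Finset.range_eq_Ico, Finset.sum_eq_sum_Ico_succ_bot (by omega)]
    refine add_le_add (by simp) ?_
    refine Finset.sum_le_sum fun k _ => ?_
    refine (le_abs_self _).trans ?_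
    rw [abs_mul, abs_mul, abs_pow, abs_neg, abs_one, one_pow, one_mul]
    refine mul_le_of_le_one_right (abs_nonneg _) ?_
    rw [abs_of_nonneg (pow_nonneg (by linarith) _)]
    exact pow_le_one₀ (by linarith) (by linarith)
  linarith [(abs_le.1 h1).2]

/-- If `τ ≤ 3` the term `k = 1` of the weight is enough; otherwise `α < 1` and
`traceBound_le_weight` applies. It follows that `ξ` is small against `w`, so all logarithms are at
least `1`. -/
theorem le_weight : |1 - I.α| * I.traceBound / 3 ≤ I.weight := by
  have hτ := hI.traceBound_pos
  have hw := hI.abs_le_weight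
  have ha := hI.abs_pos
  rcases le_or_gt I.traceBound 3 with h | h
  · nlinarith
  · have hα : I.α < 1 := by
      by_contra h'
      have := hI.traceBound_le_one (lt_of_le_of_ne (not_lt.1 h') hI.α_ne_one.symm)
      linarith
    have h1 := hI.traceBound_le_weight hα
    have h2 := hI.xi_le'
    have h3 : |1 - I.α| ≤ 1 := by
      rw [abs_le]; constructor <;> linarith [hI.α_pos]
    nlinarith

theorem two_mul_xi_le : 2 * I.xi ≤ I.weight := by
  linarith [hI.xi_le, hI.le_weight]

theorem one_le_log : 1 ≤ Real.log (4 * I.weight / I.xi) := by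
  have h1 : Real.exp 1 ≤ 4 * I.weight / I.xi := by
    rw [le_div_iff₀ hI.xi_pos]
    have := Real.exp_one_lt_d9
    nlinarith [hI.two_mul_xi_le, hI.xi_pos]
  have := Real.log_le_log (Real.exp_pos 1) h1
  rwa [Real.log_exp] at this

theorem one_le_L : 1 ≤ I.L := by
  have h1 : 1 ≤ 1 / I.Λ ^ 2 := by
    rw [le_div_iff₀ (pow_pos hI.Λ_pos 2), one_mul]
    exact pow_le_one₀ hI.Λ_pos.le hI.Λ_lt_one.le
  exact one_le_mul_of_one_le_of_one_le hI.one_le_log h1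

omit hI in
theorem bCoeff_succ_zero (k : ℕ) : bCoeff (k + 1) 0 = 0 := by
  simp [bCoeff, arcsinCoeff]

omit hI in
theorem bCoeff_one_one : bCoeff 1 1 = 2 / Real.pi := by
  simp [bCoeff, arcsinCoeff, Finset.sum_range_succ]

omit hI in
theorem bCoeff_one_of_two_le {k : ℕ} (hk : 2 ≤ k) : bCoeff k 1 = 0 := by
  obtain ⟨m, rfl⟩ := Nat.exists_eq_add_of_le' hk
  rw [bCoeff, Finset.sum_range_succ, Finset.sum_range_one, bCoeff_succ_zero]
  simp [arcsinCoeff]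

theorem f_one (s : ℕ) : I.f ⟨1, s⟩ = -(2 / Real.pi) * (I.α - 1) * ((Nat.choose 1 s : ℝ) / 2) := by
  rw [Input.f, Finset.sum_eq_single 1]
  · rw [bCoeff_one_one, Ring.choose_one_right]; ring
  · intro k hk hk1
    rw [bCoeff_one_of_two_le (by have := (Finset.mem_Icc.1 hk).1; omega)]
    ring
  · intro h
    exact absurd (Finset.mem_Icc.2 ⟨le_rfl, hI.K_pos⟩) h

/-- The two terms with `l = 1` already contribute this much: `y` occurs to the first power only for
`k = 1`. -/
theorem le_fNorm : 2 / Real.pi * |1 - I.α| ≤ I.fNorm := by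
  have hL : 1 ≤ ⌊I.L⌋₊ := Nat.le_floor (by exact_mod_cast hI.one_le_L)
  have hmem : ∀ s ≤ 1, (⟨1, s⟩ : Σ _ : ℕ, ℕ) ∈ I.terms := by
    intro s hs
    rw [Input.terms, Finset.mem_sigma, Finset.mem_range, Finset.mem_Icc]
    refine ⟨by simp only; omega, ?_, ?_⟩ <;> simp only <;> omega
  have hsub : ({⟨1, 0⟩, ⟨1, 1⟩} : Finset (Σ _ : ℕ, ℕ)) ⊆ I.terms := by
    intro p hp
    rw [Finset.mem_insert, Finset.mem_singleton] at hp
    rcases hp with rfl | rfl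
    · exact hmem 0 (by norm_num)
    · exact hmem 1 le_rfl
  have h := Finset.sum_le_sum_of_subset_of_nonneg (f := fun p => |I.f p|) hsub
    (fun p _ _ => abs_nonneg _)
  rw [Finset.sum_pair (by simp), hI.f_one, hI.f_one] at h
  refine le_trans (le_of_eq ?_) h
  simp only [Nat.choose_zero_right, Nat.choose_self, Nat.cast_one, abs_mul, abs_neg]
  rw [abs_of_pos (show (0 : ℝ) < 2 / Real.pi by positivity),
    abs_of_pos (show (0 : ℝ) < 1 / 2 by positivity), abs_sub_comm]
  ring

theorem fNorm_pos : 0 < I.fNorm :=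
  (mul_pos (by positivity) hI.abs_pos).trans_le hI.le_fNorm

omit hI in
theorem abs_sum_f_mul_le (g : (Σ _ : ℕ, ℕ) → ℝ) {c : ℝ} (hg : ∀ p ∈ I.terms, |g p| ≤ c) :
    |∑ p ∈ I.terms, I.f p * g p| ≤ I.fNorm * c := by
  refine (Finset.abs_sum_le_sum_abs _ _).trans ?_
  rw [Input.fNorm, Finset.sum_mul]
  refine Finset.sum_le_sum fun p hp => ?_
  rw [abs_mul]
  exact mul_le_mul_of_nonneg_left (hg p hp) (abs_nonneg _)

theorem series_sub_le {x : ℝ} (hx : I.Λ ≤ x) (hx1 : x ≤ 1) :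
    |1 + ∑ p ∈ I.terms, I.f p * Real.cos (x * Input.time p) - x ^ (I.α - 1)| ≤ I.xi :=
  I.abs_series_sub_le hI.α_pos hI.Λ_pos hI.Λ_lt_one hI.weight_pos hI.xi_pos
    (by linarith [hI.one_le_log]) hI.sub_one_le_K hI.pow_K_le hx hx1

/-- The cosine sum approximates `Λ ^ (α - 1) ≥ τ` at the point `Λ`, and its cosines are at most `1`.
-/
theorem traceBound_le_fNorm (h : I.α < 1) : I.traceBound ≤ 1 + I.fNorm + I.xi := by
  have h1 := hI.series_sub_le le_rfl hI.Λ_lt_one.le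
  have h2 := abs_sum_f_mul_le (I := I) (fun p => Real.cos (I.Λ * Input.time p)) (c := 1)
    (fun p _ => Real.abs_cos_le_one _)
  linarith [hI.traceBound_le_rpow h, (abs_le.1 h1).1, (abs_le.1 h2).2]

theorem prec_pos : 0 < I.prec := div_pos hI.xi_pos hI.fNorm_pos

/-- Nonzero times are at least `π / 2` in modulus, so this bound makes the step length `|t| / Q ≤
prec / |t|` at most `1 / 2`, within reach of the exact amplification. -/
theorem prec_le : I.prec ≤ Real.pi / 4 := by
  have hτ := hI.traceBound_pos
  have ha := hI.abs_pos
  have hpi := Real.pi_gt_three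
  rw [Input.prec, div_le_iff₀ hI.fNorm_pos]
  rcases le_or_gt I.traceBound 3 with h | h
  · have h1 : Real.pi / 4 * (2 / Real.pi * |1 - I.α|) = |1 - I.α| / 2 := by
      field_simp; norm_num
    have h2 := mul_le_mul_of_nonneg_left hI.le_fNorm (show 0 ≤ Real.pi / 4 by positivity)
    rw [h1] at h2
    nlinarith [hI.xi_le]
  · have hα : I.α < 1 := by
      by_contra h'
      have := hI.traceBound_le_one (lt_of_le_of_ne (not_lt.1 h') hI.α_ne_one.symm)
      linarith
    have h1 := hI.traceBound_le_fNorm hα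
    have h2 := hI.xi_le'
    nlinarith

theorem prec_lt_one : I.prec < 1 := by
  linarith [hI.prec_le, Real.pi_lt_four]

omit hI in
-- After the triangle inequality over `k`, both the binomial weights over `s` and the coefficients
-- `b` over `l` sum to at most `1`.
theorem fNorm_le_weight : I.fNorm ≤ I.weight := by
  have h1 : ∀ p : Σ _ : ℕ, ℕ, |I.f p| ≤ ∑ k ∈ Finset.Icc 1 I.K, |Ring.choose (I.α - 1) k| *
      (bCoeff k p.1 * ((p.1.choose p.2 : ℝ) / 2 ^ p.1)) := by
    intro p
    rw [Input.f, abs_mul, abs_of_nonneg (show 0 ≤ (p.1.choose p.2 : ℝ) / 2 ^ p.1 by positivity)]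
    refine (mul_le_mul_of_nonneg_right (Finset.abs_sum_le_sum_abs _ _)
      (by positivity)).trans_eq ?_
    rw [Finset.sum_mul]
    refine Finset.sum_congr rfl fun k _ => ?_
    rw [abs_mul, abs_mul, abs_pow, abs_neg, abs_one, one_pow, abs_of_nonneg (bCoeff_nonneg _ _)]
    ring
  rw [Input.fNorm]
  refine (Finset.sum_le_sum fun p _ => h1 p).trans ?_
  rw [Finset.sum_comm]
  refine Finset.sum_le_sum fun k _ => ?_
  rw [← Finset.mul_sum]
  refine mul_le_of_le_one_right (abs_nonneg _) ?_
  rw [Input.terms, Finset.sum_sigma]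
  refine (Finset.sum_le_sum fun l _ => ?_).trans (sum_range_bCoeff_le_one k (⌊I.L⌋₊ + 1))
  simp only
  rw [← Finset.mul_sum]
  refine mul_le_of_le_one_right (bCoeff_nonneg _ _) ?_
  rw [← sum_choose_div l]
  refine Finset.sum_le_sum_of_subset_of_nonneg ?_ fun s _ _ => by positivity
  intro s hs
  rw [Finset.mem_Icc] at hs
  rw [Finset.mem_range]
  omega

theorem B_pos : 0 < I.B := by
  refine Nat.ceil_pos.2 ?_
  have h1 := hI.fNorm_pos
  have h2 := hI.xi_pos
  have h3 : 0 < Real.log (2 / I.δ) := by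
    refine Real.log_pos ?_
    rw [lt_div_iff₀ hI.δ_pos]; linarith [hI.δ_lt_one]
  positivity

omit hI in
theorem one_le_N : 1 ≤ I.N := by
  have h := Finset.single_le_sum (f := fun l => 2 * I.M l + 1) (fun l _ => Nat.zero_le _)
    (Finset.mem_range.2 (Nat.succ_pos ⌊I.L⌋₊) : 0 ∈ Finset.range (⌊I.L⌋₊ + 1))
  unfold Input.N
  omega

theorem one_le_log_N : 1 ≤ Real.log (4 * I.N / I.δ) := by
  have h1 : Real.exp 1 ≤ 4 * I.N / I.δ := by
    rw [le_div_iff₀ hI.δ_pos]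
    have := Real.exp_one_lt_d9
    have h2 : (1 : ℝ) ≤ I.N := by exact_mod_cast one_le_N
    nlinarith [hI.δ_lt_one, hI.δ_pos]
  have := Real.log_le_log (Real.exp_pos 1) h1
  rwa [Real.log_exp] at this

theorem meas_pos : 0 < I.meas := by
  refine Nat.ceil_pos.2 ?_
  have h1 := hI.prec_pos
  have h2 := hI.one_le_log_N
  positivity

end Input.Valid

end RenyiEst
end

noncomputable section
namespace RenyiEst

/-! ### Gate counts -/

section Size

variable {Q n : ℕ}

theorem length_cSwap (j : Fin Q) (i : Fin n) : (cSwap j i).length = 9 := by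
  simp [cSwap, toffoli, ccZ]

theorem length_cSelect_le (Δ : ℝ) (j : Fin Q) :
    (cSelect Δ j : Circuit (Wire Q n)).length ≤ 9 * n + 16 := by
  unfold cSelect
  simp only [List.length_append, List.length_flatMap, length_cSwap, toffoli, ccZ]
  split_ifs <;> simp <;> omega

theorem length_cA_le (Δ : ℝ) (j : Fin Q) :
    (cA Δ j : Circuit (Wire Q n)).length ≤ 27 * n + 73 := by
  have h := length_cSelect_le (n := n) Δ j
  simp only [cA, cW, cRefl, cReflNeg, Circuit.inv, List.length_append, List.length_reverse,
    List.length_map, ccZ, List.length_cons, List.length_nil]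
  omega

theorem size_cosCircuit_le (hn : 1 ≤ n) (t : ℝ) :
    (cosCircuit n Q t).size ≤ 100 * n * (Q + 1) := by
  have h : ((List.finRange Q).flatMap fun j => (cA (t / Q) j : Circuit (Wire Q n))).length ≤
      Q * (27 * n + 73) := by
    rw [List.length_flatMap]
    have h1 := List.sum_le_card_nsmul
      ((List.finRange Q).map fun j => (cA (t / Q) j : Circuit (Wire Q n)).length) (27 * n + 73) ?_
    · simpa using h1
    · intro x hx
      obtain ⟨j, -, rfl⟩ := List.mem_map.1 hx
      exact length_cA_le _ j
  unfold Circuit.size cosCircuit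
  simp only [List.length_append, List.length_cons, List.length_nil]
  nlinarith

end Size

/-! ### Costs -/

theorem two_pow_le_centralBinom (k : ℕ) : 2 ^ k ≤ k.centralBinom := by
  induction k with
  | zero => simp
  | succ k ih =>
    have h := Nat.succ_mul_centralBinom_succ k
    have h2 : (k + 1) * (2 * k.centralBinom) ≤ (k + 1) * (k + 1).centralBinom := by
      rw [h]; nlinarith
    have := Nat.le_of_mul_le_mul_left h2 (Nat.succ_pos k)
    rw [pow_succ]; omega

/-- The recursion in the lower index is monotone in the upper one, so `x` may be replaced by `2 k`,
where the coefficient is central. -/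
theorem two_pow_le_ringChoose {x : ℝ} {k : ℕ} (h : 2 * (k : ℝ) ≤ x) :
    (2 : ℝ) ^ k ≤ Ring.choose x k := by
  have h1 : ∀ j ≤ k, ((2 * k).choose j : ℝ) ≤ Ring.choose x j := by
    intro j
    induction j with
    | zero => simp
    | succ j ih =>
      intro hj
      have h2 := succ_mul_ringChoose_succ x j
      have h3 : ((2 * k).choose (j + 1) : ℝ) * (j + 1) = (2 * k).choose j * (2 * k - j) := by
        have := Nat.choose_succ_right_eq (2 * k) j
        have h4 : ((2 * k - j : ℕ) : ℝ) = 2 * k - j := by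
          rw [Nat.cast_sub (by omega)]; push_cast; ring
        rw [← h4]
        exact_mod_cast this
      have hj' : (j : ℝ) ≤ k := by exact_mod_cast (by omega : j ≤ k)
      have h5 : ((2 * k).choose j : ℝ) * (2 * k - j) ≤ Ring.choose x j * (x - j) :=
        mul_le_mul (ih (by omega)) (by linarith)
          (by linarith [(k.cast_nonneg : (0 : ℝ) ≤ k)])
          ((Nat.cast_nonneg _).trans (ih (by omega)))
      refine le_of_mul_le_mul_right ?_ (show (0 : ℝ) < j + 1 by positivity)
      linarith
  refine le_trans ?_ (h1 k le_rfl)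
  have := two_pow_le_centralBinom k
  rw [Nat.centralBinom_eq_two_mul_choose] at this
  exact_mod_cast this

/-! ### Bounds of the cost parameters by `ratio`, `logFactor` and `Λ`. -/

namespace Input.Valid

variable {I : Input} (hI : I.Valid)

include hI

theorem ratio_pos : 0 < I.ratio := by
  have h1 := hI.weight_pos
  have h2 := hI.abs_pos
  have h3 := hI.traceBound_pos
  have h4 := hI.ε_pos
  unfold Input.ratio
  positivity

theorem one_le_three_mul_ratio : 1 ≤ 3 * I.ratio := by
  have h2 := hI.abs_pos
  have h3 := hI.traceBound_pos
  have h4 := hI.ε_pos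
  have h5 := hI.le_weight
  have h6 : |1 - I.α| * I.traceBound * I.ε ≤ |1 - I.α| * I.traceBound :=
    mul_le_of_le_one_right (by positivity) hI.ε_lt_one.le
  unfold Input.ratio
  rw [mul_div_assoc', le_div_iff₀ (by positivity)]
  linarith

theorem ratio_le : I.ratio ≤ 2 + I.ratio / (I.Λ * I.δ) := by
  have h0 := hI.ratio_pos
  have h1 : 0 < I.Λ * I.δ := mul_pos hI.Λ_pos hI.δ_pos
  have h2 : I.Λ * I.δ ≤ 1 := mul_le_one₀ hI.Λ_lt_one.le hI.δ_pos.le hI.δ_lt_one.le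
  have : I.ratio ≤ I.ratio / (I.Λ * I.δ) := le_div_self h0.le h1 h2
  linarith

theorem inv_le : 1 / (I.Λ * I.δ) ≤ 3 * (2 + I.ratio / (I.Λ * I.δ)) := by
  have h1 : 0 < I.Λ * I.δ := mul_pos hI.Λ_pos hI.δ_pos
  have h2 := div_le_div_of_nonneg_right hI.one_le_three_mul_ratio h1.le
  rw [mul_div_assoc] at h2
  linarith

theorem two_le_arg : 2 ≤ 2 + I.ratio / (I.Λ * I.δ) := by
  have h0 := hI.ratio_pos
  have h1 : 0 < I.Λ * I.δ := mul_pos hI.Λ_pos hI.δ_pos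
  have := (div_pos h0 h1).le
  linarith

theorem half_lt_logFactor : 0.69 < I.logFactor := by
  have h := Real.log_le_log (by norm_num) hI.two_le_arg
  have := Real.log_two_gt_d9
  unfold Input.logFactor
  linarith

omit hI in
theorem log_le_of_le_pow {a : ℝ} (ha : 0 < a) (k : ℕ)
    (h : a ≤ (2 + I.ratio / (I.Λ * I.δ)) ^ k) : Real.log a ≤ k * I.logFactor := by
  have := Real.log_le_log ha h
  rwa [Real.log_pow] at this

theorem logFactor_le : I.logFactor ≤ 2 + I.ratio / (I.Λ * I.δ) := by
  have := hI.two_le_arg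
  have h := Real.log_le_sub_one_of_pos (show 0 < 2 + I.ratio / (I.Λ * I.δ) by linarith)
  unfold Input.logFactor
  linarith

/-- The weight grows exponentially with the order. -/
theorem abs_le_logFactor : |1 - I.α| ≤ 20 * I.logFactor := by
  have hl := hI.half_lt_logFactor
  rcases le_or_gt I.α 3 with h | h
  · have : |1 - I.α| ≤ 2 := by rw [abs_le]; constructor <;> linarith [hI.α_pos]
    linarith
  · set x := I.α - 1 with hx
    have hx2 : 2 < x := by linarith
    have habs : |1 - I.α| = x := by rw [abs_of_neg (by linarith)]; ring
    set k := ⌊x / 2⌋₊ with hk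
    have hk1 : 1 ≤ k := Nat.le_floor (by push_cast; linarith)
    have hkx : (k : ℝ) ≤ x / 2 := Nat.floor_le (by linarith)
    have hkx' : x / 2 - 1 < k := by linarith [Nat.lt_floor_add_one (x / 2)]
    have hkK : k ≤ I.K := by
      have : (k : ℝ) ≤ I.K := by linarith [hI.sub_one_le_K]
      exact_mod_cast this
    have hw : (2 : ℝ) ^ k ≤ I.weight := by
      have h1 := Finset.single_le_sum (f := fun k => |Ring.choose (I.α - 1) k|)
        (fun k _ => abs_nonneg _) (Finset.mem_Icc.2 ⟨hk1, hkK⟩ : k ∈ Finset.Icc 1 I.K)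
      have h2 := two_pow_le_ringChoose (x := x) (k := k) (by linarith)
      exact h2.trans ((le_abs_self _).trans h1)
    -- For `α > 1` one has `τ ε ≤ 1`, so the exponential lower bound on the weight passes to `ratio`
    -- up to the factor `x`.
    have hR : I.weight / x ≤ I.ratio := by
      have h3 := hI.traceBound_pos
      have h4 := hI.ε_pos
      have h5 : x * I.traceBound * I.ε ≤ x := by
        have h6 : I.traceBound * I.ε ≤ 1 :=
          mul_le_one₀ (hI.traceBound_le_one (by linarith)) h4.le hI.ε_lt_one.le
        nlinarith
      unfold Input.ratio
      rw [habs]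
      exact div_le_div_of_nonneg_left hI.weight_pos.le (by positivity) h5
    have hlog : Real.log ((2 : ℝ) ^ k / x) ≤ I.logFactor := by
      refine Real.log_le_log (by positivity) (le_trans ?_ hI.ratio_le)
      exact (div_le_div_of_nonneg_right hw (by linarith)).trans hR
    rw [Real.log_div (by positivity) (by linarith), Real.log_pow] at hlog
    -- The tangent of the logarithm at `8` has slope `1 / 8`, small enough to be beaten by `k log 2
    -- ≥ (x / 2 - 1) log 2`.
    have hlx : Real.log x ≤ x / 8 - 1 + 3 * Real.log 2 := by
      have h7 := Real.log_le_sub_one_of_pos (show 0 < x / 8 by linarith)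
      rw [Real.log_div (by linarith) (by norm_num), show (8 : ℝ) = 2 ^ 3 by norm_num,
        Real.log_pow] at h7
      push_cast at h7
      linarith
    have hl2 := Real.log_two_gt_d9
    have hl2' := Real.log_two_lt_d9
    rw [habs]
    nlinarith

/-- Capping the precision at `1` loses at most the factor `|1 - α| ε`, which `abs_le_logFactor`
bounds by `20 logFactor`; the `6` in `120 = 6 · 20` comes from the definition of `ξ`. -/
theorem weight_div_xi_le : I.weight / I.xi ≤ 120 * I.ratio * I.logFactor := by
  have h1 := hI.weight_pos
  have h2 := hI.abs_pos
  have h3 := hI.traceBound_pos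
  have h4 := hI.ε_pos
  have h5 := hI.half_lt_logFactor
  have h6 := hI.abs_le_logFactor
  have h7 : |1 - I.α| * I.ε ≤ 20 * I.logFactor * min (|1 - I.α| * I.ε) 1 := by
    rcases le_total (|1 - I.α| * I.ε) 1 with h | h
    · rw [min_eq_left h]
      exact le_mul_of_one_le_left (by positivity) (by linarith)
    · rw [min_eq_right h, mul_one]
      exact (mul_le_of_le_one_right h2.le hI.ε_lt_one.le).trans h6
  rw [div_le_iff₀ hI.xi_pos]
  have e : 120 * I.ratio * I.logFactor * I.xi = I.weight *
      (20 * I.logFactor * min (|1 - I.α| * I.ε) 1) / (|1 - I.α| * I.ε) := by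
    unfold Input.ratio Input.xi Input.totalPrec
    field_simp
    ring
  rw [e, le_div_iff₀ (by positivity)]
  exact mul_le_mul_of_nonneg_left h7 h1.le

theorem inv_prec_le : 1 / I.prec ≤ 120 * I.ratio * I.logFactor := by
  refine le_trans ?_ hI.weight_div_xi_le
  rw [Input.prec, one_div_div]
  exact div_le_div_of_nonneg_right fNorm_le_weight hI.xi_pos.le

theorem log_weight_le : Real.log (4 * I.weight / I.xi) ≤ 11 * I.logFactor := by
  have h0 := hI.xi_pos
  have h1 := hI.weight_pos
  refine log_le_of_le_pow (I := I) (by positivity) 11 ?_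
  have h2 := hI.two_le_arg
  have h3 := hI.ratio_le
  have h4 := hI.logFactor_le
  have h5 := hI.half_lt_logFactor
  set X := 2 + I.ratio / (I.Λ * I.δ)
  have h6 : I.ratio * I.logFactor ≤ X * X := mul_le_mul h3 h4 (by linarith) (by linarith)
  have h7 : (2 : ℝ) ^ 9 ≤ X ^ 9 := pow_le_pow_left₀ (by norm_num) h2 9
  calc 4 * I.weight / I.xi = 4 * (I.weight / I.xi) := by ring
    _ ≤ 4 * (120 * I.ratio * I.logFactor) := by linarith [hI.weight_div_xi_le]
    _ = 480 * (I.ratio * I.logFactor) := by ring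
    _ ≤ X ^ 9 * (X * X) := mul_le_mul (by linarith) h6
        (mul_nonneg hI.ratio_pos.le (by linarith)) (by positivity)
    _ = X ^ 11 := by ring

/-- As `l ≤ G / Λ²`, the half-width `√(G l / 2)` is of order `G / Λ`. This saves a factor `1 / Λ`
over the trivial range of `s`, and makes `t²` of order `1 / Λ²`. -/
theorem two_mul_M_add_one_le {l : ℕ} (hl : l ≤ ⌊I.L⌋₊) :
    2 * (I.M l : ℝ) + 1 ≤ 5 * (Real.log (4 * I.weight / I.xi) / I.Λ) := by
  set G := Real.log (4 * I.weight / I.xi) with hG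
  have hG1 : 1 ≤ G := hI.one_le_log
  have hΛ := hI.Λ_pos
  have hlL : (l : ℝ) ≤ G * (1 / I.Λ ^ 2) :=
    (Nat.cast_le.2 hl).trans (Nat.floor_le (by rw [Input.L]; positivity))
  have h1 : (I.M l : ℝ) < √(G * (l / 2)) + 1 := Nat.ceil_lt_add_one (Real.sqrt_nonneg _)
  have h2 : √(G * (l / 2)) ≤ G / I.Λ := by
    refine Real.sqrt_le_iff.2 ⟨by positivity, ?_⟩
    have : G * l ≤ G * (G * (1 / I.Λ ^ 2)) := mul_le_mul_of_nonneg_left hlL (by linarith)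
    have e : G * (G * (1 / I.Λ ^ 2)) = (G / I.Λ) ^ 2 := by field_simp
    have h3 : 0 ≤ G * l := by positivity
    linarith
  have h3 : 1 ≤ G / I.Λ := by
    rw [le_div_iff₀ hΛ]; linarith [hI.Λ_lt_one]
  linarith

theorem time_sq_le {p : Σ _ : ℕ, ℕ} (hp : p ∈ I.terms) :
    time p ^ 2 ≤ 64 * (Real.log (4 * I.weight / I.xi) / I.Λ) ^ 2 := by
  obtain ⟨l, s⟩ := p
  rw [Input.terms, Finset.mem_sigma, Finset.mem_range, Finset.mem_Icc] at hp
  simp only at hp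
  obtain ⟨hl, hs1, hs2⟩ := hp
  have hM := hI.two_mul_M_add_one_le (Nat.lt_succ_iff.1 hl)
  set D := Real.log (4 * I.weight / I.xi) / I.Λ
  have h1 : |2 * (s : ℝ) - l| ≤ 2 * (I.M l : ℝ) + 1 := by
    have a1 : 2 * s ≤ l + (2 * I.M l + 1) := by omega
    have a2 : l ≤ 2 * s + (2 * I.M l + 1) := by omega
    have b1 : 2 * (s : ℝ) ≤ l + (2 * I.M l + 1) := by exact_mod_cast a1
    have b2 : (l : ℝ) ≤ 2 * s + (2 * I.M l + 1) := by exact_mod_cast a2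
    rw [abs_le]; constructor <;> linarith
  have h2 : (2 * (s : ℝ) - l) ^ 2 ≤ (5 * D) ^ 2 := by
    rw [← sq_abs]
    exact pow_le_pow_left₀ (abs_nonneg _) (h1.trans hM) 2
  have h3 : (Real.pi / 2) ^ 2 ≤ 64 / 25 := by
    have := Real.pi_lt_d2
    have := Real.pi_pos
    nlinarith
  calc time ⟨l, s⟩ ^ 2 = (2 * (s : ℝ) - l) ^ 2 * (Real.pi / 2) ^ 2 := by
        unfold time; ring
    _ ≤ (5 * D) ^ 2 * (64 / 25) := mul_le_mul h2 h3 (by positivity) (by positivity)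
    _ = 64 * D ^ 2 := by ring

theorem one_le_inv_prec : 1 ≤ 1 / I.prec := by
  rw [le_div_iff₀ hI.prec_pos]; linarith [hI.prec_lt_one]

theorem steps_add_one_le {p : Σ _ : ℕ, ℕ} (hp : p ∈ I.terms) :
    (I.steps p : ℝ) + 1 ≤ 7986 * I.logFactor ^ 2 * (1 / I.prec) / I.Λ ^ 2 := by
  have h0 := hI.prec_pos
  have h1 : (I.steps p : ℝ) < time p ^ 2 / I.prec + 1 := Nat.ceil_lt_add_one (by positivity)
  have h2 := hI.time_sq_le hp
  have h3 := hI.one_le_inv_prec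
  have h4 := hI.log_weight_le
  have h5 := hI.one_le_log
  have hΛ := hI.Λ_pos
  set G := Real.log (4 * I.weight / I.xi)
  have h6 : 1 ≤ (G / I.Λ) ^ 2 := by
    refine one_le_pow₀ ?_
    rw [le_div_iff₀ hΛ]; linarith [hI.Λ_lt_one]
  have h7 : (G / I.Λ) ^ 2 ≤ 121 * I.logFactor ^ 2 / I.Λ ^ 2 := by
    rw [div_pow]
    refine div_le_div_of_nonneg_right ?_ (by positivity)
    calc G ^ 2 ≤ (11 * I.logFactor) ^ 2 := pow_le_pow_left₀ (by linarith) h4 2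
      _ = _ := by ring
  calc (I.steps p : ℝ) + 1 ≤ 64 * (G / I.Λ) ^ 2 * (1 / I.prec) + 2 := by
        have := mul_le_mul_of_nonneg_right h2 (show 0 ≤ 1 / I.prec by positivity)
        rw [mul_one_div] at this
        linarith
    _ ≤ 66 * (G / I.Λ) ^ 2 * (1 / I.prec) := by
        have := one_le_mul_of_one_le_of_one_le h6 h3
        linarith
    _ ≤ 66 * (121 * I.logFactor ^ 2 / I.Λ ^ 2) * (1 / I.prec) := by gcongr
    _ = _ := by ring

theorem B_le : (I.B : ℝ) ≤ 10 * I.logFactor * (1 / I.prec) ^ 2 := by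
  have hδ := hI.δ_pos
  have h0 := hI.fNorm_pos
  have h1 := hI.xi_pos
  have hlog : 0 ≤ Real.log (2 / I.δ) := by
    refine Real.log_nonneg ?_
    rw [le_div_iff₀ hδ]; linarith [hI.δ_lt_one]
  have h2 : (I.B : ℝ) < 2 * (I.fNorm ^ 2 / I.xi ^ 2) * Real.log (2 / I.δ) + 1 :=
    Nat.ceil_lt_add_one (by positivity)
  have e : I.fNorm ^ 2 / I.xi ^ 2 = (1 / I.prec) ^ 2 := by
    rw [Input.prec, one_div_div, div_pow]
  rw [e] at h2
  have h3 : Real.log (2 / I.δ) ≤ 4 * I.logFactor := by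
    refine log_le_of_le_pow (I := I) (by positivity) 4 ?_
    have h4 := hI.two_le_arg
    have h5 := hI.inv_le
    have h6 : 1 / I.δ ≤ 1 / (I.Λ * I.δ) :=
      one_div_le_one_div_of_le (mul_pos hI.Λ_pos hδ)
        (mul_le_of_le_one_left hδ.le hI.Λ_lt_one.le)
    set X := 2 + I.ratio / (I.Λ * I.δ)
    have h7 : (2 : ℝ) ^ 3 ≤ X ^ 3 := pow_le_pow_left₀ (by norm_num) h4 3
    calc 2 / I.δ = 2 * (1 / I.δ) := by ring
      _ ≤ 2 * (3 * X) := by linarith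
      _ ≤ X ^ 3 * X := by nlinarith
      _ = X ^ 4 := by ring
  have h8 : 1 ≤ (1 / I.prec) ^ 2 := one_le_pow₀ hI.one_le_inv_prec
  have h9 := hI.half_lt_logFactor
  have h10 := mul_le_mul_of_nonneg_left h3 (show 0 ≤ 2 * (1 / I.prec) ^ 2 by positivity)
  nlinarith

theorem log_N_le : Real.log (4 * I.N / I.δ) ≤ 25 * I.logFactor := by
  have hδ := hI.δ_pos
  have hΛ := hI.Λ_pos
  have hN : (1 : ℝ) ≤ I.N := by exact_mod_cast one_le_N
  refine log_le_of_le_pow (I := I) (by positivity) 25 ?_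
  have hG := hI.log_weight_le
  have hG1 := hI.one_le_log
  have hM : ∀ l ∈ Finset.range (⌊I.L⌋₊ + 1),
      2 * (I.M l : ℝ) + 1 ≤ 5 * (Real.log (4 * I.weight / I.xi) / I.Λ) := fun l hl =>
    hI.two_mul_M_add_one_le (Nat.lt_succ_iff.1 (Finset.mem_range.1 hl))
  have hL : I.L = Real.log (4 * I.weight / I.xi) * (1 / I.Λ ^ 2) := rfl
  set G := Real.log (4 * I.weight / I.xi)
  have hL1 := hI.one_le_L
  have h1 : (I.N : ℝ) ≤ 2 * I.L * (5 * (G / I.Λ)) := by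
    unfold Input.N
    push_cast
    refine (Finset.sum_le_sum hM).trans ?_
    rw [Finset.sum_const, Finset.card_range, nsmul_eq_mul]
    refine mul_le_mul_of_nonneg_right ?_ (by positivity)
    push_cast
    linarith [Nat.floor_le (show 0 ≤ I.L by linarith)]
  have h2 := hI.two_le_arg
  have h3 := hI.inv_le
  have h4 := hI.logFactor_le
  have h5 := hI.half_lt_logFactor
  set X := 2 + I.ratio / (I.Λ * I.δ)
  have h6 : 1 / I.Λ ≤ 3 * X := le_trans (one_div_le_one_div_of_le (mul_pos hΛ hδ)
    (mul_le_of_le_one_right hΛ.le hI.δ_lt_one.le)) h3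
  have h7 : 1 / I.δ ≤ 3 * X := le_trans (one_div_le_one_div_of_le (mul_pos hΛ hδ)
    (mul_le_of_le_one_left hδ.le hI.Λ_lt_one.le)) h3
  have h8 : (2 : ℝ) ^ 19 ≤ X ^ 19 := pow_le_pow_left₀ (by norm_num) h2 19
  calc 4 * I.N / I.δ = 4 * I.N * (1 / I.δ) := by ring
    _ ≤ 4 * (2 * I.L * (5 * (G / I.Λ))) * (1 / I.δ) := by gcongr
    _ = 40 * G ^ 2 * (1 / I.Λ) ^ 3 * (1 / I.δ) := by rw [hL]; ring
    _ ≤ 40 * (11 * X) ^ 2 * (3 * X) ^ 3 * (3 * X) := by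
        gcongr
        linarith
    _ = 392040 * X ^ 6 := by ring
    _ ≤ X ^ 19 * X ^ 6 := mul_le_mul_of_nonneg_right (by linarith) (by positivity)
    _ = X ^ 25 := by ring

theorem meas_le : (I.meas : ℝ) ≤ 402 * I.logFactor * (1 / I.prec) ^ 2 := by
  have h0 := hI.prec_pos
  have hl := hI.one_le_log_N
  have h2 : (I.meas : ℝ) < 16 * Real.log (4 * I.N / I.δ) / I.prec ^ 2 + 1 :=
    Nat.ceil_lt_add_one (by positivity)
  have e : 16 * Real.log (4 * I.N / I.δ) / I.prec ^ 2 =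
      16 * Real.log (4 * I.N / I.δ) * (1 / I.prec) ^ 2 := by field_simp
  rw [e] at h2
  have h8 : 1 ≤ (1 / I.prec) ^ 2 := one_le_pow₀ hI.one_le_inv_prec
  have h9 := hI.half_lt_logFactor
  have h10 := mul_le_mul_of_nonneg_right hI.log_N_le (show 0 ≤ (1 / I.prec) ^ 2 by positivity)
  nlinarith

theorem copies_le (ω : I.Run) : (I.copies ω : ℝ) ≤
    (10 * 402 * 7986 * 120 ^ 5) * I.logFactor ^ 9 * (I.ratio ^ 5 / I.Λ ^ 2) := by
  have h0 : 0 ≤ 1 / I.prec := by linarith [hI.one_le_inv_prec]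
  have hl := hI.half_lt_logFactor
  have hl0 : 0 ≤ I.logFactor := by linarith
  have hΛ := hI.Λ_pos
  set V := 1 / I.prec with hV
  calc (I.copies ω : ℝ) = ∑ j, (I.meas : ℝ) * ((I.steps (ω j).1.1 : ℝ) + 1) := by
        unfold Input.copies; push_cast; rfl
    _ ≤ ∑ _j : Fin I.B, (402 * I.logFactor * V ^ 2) *
        (7986 * I.logFactor ^ 2 * V / I.Λ ^ 2) :=
        Finset.sum_le_sum fun j _ => mul_le_mul hI.meas_le (hI.steps_add_one_le (ω j).1.2)
          (by positivity) (by positivity)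
    _ = I.B * ((402 * I.logFactor * V ^ 2) * (7986 * I.logFactor ^ 2 * V / I.Λ ^ 2)) := by
        rw [Finset.sum_const, Finset.card_univ, Fintype.card_fin, nsmul_eq_mul]
    _ ≤ (10 * I.logFactor * V ^ 2) *
        ((402 * I.logFactor * V ^ 2) * (7986 * I.logFactor ^ 2 * V / I.Λ ^ 2)) :=
        mul_le_mul_of_nonneg_right hI.B_le (by positivity)
    _ = (10 * 402 * 7986) * I.logFactor ^ 4 / I.Λ ^ 2 * V ^ 5 := by ring
    _ ≤ (10 * 402 * 7986) * I.logFactor ^ 4 / I.Λ ^ 2 * (120 * I.ratio * I.logFactor) ^ 5 :=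
        mul_le_mul_of_nonneg_left (pow_le_pow_left₀ h0 hI.inv_prec_le 5) (by positivity)
    _ = _ := by ring

theorem gates_le {n : ℕ} (hn : 1 ≤ n) (ω : I.Run) : (I.gates n ω : ℝ) ≤
    (10 * 402 * 7986 * 120 ^ 5) * I.logFactor ^ 9 * (n * I.ratio ^ 3 / I.Λ ^ 2) := by
  have h0 : 0 ≤ 1 / I.prec := by linarith [hI.one_le_inv_prec]
  have hl := hI.half_lt_logFactor
  have hl0 : 0 ≤ I.logFactor := by linarith
  have hΛ := hI.Λ_pos
  have hR := hI.ratio_pos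
  set V := 1 / I.prec with hV
  -- The gate count needs only six logarithmic factors; padding to nine lets one pair of constants
  -- serve both costs.
  have hl3 : 1 ≤ 8 * I.logFactor ^ 3 := by
    have : (1 : ℝ) ≤ (2 * I.logFactor) ^ 3 := one_le_pow₀ (by linarith)
    linarith [(by ring : (2 * I.logFactor) ^ 3 = 8 * I.logFactor ^ 3)]
  calc (I.gates n ω : ℝ)
      ≤ ∑ j, 100 * (n : ℝ) * ((I.steps (ω j).1.1 : ℝ) + 1) := by
        unfold Input.gates
        push_cast
        refine Finset.sum_le_sum fun j _ => ?_
        exact_mod_cast size_cosCircuit_le hn _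
    _ ≤ ∑ _j : Fin I.B, 100 * (n : ℝ) * (7986 * I.logFactor ^ 2 * V / I.Λ ^ 2) :=
        Finset.sum_le_sum fun j _ => mul_le_mul_of_nonneg_left (hI.steps_add_one_le (ω j).1.2)
          (by positivity)
    _ = I.B * (100 * (n : ℝ) * (7986 * I.logFactor ^ 2 * V / I.Λ ^ 2)) := by
        rw [Finset.sum_const, Finset.card_univ, Fintype.card_fin, nsmul_eq_mul]
    _ ≤ (10 * I.logFactor * V ^ 2) * (100 * (n : ℝ) * (7986 * I.logFactor ^ 2 * V / I.Λ ^ 2)) :=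
        mul_le_mul_of_nonneg_right hI.B_le (by positivity)
    _ = (10 * 100 * 7986) * n * I.logFactor ^ 3 / I.Λ ^ 2 * V ^ 3 := by ring
    _ ≤ (10 * 100 * 7986) * n * I.logFactor ^ 3 / I.Λ ^ 2 *
        (120 * I.ratio * I.logFactor) ^ 3 :=
        mul_le_mul_of_nonneg_left (pow_le_pow_left₀ h0 hI.inv_prec_le 3) (by positivity)
    _ = ((10 * 100 * 7986) * 120 ^ 3 * I.logFactor ^ 6 * (n * I.ratio ^ 3 / I.Λ ^ 2)) * 1 := by
        ring
    _ ≤ ((10 * 100 * 7986) * 120 ^ 3 * I.logFactor ^ 6 * (n * I.ratio ^ 3 / I.Λ ^ 2)) *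
        (8 * I.logFactor ^ 3) := mul_le_mul_of_nonneg_left hl3 (by positivity)
    _ = (10 * 100 * 7986 * 120 ^ 3 * 8) * (I.logFactor ^ 9 * (n * I.ratio ^ 3 / I.Λ ^ 2)) := by
        ring
    _ ≤ (10 * 402 * 7986 * 120 ^ 5) * (I.logFactor ^ 9 * (n * I.ratio ^ 3 / I.Λ ^ 2)) :=
        mul_le_mul_of_nonneg_right (by norm_num) (by positivity)
    _ = _ := by ring

end Input.Valid

end RenyiEst
end

noncomputable section
namespace RenyiEst

/-! ### From the estimated trace to the entropy -/

theorem one_add_mul_le_rpow {x p : ℝ} (hx : 0 < x) (hp : p ≤ 0 ∨ 1 ≤ p) :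
    1 + p * (x - 1) ≤ x ^ p := by
  rcases hp with hp | hp
  · have h1 := Real.add_one_le_exp (Real.log x * p)
    rw [← Real.rpow_def_of_pos hx] at h1
    nlinarith [mul_le_mul_of_nonpos_left (Real.log_le_sub_one_of_pos hx) hp]
  · simpa using one_add_mul_self_le_rpow_one_add (s := x - 1) (by linarith) hp

/-- Below `1` the concave logarithm lies above its chord over `[1/2, 1]`, of slope `2 log 2`. This
constant cancels the base `2` and the `1 / 2` in the precision exactly. -/
theorem abs_log_le {x : ℝ} (hx : |x - 1| ≤ 1 / 2) : |Real.log x| ≤ 2 * Real.log 2 * |x - 1| := by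
  obtain ⟨h1, h2⟩ := abs_le.1 hx
  have hl := Real.log_two_gt_d9
  rcases le_or_gt 1 x with h | h
  · rw [abs_of_nonneg (Real.log_nonneg h), abs_of_nonneg (sub_nonneg.2 h)]
    nlinarith [Real.log_le_sub_one_of_pos (show 0 < x by linarith)]
  · rw [abs_of_neg (Real.log_neg (by linarith) h), abs_of_neg (sub_neg.2 h)]
    have h3 := strictConcaveOn_log_Ioi.concaveOn.2 (Set.mem_Ioi.2 one_pos)
      (Set.mem_Ioi.2 (show (0 : ℝ) < 1 / 2 by norm_num)) (show 0 ≤ 2 * x - 1 by linarith)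
      (show 0 ≤ 2 - 2 * x by linarith) (by ring)
    simp only [smul_eq_mul, Real.log_one, mul_zero, zero_add, one_div, Real.log_inv] at h3
    have e : (2 * x - 1) * 1 + (2 - 2 * x) * 2⁻¹ = x := by ring
    rw [e] at h3
    linarith

theorem abs_logb_sub_le {S T r : ℝ} (hT : 0 < T) (hr : r ≤ 1) (h : |S - T| ≤ r * T / 2) :
    |Real.logb 2 S - Real.logb 2 T| ≤ r := by
  have hd : |S / T - 1| ≤ r / 2 := by
    rw [div_sub_one hT.ne', abs_div, abs_of_pos hT, div_le_iff₀ hT]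
    linarith
  have hS : 0 < S / T := by linarith [(abs_le.1 hd).1]
  have hS' : 0 < S := by
    have := mul_pos hS hT
    rwa [div_mul_cancel₀ _ hT.ne'] at this
  have hl : 0 < Real.log 2 := Real.log_pos one_lt_two
  have h1 := abs_log_le (x := S / T) (by linarith)
  rw [← Real.logb_div hS'.ne' hT.ne', Real.logb, abs_div, abs_of_pos hl, div_le_iff₀ hl]
  nlinarith [mul_le_mul_of_nonneg_left hd hl.le]

/-! ### Lower bounds for `tr (ρ ^ α)` in terms of the purity. -/

section Trace

variable {n : ℕ} {ρ : Matrix (Bits n) (Bits n) ℂ}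

theorem purity_le_one (hρ : IsState ρ) : purity ρ ≤ 1 := by
  rw [purity_eq hρ, ← sum_eig hρ]
  refine Finset.sum_le_sum fun i _ => ?_
  nlinarith [eig_nonneg hρ i, eig_le_one hρ i]

theorem le_purity (hρ : IsState ρ) {Λ : ℝ} (h : ∀ i, eig hρ i ≠ 0 → Λ ≤ eig hρ i) :
    Λ ≤ purity ρ := by
  rw [purity_eq hρ, ← mul_one Λ, ← sum_eig hρ, Finset.mul_sum]
  refine Finset.sum_le_sum fun i _ => ?_
  by_cases hi : eig hρ i = 0
  · simp [hi]
  · nlinarith [h i hi, eig_nonneg hρ i]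

theorem tracePow_eq (hρ : IsState ρ) {α : ℝ} (hα : 0 < α) :
    tracePow hρ α = ∑ i, eig hρ i * eig hρ i ^ (α - 1) := by
  refine Finset.sum_congr rfl fun i _ => ?_
  rcases (eig_nonneg hρ i).eq_or_lt with h | h
  · rw [← h, Real.zero_rpow hα.ne', zero_mul]
  · rw [← Real.rpow_one_add' h.le (by linarith), add_sub_cancel]

/-- Jensen's inequality for the convex function `x ^ (α - 1)` and the eigenvalues weighted by
themselves, whose mean is the purity. It is proved by the tangent line at the purity, the linear
terms summing to zero. -/
theorem purity_rpow_le_tracePow (hρ : IsState ρ) {α : ℝ} (hα : 0 < α) (hP : 0 < purity ρ)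
    (h : α ≤ 1 ∨ 2 ≤ α) : purity ρ ^ (α - 1) ≤ tracePow hρ α := by
  have hP' : 0 < purity ρ ^ (α - 1) := Real.rpow_pos_of_pos hP _
  have h1 : ∀ i, eig hρ i * (1 + (α - 1) * (eig hρ i / purity ρ - 1)) * purity ρ ^ (α - 1) ≤
      eig hρ i * eig hρ i ^ (α - 1) := by
    intro i
    rcases (eig_nonneg hρ i).eq_or_lt with h0 | h0
    · simp [← h0]
    · rw [mul_assoc]
      refine mul_le_mul_of_nonneg_left ?_ h0.le
      have h2 := one_add_mul_le_rpow (x := eig hρ i / purity ρ) (p := α - 1) (by positivity)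
        (h.imp (fun h => by linarith) (fun h => by linarith))
      rw [Real.div_rpow h0.le hP.le, le_div_iff₀ hP'] at h2
      exact h2
  rw [tracePow_eq hρ hα]
  refine le_trans (le_of_eq ?_) (Finset.sum_le_sum fun i _ => h1 i)
  rw [← Finset.sum_mul]
  have e : ∑ i, eig hρ i * (1 + (α - 1) * (eig hρ i / purity ρ - 1)) = 1 := by
    have e1 : ∀ i, eig hρ i * (1 + (α - 1) * (eig hρ i / purity ρ - 1)) =
        (2 - α) * eig hρ i + (α - 1) / purity ρ * eig hρ i ^ 2 := fun i => by
      field_simp; ring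
    simp only [e1]
    rw [Finset.sum_add_distrib, ← Finset.mul_sum, ← Finset.mul_sum, sum_eig hρ, ← purity_eq hρ,
      div_mul_cancel₀ _ hP.ne']
    ring
  rw [e, one_mul]

theorem purity_le_tracePow (hρ : IsState ρ) {α : ℝ} (hα : 0 < α) (h : α ≤ 2) :
    purity ρ ≤ tracePow hρ α := by
  rw [purity_eq hρ]
  refine Finset.sum_le_sum fun i _ => ?_
  rcases (eig_nonneg hρ i).eq_or_lt with h0 | h0
  · rw [← h0, Real.zero_rpow hα.ne', zero_pow two_ne_zero]
  · rw [← Real.rpow_natCast]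
    exact Real.rpow_le_rpow_of_exponent_ge h0 (eig_le_one hρ i) (by exact_mod_cast h)

end Trace

/-! ### Error budget of a run. -/

namespace Input.Valid

variable {I : Input} (hI : I.Valid)

include hI

omit hI in
theorem pi_div_two_le_abs_time {p : Σ _ : ℕ, ℕ} (h : time p ≠ 0) : Real.pi / 2 ≤ |time p| := by
  have e : time p = ((2 * (p.2 : ℤ) - p.1 : ℤ) : ℝ) * (Real.pi / 2) := by
    unfold time; push_cast; ring
  have hpi := Real.pi_pos
  rw [e, abs_mul, abs_of_pos (half_pos hpi)]
  refine le_mul_of_one_le_left (half_pos hpi).le ?_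
  rw [← Int.cast_abs]
  have : 2 * (p.2 : ℤ) - p.1 ≠ 0 := fun h0 => h (by rw [e, h0]; simp)
  exact_mod_cast Int.one_le_abs this

theorem time_ne_zero {p : Σ _ : ℕ, ℕ} (h : I.steps p ≠ 0) : time p ≠ 0 := by
  have := hI.prec_pos
  intro h0
  exact h (by simp [Input.steps, h0])

omit hI in
theorem le_steps (p : Σ _ : ℕ, ℕ) : time p ^ 2 / I.prec ≤ I.steps p :=
  Nat.le_ceil _

theorem abs_time_div_steps_le {p : Σ _ : ℕ, ℕ} (h : I.steps p ≠ 0) :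
    |time p / I.steps p| ≤ 1 / 2 := by
  have hQ : (0 : ℝ) < I.steps p := Nat.cast_pos.2 (Nat.pos_of_ne_zero h)
  have h1 := pi_div_two_le_abs_time (hI.time_ne_zero h)
  have h2 := le_steps (I := I) p
  have hp := hI.prec_le
  rw [div_le_iff₀ hI.prec_pos, ← sq_abs] at h2
  rw [abs_div, Nat.abs_cast, div_le_iff₀ hQ]
  have hpi := Real.pi_pos
  have h3 : |time p| * (Real.pi / 2) ≤ I.steps p * (Real.pi / 4) := by
    nlinarith [abs_nonneg (time p), mul_le_mul_of_nonneg_left hp hQ.le,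
      mul_le_mul_of_nonneg_left h1 (abs_nonneg (time p))]
  nlinarith

variable {n : ℕ} {ρ : Matrix (Bits n) (Bits n) ℂ}

theorem outcomeProb_steps (hρ : IsState ρ) (p : Σ _ : ℕ, ℕ) (b : Bool) :
    outcomeProb ρ (I.steps p) (time p) b =
      (1 + (if b then -1 else 1) * meanOutcome ρ (I.steps p) (time p)) / 2 :=
  outcomeProb_eq hρ _ _ (fun h => (hI.abs_time_div_steps_le h).trans_lt
    (by linarith [Real.pi_gt_three])) b

/-- With no steps the time is `0` and the circuit is exact; otherwise the error `t² / Q` is at most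
`prec` by the choice of `Q`. -/
theorem abs_meanOutcome_steps_sub_le (hρ : IsState ρ) (p : Σ _ : ℕ, ℕ) :
    |meanOutcome ρ (I.steps p) (time p) - ∑ i, eig hρ i * Real.cos (eig hρ i * time p)| ≤
      I.prec := by
  have hp := hI.prec_pos
  by_cases h : I.steps p = 0
  · have h1 := le_steps (I := I) p
    rw [h, Nat.cast_zero, div_le_iff₀ hp, zero_mul] at h1
    have h2 : time p = 0 := pow_eq_zero_iff two_ne_zero |>.1 (le_antisymm h1 (sq_nonneg _))
    rw [meanOutcome_eq hρ, h, h2]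
    simpa using hp.le
  · refine (abs_meanOutcome_sub_le hρ h
      ((hI.abs_time_div_steps_le h).trans (by norm_num))).trans ?_
    have h1 := le_steps (I := I) p
    have hQ : (0 : ℝ) < I.steps p := Nat.cast_pos.2 (Nat.pos_of_ne_zero h)
    rw [div_le_iff₀ hp] at h1
    rw [div_le_iff₀ hQ]
    linarith

/-- The errors at the eigenvalues are averaged with the eigenvalues as weights, so zero eigenvalues,
where the series need not approximate anything, drop out. -/
theorem abs_series_sub_tracePow_le (hρ : IsState ρ) (hΛ : ∀ i, eig hρ i ≠ 0 → I.Λ ≤ eig hρ i) :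
    |1 + ∑ p ∈ I.terms, I.f p * ∑ i, eig hρ i * Real.cos (eig hρ i * time p) -
      tracePow hρ I.α| ≤ I.xi := by
  have e : 1 + ∑ p ∈ I.terms, I.f p * ∑ i, eig hρ i * Real.cos (eig hρ i * time p) -
      tracePow hρ I.α = ∑ i, eig hρ i *
        (1 + ∑ p ∈ I.terms, I.f p * Real.cos (eig hρ i * time p) - eig hρ i ^ (I.α - 1)) := by
    simp only [mul_sub, mul_add, mul_one, Finset.sum_sub_distrib, Finset.sum_add_distrib]
    rw [sum_eig hρ, ← tracePow_eq hρ hI.α_pos]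
    simp only [Finset.mul_sum]
    rw [Finset.sum_comm]
    simp only [mul_left_comm]
  have e1 : I.xi = ∑ i, eig hρ i * I.xi := by rw [← Finset.sum_mul, sum_eig hρ, one_mul]
  rw [e, e1]
  refine (Finset.abs_sum_le_sum_abs _ _).trans (Finset.sum_le_sum fun i _ => ?_)
  rw [abs_mul, abs_of_nonneg (eig_nonneg hρ i)]
  by_cases hi : eig hρ i = 0
  · simp [hi]
  · exact mul_le_mul_of_nonneg_left (hI.series_sub_le (hΛ i hi) (eig_le_one hρ i))
      (eig_nonneg hρ i)

theorem abs_mean_sub_tracePow_le (hρ : IsState ρ) (hΛ : ∀ i, eig hρ i ≠ 0 → I.Λ ≤ eig hρ i) :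
    |1 + ∑ p ∈ I.terms, I.f p * meanOutcome ρ (I.steps p) (time p) - tracePow hρ I.α| ≤
      2 * I.xi := by
  have h1 := hI.abs_series_sub_tracePow_le hρ hΛ
  have h2 := abs_sum_f_mul_le (I := I) (fun p => meanOutcome ρ (I.steps p) (time p) -
    ∑ i, eig hρ i * Real.cos (eig hρ i * time p))
    (fun p _ => hI.abs_meanOutcome_steps_sub_le hρ p)
  rw [Input.prec, mul_div_cancel₀ _ hI.fNorm_pos.ne'] at h2
  simp only [mul_sub, Finset.sum_sub_distrib] at h2
  rw [abs_le] at *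
  constructor <;> linarith [h1.1, h1.2, h2.1, h2.2]

theorem traceBound_le_tracePow (hρ : IsState ρ) (hP : I.P = purity ρ) :
    I.traceBound ≤ tracePow hρ I.α := by
  have hP0 := hI.P_pos
  unfold Input.traceBound
  split_ifs with h
  · exact hP ▸ purity_le_tracePow hρ hI.α_pos h.2
  · rw [hP] at hP0 ⊢
    refine purity_rpow_le_tracePow hρ hI.α_pos hP0 ?_
    by_contra! h'
    exact h ⟨h'.1, h'.2.le⟩

theorem abs_output_sub_le (hρ : IsState ρ) (hΛ : ∀ i, eig hρ i ≠ 0 → I.Λ ≤ eig hρ i)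
    (hP : I.P = purity ρ) (ω : I.Run)
    (hω : |I.fNorm * (∑ j, Real.sign (I.f (ω j).1.1) * I.est ω j) / I.B -
      ∑ p ∈ I.terms, I.f p * meanOutcome ρ (I.steps p) (time p)| ≤ I.xi) :
    |I.output ω - renyiEntropy hρ I.α| ≤ I.ε := by
  have h1 := hI.abs_mean_sub_tracePow_le hρ hΛ
  have h2 := hI.traceBound_le_tracePow hρ hP
  have h3 := hI.traceBound_pos
  have ha := hI.abs_pos
  set S := I.fNorm * (∑ j, Real.sign (I.f (ω j).1.1) * I.est ω j) / I.B with hS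
  have hr : 0 ≤ min (|1 - I.α| * I.ε) 1 := le_min (mul_pos ha hI.ε_pos).le one_pos.le
  have h4 : |1 + S - tracePow hρ I.α| ≤ min (|1 - I.α| * I.ε) 1 * tracePow hρ I.α / 2 := by
    -- Series, simulation and sampling contribute one `ξ` each; the sum is a relative error since `τ
    -- ≤ tr (ρ ^ α)`.
    have h5 : 3 * I.xi = min (|1 - I.α| * I.ε) 1 * I.traceBound / 2 := by
      unfold Input.xi Input.totalPrec; ring
    have h6 := mul_le_mul_of_nonneg_left h2 hr
    rw [abs_le] at *
    constructor <;> linarith [h1.1, h1.2, hω.1, hω.2]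
  have h5 := abs_logb_sub_le (h3.trans_le h2) (min_le_right _ _) h4
  have e : I.output ω - renyiEntropy hρ I.α =
      (Real.logb 2 (1 + S) - Real.logb 2 (tracePow hρ I.α)) / (1 - I.α) := by
    unfold Input.output renyiEntropy; rw [hS]; ring
  rw [e, abs_div, div_le_iff₀ ha, mul_comm]
  exact h5.trans (min_le_left _ _)

theorem success (hρ : IsState ρ) (hΛ : ∀ i, eig hρ i ≠ 0 → I.Λ ≤ eig hρ i)
    (hP : I.P = purity ρ) :
    1 - I.δ ≤ I.prob ρ (fun ω => |I.output ω - renyiEntropy hρ I.α| ≤ I.ε) :=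
  I.one_sub_le_prob hI.fNorm_pos hI.xi_pos hI.δ_pos hI.meas_pos hI.B_pos
    (fun p _ => hI.outcomeProb_steps hρ p) (fun _ => abs_meanOutcome_le_one hρ _ _) _
    (hI.abs_output_sub_le hρ hΛ hP)

omit hI in
theorem ratio_pow (k : ℕ) (a : ℝ) : a * I.ratio ^ k / I.Λ ^ 2 =
    a * I.weight ^ k / (|1 - I.α| ^ k * I.traceBound ^ k * I.ε ^ k * I.Λ ^ 2) := by
  rw [Input.ratio, div_pow, mul_pow, mul_pow, mul_div_assoc', div_div]

theorem traceBound_pow (h : (0 < I.α ∧ I.α < 1) ∨ 2 < I.α) (k : ℕ) :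
    I.traceBound ^ k = I.P ^ (k * (I.α - 1)) := by
  unfold Input.traceBound
  rw [if_neg (by rintro ⟨h1, h2⟩; rcases h with ⟨-, h⟩ | h <;> linarith), mul_comm,
    Real.rpow_mul_natCast hI.P_pos.le]

end Input.Valid

end RenyiEst
end

theorem theorem2 :
    ∃ (C : ℝ) (c : ℕ), 0 < C ∧
      ∀ (n : ℕ) (ρ : Matrix (RenyiEst.Bits n) (RenyiEst.Bits n) ℂ) (hρ : RenyiEst.IsState ρ)
        (Λ α ε δ : ℝ),
        1 ≤ n → 0 < Λ → Λ < 1 →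
        (∀ i, RenyiEst.eig hρ i ≠ 0 → Λ ≤ RenyiEst.eig hρ i) →
        0 < α → α ≠ 1 → 0 < ε → ε < 1 → 0 < δ → δ < 1 →
        ∀ I : RenyiEst.Input,
          I = { α := α, ε := ε, δ := δ, Λ := Λ, P := RenyiEst.purity ρ } →
          ((∀ ω : I.Run, 0 ≤ I.runProb ρ ω) ∧ ∑ ω : I.Run, I.runProb ρ ω = 1) ∧
          1 - δ ≤ I.prob ρ (fun ω => |I.output ω - RenyiEst.renyiEntropy hρ α| ≤ ε) ∧
          ∀ ω : I.Run,
            ((0 < α ∧ α < 1) ∨ 2 < α →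
              (I.copies ω : ℝ) ≤ C * I.logFactor ^ c *
                (I.weight ^ 5 /
                  (|1 - α| ^ 5 * RenyiEst.purity ρ ^ (5 * (α - 1)) * ε ^ 5 * Λ ^ 2)) ∧
              (I.gates n ω : ℝ) ≤ C * I.logFactor ^ c *
                (n * I.weight ^ 3 /
                  (|1 - α| ^ 3 * RenyiEst.purity ρ ^ (3 * (α - 1)) * ε ^ 3 * Λ ^ 2))) ∧
            (1 < α ∧ α ≤ 2 →
              (I.copies ω : ℝ) ≤ C * I.logFactor ^ c *
                (I.weight ^ 5 / (|1 - α| ^ 5 * RenyiEst.purity ρ ^ 5 * ε ^ 5 * Λ ^ 2)) ∧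
              (I.gates n ω : ℝ) ≤ C * I.logFactor ^ c *
                (n * I.weight ^ 3 / (|1 - α| ^ 3 * RenyiEst.purity ρ ^ 3 * ε ^ 3 * Λ ^ 2))) := by
  -- The factors come from `B`, `meas`, the steps and five factors `1 / prec`. These carry `1 + 1 +
  -- 2 + 5 = 9` logarithms.
  refine ⟨10 * 402 * 7986 * 120 ^ 5, 9, by norm_num, ?_⟩
  intro n ρ hρ Λ α ε δ hn hΛ hΛ1 heig hα hα1 hε hε1 hδ hδ1 I hI
  obtain ⟨rfl, rfl, rfl, rfl, hP⟩ : I.α = α ∧ I.ε = ε ∧ I.δ = δ ∧ I.Λ = Λ ∧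
      I.P = RenyiEst.purity ρ := by subst hI; exact ⟨rfl, rfl, rfl, rfl, rfl⟩
  clear hI
  have hI : I.Valid := ⟨hα, hα1, hε, hε1, hδ, hδ1, hΛ, hΛ1, hP ▸ RenyiEst.le_purity hρ heig,
    hP ▸ RenyiEst.purity_le_one hρ⟩
  refine ⟨I.runProb_isDistribution hI.fNorm_pos (fun p _ => hI.outcomeProb_steps hρ p)
    (fun _ => RenyiEst.abs_meanOutcome_le_one hρ _ _), hI.success hρ heig hP, fun ω => ?_⟩
  have h1 := hI.copies_le ω
  have h2 := hI.gates_le hn ω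
  rw [← one_mul (I.ratio ^ 5), RenyiEst.Input.Valid.ratio_pow, one_mul] at h1
  rw [RenyiEst.Input.Valid.ratio_pow] at h2
  constructor
  · intro h
    rw [hI.traceBound_pow h, hP] at h1 h2
    exact ⟨mod_cast h1, mod_cast h2⟩
  · intro h
    rw [RenyiEst.Input.traceBound, if_pos h, hP] at h1 h2
    exact ⟨h1, h2⟩
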